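/- Let $R$ be a finitely generated commutative $\mathbb C$-algebra (not necessarily reduced) with a Poisson bracket, and $X=\operatorname{Specm} R$ its set of $\mathbb C$-points with the Zariski topology. Let $J_\infty R$ be the differential $\mathbb C$-algebra, with derivation $T$, universal among differential $\mathbb C$-algebras receiving an algebra homomorphism from $R$; its $\mathbb C$-points form the arc space $J_\infty X$ (again with the Zariski topology), that is, the set of arcs $\operatorname{Spec}\mathbb C[[t]]\to\operatorname{Spec} R$. Equip $J_\infty R$ with its unique vertex Poisson algebra structure with $a_{(0)}b=\{a,b\}$ and $a_{(n)}b=0$ for $a,b\in R$, $n>0$. An ideal $I$ of $J_\infty R$ is *chiral Poisson* if $a_{(n)}I\subset I$ for all $a\in J_\infty R$, $n\ge 0$. The *symplectic core* $\mathscr C_X(x)$ of $x\in X$ is the set of $y\in X$ such that the biggest Poisson ideals of $R$ contained in the maximal ideals $\mathfrak m_x$ and $\mathfrak m_y$ coincide. The *chiral symplectic core* $\mathscr C_{J_\infty X}(y)$ of $y\in J_\infty X$ is defined in the same way, with chiral Poisson ideals of $J_\infty R$. For $x\in X$, let $x_\infty\in J_\infty X$ be the constant arc at $x$. For $S\subset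 X$ locally closed, with its reduced structure, $J_\infty S\subset J_\infty X$ is the set of arcs that factor through $S$. The symplectic leaf through $x\in X$ is the set of points that can be reached from $x$ along finitely many (holomorphic) integral curves of Hamiltonian vector fields $\{a,-\}$, $a\in R$. **Theorem.** Assume that $X$ has only finitely many symplectic leaves. Then each irreducible component of $J_\infty X$ is the closure of some chiral symplectic core. More precisely, let $X_1,\dots,X_r$ be the irreducible components of $X$. Then the irreducible components of $J_\infty X$ are the sets $J_\infty X_1,\dots,J_\infty X_r$. For each $i$ there is $x_i\in X_i$ with $X_i=\overline{\mathscr C_X(x_i)}$; and for every $x_i\in X$ with this property, $\mathscr C_X(x_i)$ is locally closed in $X$ and $$J_\infty X_i=\overline{J_\infty\mathscr C_X(x_i)}=\overline{\mathscr C_{J_\infty X}(x_{i,\infty})}.$$ -/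

import Mathlib

namespace ArcPoisson

noncomputable section

/-- A Poisson algebra structure over `ℂ` on a commutative `ℂ`-algebra `R`. The bracket `{a, b}` is
`bracket a b` (the commutator notation `⁅a, b⁆` of Mathlib would denote `a * b - b * a = 0`). -/
class PoissonAlgebra (R : Type*) [CommRing R] [Algebra ℂ R] where
  bracket : R →ₗ[ℂ] R →ₗ[ℂ] R
  bracket_self : ∀ a, bracket a a = 0
  leibniz : ∀ a b c, bracket a (b * c) = bracket a b * c + b * bracket a c
  jacobi : ∀ a b c,
    bracket a (bracket b c) = bracket (bracket a b) c + bracket b (bracket a c)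

section ArcAlgebra

variable (R : Type*) [CommRing R] [Algebra ℂ R]

/-- The polynomial ring on the variables `T^j a` (`a ∈ R`, `j ≥ 0`), written `X (a, j)`, is the free
differential `ℂ`-algebra on the set `R`; this is its derivation `T^j a ↦ T^(j+1) a`. -/
def freeT : Derivation ℂ (MvPolynomial (R × ℕ) ℂ) (MvPolynomial (R × ℕ) ℂ) :=
  MvPolynomial.mkDerivation ℂ fun p => MvPolynomial.X (p.1, p.2 + 1)

/-- The relations between the elements of the `ℂ`-algebra `R`. -/
def baseRel : Set (MvPolynomial (R × ℕ) ℂ) :=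
  {r | (∃ a b : R, r = .X (a + b, 0) - .X (a, 0) - .X (b, 0)) ∨
    (∃ a b : R, r = .X (a * b, 0) - .X (a, 0) * .X (b, 0)) ∨
    (∃ c : ℂ, r = .X (algebraMap ℂ R c, 0) - .C c)}

/-- The ideal generated by all `T^j r`, for `r` a relation of `R`. -/
def relIdeal : Ideal (MvPolynomial (R × ℕ) ℂ) :=
  Ideal.span {p | ∃ j : ℕ, ∃ r ∈ baseRel R, p = (freeT R)^[j] r}

/-- The coordinate ring `J_∞ R` of the arc space `J_∞ X` of `X = Spec R`: generators `T^j a`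
(`a ∈ R`), modulo all `T^j` of the relations of `R`. See `Arc.lift` for its universal property. -/
def Arc : Type _ := MvPolynomial (R × ℕ) ℂ ⧸ relIdeal R

instance : CommRing (Arc R) := inferInstanceAs (CommRing (_ ⧸ relIdeal R))
instance : Algebra ℂ (Arc R) := inferInstanceAs (Algebra ℂ (_ ⧸ relIdeal R))

namespace Arc

open Finset.HasAntidiagonal (antidiagonal mem_antidiagonal)

/-- The quotient map. -/
def mk : MvPolynomial (R × ℕ) ℂ →ₐ[ℂ] Arc R := Ideal.Quotient.mkₐ ℂ (relIdeal R)

variable {R}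

theorem mk_surjective : Function.Surjective (mk R) := Ideal.Quotient.mkₐ_surjective ℂ _

theorem mk_eq_zero {p : MvPolynomial (R × ℕ) ℂ} : mk R p = 0 ↔ p ∈ relIdeal R :=
  Ideal.Quotient.eq_zero_iff_mem

theorem freeT_mem {p : MvPolynomial (R × ℕ) ℂ} (hp : p ∈ relIdeal R) :
    freeT R p ∈ relIdeal R := by
  induction hp using Submodule.span_induction with
  | mem x hx =>
    obtain ⟨j, r, hr, rfl⟩ := hx
    exact Ideal.subset_span ⟨j + 1, r, hr, (Function.iterate_succ_apply' _ _ _).symm⟩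
  | zero => simp
  | add x y _ _ hx hy => rw [map_add]; exact add_mem hx hy
  | smul a x hx' hx =>
    rw [smul_eq_mul, Derivation.leibniz, smul_eq_mul, smul_eq_mul]
    exact add_mem (Ideal.mul_mem_left _ _ hx) (Ideal.mul_mem_right _ _ hx')

/-- The derivation `T` of `J_∞ R`. -/
def T : Derivation ℂ (Arc R) (Arc R) :=
  Derivation.liftOfSurjective (f := mk R) mk_surjective (d := freeT R) fun _ hx =>
    mk_eq_zero.2 (freeT_mem (mk_eq_zero.1 hx))

theorem T_mk (p : MvPolynomial (R × ℕ) ℂ) : T (mk R p) = mk R (freeT R p) :=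
  Derivation.liftOfSurjective_apply mk_surjective
    (fun _ hx => mk_eq_zero.2 (freeT_mem (mk_eq_zero.1 hx))) p

/-- The canonical homomorphism `R → J_∞ R`. -/
def ι : R →ₐ[ℂ] Arc R :=
  have h {p} (hp : p ∈ baseRel R) : mk R p = 0 :=
    mk_eq_zero.2 (Ideal.subset_span ⟨0, p, hp, rfl⟩)
  have hadd (a b : R) : mk R (.X (a + b, 0)) = mk R (.X (a, 0)) + mk R (.X (b, 0)) := by
    have := h (.inl ⟨a, b, rfl⟩)
    rwa [map_sub, map_sub, sub_sub, sub_eq_zero] at this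
  have hmul (a b : R) : mk R (.X (a * b, 0)) = mk R (.X (a, 0)) * mk R (.X (b, 0)) := by
    have := h (.inr (.inl ⟨a, b, rfl⟩))
    rwa [map_sub, map_mul, sub_eq_zero] at this
  have halg (c : ℂ) : mk R (.X (algebraMap ℂ R c, 0)) = algebraMap ℂ (Arc R) c := by
    have := h (.inr (.inr ⟨c, rfl⟩))
    rw [map_sub, sub_eq_zero] at this
    exact this.trans ((mk R).commutes c)
  { toFun a := mk R (.X (a, 0))
    map_one' := by simpa using halg 1
    map_zero' := by simpa using halg 0
    map_add' := hadd
    map_mul' := hmul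
    commutes' := halg }

theorem mk_X (a : R) (j : ℕ) : mk R (.X (a, j)) = T^[j] (ι a) := by
  induction j with
  | zero => rfl
  | succ j ih =>
    rw [Function.iterate_succ_apply', ← ih, T_mk, freeT, MvPolynomial.mkDerivation_X]

@[elab_as_elim]
theorem induction {p : Arc R → Prop} (hι : ∀ a, p (ι a)) (hT : ∀ u, p u → p (T u))
    (hadd : ∀ u v, p u → p v → p (u + v)) (hmul : ∀ u v, p u → p v → p (u * v))
    (u : Arc R) : p u := by
  obtain ⟨q, rfl⟩ := mk_surjective u
  induction q using MvPolynomial.induction_on with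
  | C c =>
    have : mk R (.C c) = ι (algebraMap ℂ R c) := by
      rw [AlgHom.commutes]; exact (mk R).commutes c
    rw [this]; exact hι _
  | add f g hf hg => rw [map_add]; exact hadd _ _ hf hg
  | mul_X f n hf =>
    rw [map_mul]
    refine hmul _ _ hf ?_
    obtain ⟨a, j⟩ := n
    rw [mk_X]
    induction j with
    | zero => exact hι a
    | succ j ih => rw [Function.iterate_succ_apply']; exact hT _ ih

section lift
variable {A : Type*} [CommRing A] [Algebra ℂ A] (D : Derivation ℂ A A) (f : R →ₐ[ℂ] A)

/-- The homomorphism `T^j a ↦ D^j (f a)` on the free differential algebra. -/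
def liftAux : MvPolynomial (R × ℕ) ℂ →ₐ[ℂ] A := MvPolynomial.aeval fun p => D^[p.2] (f p.1)

theorem liftAux_freeT (p : MvPolynomial (R × ℕ) ℂ) :
    liftAux D f (freeT R p) = D (liftAux D f p) := by
  induction p using MvPolynomial.induction_on with
  | C c => simp [liftAux, freeT]
  | add p q hp hq => simp [hp, hq]
  | mul_X p n hp =>
    simp only [Derivation.leibniz, smul_eq_mul, map_add, map_mul, hp]
    simp [freeT, liftAux, Function.iterate_succ_apply']

/-- The universal property: a homomorphism `f` from `R` to a differential algebra `(A, D)` extends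
to a homomorphism of differential algebras `J_∞ R → A`. -/
def lift : Arc R →ₐ[ℂ] A :=
  Ideal.Quotient.liftₐ (relIdeal R) (liftAux D f) fun p hp => by
    induction hp using Submodule.span_induction with
    | mem x hx =>
      obtain ⟨j, r, hr, rfl⟩ := hx
      have : liftAux D f r = 0 := by
        obtain ⟨a, b, rfl⟩ | ⟨a, b, rfl⟩ | ⟨c, rfl⟩ := hr <;> simp [liftAux]
      have h2 : ∀ j, liftAux D f ((freeT R)^[j] r) = 0 := fun j => by
        induction j with
        | zero => exact this
        | succ j ih => rw [Function.iterate_succ_apply', liftAux_freeT, ih, map_zero]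
      exact h2 j
    | zero => exact map_zero _
    | add x y _ _ hx hy => rw [map_add, hx, hy, add_zero]
    | smul a x _ hx => rw [smul_eq_mul, map_mul, hx, mul_zero]

theorem lift_mk (p : MvPolynomial (R × ℕ) ℂ) : lift D f (mk R p) = liftAux D f p := rfl

theorem lift_ι (a : R) : lift D f (ι a) = f a := by
  change liftAux D f (.X (a, 0)) = f a
  simp [liftAux]

theorem lift_T (u : Arc R) : lift D f (T u) = D (lift D f u) := by
  obtain ⟨p, rfl⟩ := mk_surjective u
  rw [T_mk, lift_mk, lift_mk, liftAux_freeT]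

end lift

section liftDer
variable {M : Type*} [AddCommGroup M] [Module ℂ M] [Module (Arc R) M] [IsScalarTower ℂ (Arc R) M]

theorem exists_liftDer
    (δ : M →ₗ[ℂ] M) (hδ : ∀ (v : Arc R) (m : M), δ (v • m) = T v • m + v • δ m)
    (d : R →ₗ[ℂ] M) (hd : ∀ a b, d (a * b) = ι a • d b + ι b • d a) : ∃ D : Derivation ℂ (Arc R) M,
    (∀ a, D (ι a) = d a) ∧ ∀ u, D (T u) = δ (D u) := by
  let : Module (Arc R)ᵐᵒᵖ M := Module.compHom _ ((RingHom.id (Arc R)).fromOpposite mul_comm)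
  have : IsCentralScalar (Arc R) M := ⟨fun _ _ => rfl⟩
  have : IsScalarTower ℂ (Arc R)ᵐᵒᵖ M := ⟨fun c v m => smul_assoc c v.unop m⟩
  let E : Derivation ℂ (TrivSqZeroExt (Arc R) M) (TrivSqZeroExt (Arc R) M) := Derivation.mk'
    { toFun x := .inl (T x.fst) + .inr (δ x.snd)
      map_add' x y := by ext <;> simp
      map_smul' c x := by ext <;> simp }
    (by
      intro x y
      ext
      · simp [Derivation.leibniz]
      · simp [hδ]; abel)
  have hd1 : d 1 = 0 := by simpa using hd 1 1
  let f : R →ₐ[ℂ] TrivSqZeroExt (Arc R) M := AlgHom.ofLinearMap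
    { toFun a := .inl (ι a) + .inr (d a)
      map_add' a b := by ext <;> simp
      map_smul' c a := by ext <;> simp }
    (by ext <;> simp [hd1])
    (by intro a b; ext <;> simp [hd])
  have hfst : ∀ u, (lift E f u).fst = u := fun u => by
    induction u using Arc.induction with
    | hι a => rw [lift_ι]; simp [f]
    | hT u hu => rw [lift_T]; simp [E, hu]
    | hadd u v hu hv => simp [hu, hv]
    | hmul u v hu hv => simp [hu, hv]
  refine ⟨Derivation.mk'
    { toFun u := (lift E f u).snd
      map_add' u v := by simp
      map_smul' c u := by simp } ?_, ?_, ?_⟩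
  · intro u v; simp [hfst]
  · intro a; simp [lift_ι, f]
  · intro u; simp [lift_T, E]

end liftDer

/-- Divided powers `T^i u / i!`. -/
def E (i : ℕ) : Arc R →ₗ[ℂ] Arc R := ((i.factorial : ℂ)⁻¹) • (T : Derivation ℂ (Arc R) (Arc R)).toLinearMap ^ i

theorem E_zero (u : Arc R) : E 0 u = u := by simp [E]

theorem T_E (i : ℕ) (u : Arc R) : T (E i u) = (i + 1 : ℂ) • E (i + 1) u := by
  have : (i + 1 : ℂ) ≠ 0 := by exact_mod_cast i.succ_ne_zero
  simp only [E, LinearMap.smul_apply, Derivation.map_smul, pow_succ', Module.End.mul_apply, smul_smul,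
    Nat.factorial_succ, Nat.cast_mul, Nat.cast_succ, mul_inv, mul_inv_cancel_left₀ this]
  rfl

theorem E_T (i : ℕ) (u : Arc R) : E i (T u) = (i + 1 : ℂ) • E (i + 1) u := by
  rw [← T_E]
  simp only [E, LinearMap.smul_apply, Derivation.map_smul]
  congr 1
  change _ = (T : Derivation ℂ (Arc R) (Arc R)).toLinearMap _
  rw [← Module.End.mul_apply, ← pow_succ', pow_succ]
  rfl

theorem sum_antidiagonal_split {M : Type*} [AddCommGroup M] [Module ℂ M] (m : ℕ)
    (g : ℕ → ℕ → M) : (m + 1 : ℂ) • ∑ p ∈ antidiagonal (m + 1), g p.1 p.2 =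
      ∑ p ∈ antidiagonal m, (p.1 + 1 : ℂ) • g (p.1 + 1) p.2 +
      ∑ p ∈ antidiagonal m, (p.2 + 1 : ℂ) • g p.1 (p.2 + 1) := by
  have : ∀ p ∈ antidiagonal (m + 1), (m + 1 : ℂ) • g p.1 p.2 =
      (p.1 : ℂ) • g p.1 p.2 + (p.2 : ℂ) • g p.1 p.2 := fun p hp => by
    rw [← add_smul]; congr 1; exact_mod_cast (mem_antidiagonal.1 hp).symm
  rw [Finset.smul_sum, Finset.sum_congr rfl this, Finset.sum_add_distrib,
    Finset.Nat.sum_antidiagonal_succ (f := fun p => (p.1 : ℂ) • g p.1 p.2),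
    Finset.Nat.sum_antidiagonal_succ' (f := fun p => (p.2 : ℂ) • g p.1 p.2)]
  simp

theorem E_mul (m : ℕ) (u v : Arc R) : E m (u * v) = ∑ p ∈ antidiagonal m, E p.1 u * E p.2 v := by
  induction m with
  | zero => simp [E_zero]
  | succ m ih =>
    have hm : (m + 1 : ℂ) ≠ 0 := by exact_mod_cast m.succ_ne_zero
    apply smul_right_injective _ hm
    change (m + 1 : ℂ) • _ = (m + 1 : ℂ) • _
    rw [← T_E, ih, map_sum, sum_antidiagonal_split m fun i j => E i u * E j v,
      ← Finset.sum_add_distrib]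
    refine Finset.sum_congr rfl fun p _ => ?_
    simp [Derivation.leibniz, T_E, add_comm, mul_comm]

variable (R) in
/-- Finite sequences `(s_n)` in `J_∞ R`, standing for `∑ s_n z^(-n-1)`. The module structure over
`J_∞ R` given below is `(b • s)_n = ∑ i, (T^i b / i!) s_(n+i)`, so that the right Leibniz rule says
that `a ↦ (a_(n) c)_n` is a derivation. -/
def Tail : Type _ := ℕ →₀ Arc R

namespace Tail
instance : AddCommGroup (Tail R) := inferInstanceAs (AddCommGroup (ℕ →₀ Arc R))
instance : Module ℂ (Tail R) := inferInstanceAs (Module ℂ (ℕ →₀ Arc R))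

/-- The sequence with one term `v` in place `n`. -/
def single (n : ℕ) : Arc R →ₗ[ℂ] Tail R := Finsupp.lsingle n

/-- The `n`-th term. -/
def coeff (n : ℕ) : Tail R →ₗ[ℂ] Arc R := Finsupp.lapply n

/-- Linear maps out of the space of finite sequences. -/
def lsum {M : Type*} [AddCommGroup M] [Module ℂ M] (f : ℕ → Arc R →ₗ[ℂ] M) : Tail R →ₗ[ℂ] M :=
  Finsupp.lsum ℂ f

theorem lsum_single {M : Type*} [AddCommGroup M] [Module ℂ M] (f : ℕ → Arc R →ₗ[ℂ] M) (n : ℕ)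
    (v : Arc R) : lsum f (single n v) = f n v := by
  exact Finsupp.lsum_single (S := ℂ) f n v

theorem hom_ext {M : Type*} [AddCommGroup M] [Module ℂ M] {f g : Tail R →ₗ[ℂ] M}
    (h : ∀ n v, f (single n v) = g (single n v)) (s : Tail R) : f s = g s := by
  have : f = g := Finsupp.lhom_ext h
  rw [this]

/-- The twisted action of `J_∞ R` on sequences. -/
def act : Arc R →ₗ[ℂ] Tail R →ₗ[ℂ] Tail R :=
  LinearMap.mk₂ ℂ (fun b s => lsum (fun m => ∑ p ∈ antidiagonal m,
      single p.2 ∘ₗ LinearMap.mulLeft ℂ (E p.1 b)) s)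
    (fun b b' s => by
      rw [← LinearMap.add_apply]
      refine hom_ext (fun n v => ?_) s
      simp [lsum_single, add_mul, Finset.sum_add_distrib])
    (fun c b s => by
      rw [← LinearMap.smul_apply]
      refine hom_ext (fun n v => ?_) s
      simp [lsum_single, Finset.smul_sum])
    (fun b s s' => map_add _ _ _)
    (fun c b s => map_smul _ _ _)

theorem act_single (b : Arc R) (m : ℕ) (v : Arc R) :
    act b (single m v) = ∑ p ∈ antidiagonal m, single p.2 (E p.1 b * v) := by
  simp [act, lsum_single]

theorem act_one (s : Tail R) : act 1 s = s := by
  refine hom_ext (g := LinearMap.id) (fun n v => ?_) s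
  have hE : ∀ i, E (i + 1) (1 : Arc R) = 0 := fun i => by
    have := E_T i (1 : Arc R)
    rw [Derivation.map_one_eq_zero, map_zero, eq_comm, smul_eq_zero] at this
    exact this.resolve_left (by exact_mod_cast i.succ_ne_zero)
  rw [act_single]
  cases n with
  | zero => simp [E_zero]
  | succ n => rw [Finset.Nat.sum_antidiagonal_succ]; simp [E_zero, hE]

theorem act_mul (b b' : Arc R) (s : Tail R) : act (b * b') s = act b (act b' s) := by
  refine hom_ext (g := act b ∘ₗ act b') (fun n v => ?_) s
  simp only [LinearMap.comp_apply, act_single, map_sum, E_mul, Finset.sum_mul, Finset.sum_sigma']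
  refine Finset.sum_nbij' (fun x => ⟨(x.2.2, x.2.1 + x.1.2), (x.2.1, x.1.2)⟩)
    (fun x => ⟨(x.1.1 + x.2.1, x.2.2), (x.2.1, x.1.1)⟩) ?_ ?_ ?_ ?_ ?_ <;>
  · rintro ⟨⟨a, b⟩, ⟨c, d⟩⟩
    simp only [Finset.mem_sigma, mem_antidiagonal]
    rintro ⟨rfl, h⟩
    first
      | (simp only [mul_assoc])
      | (subst h; simp [add_comm, add_left_comm])

instance : Module (Arc R) (Tail R) where
  smul b s := act b s
  one_smul := act_one
  mul_smul := act_mul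
  smul_zero b := map_zero (act b)
  smul_add b := map_add (act b)
  add_smul b b' s := by change act (b + b') s = _; rw [map_add]; rfl
  zero_smul s := by change act 0 s = _; rw [map_zero]; rfl

theorem smul_def (b : Arc R) (s : Tail R) : b • s = act b s := rfl

instance : IsScalarTower ℂ (Arc R) (Tail R) :=
  ⟨fun c b s => by simp [smul_def]⟩

theorem smul_single (b : Arc R) (m : ℕ) (v : Arc R) :
    b • single m v = ∑ p ∈ antidiagonal m, single p.2 (E p.1 b * v) := act_single b m v

/-- The operator `(c_n) ↦ (n c_{n-1})`. -/
def raise : Tail R →ₗ[ℂ] Tail R := lsum fun m => (m + 1 : ℂ) • single (m + 1)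

theorem raise_single (m : ℕ) (v : Arc R) : raise (single m v) = (m + 1 : ℂ) • single (m + 1) v := by
  simp [raise, lsum_single]

/-- Termwise application of a linear endomorphism. -/
def map (f : Arc R →ₗ[ℂ] Arc R) : Tail R →ₗ[ℂ] Tail R := lsum fun m => single m ∘ₗ f

theorem map_single (f : Arc R →ₗ[ℂ] Arc R) (m : ℕ) (v : Arc R) :
    map f (single m v) = single m (f v) := by
  simp [map, lsum_single]

theorem coeff_single (n m : ℕ) (v : Arc R) : coeff n (single m v) = if m = n then v else 0 :=
  Finsupp.single_apply

theorem coeff_map (n : ℕ) (f : Arc R →ₗ[ℂ] Arc R) (s : Tail R) :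
    coeff n (map f s) = f (coeff n s) :=
  hom_ext (f := coeff n ∘ₗ map f) (g := f ∘ₗ coeff n) (fun m v => by
    simp only [LinearMap.comp_apply, map_single, coeff_single]
    split_ifs <;> simp) s

theorem coeff_raise (n : ℕ) (s : Tail R) : coeff n (raise s) = (n : ℂ) • coeff (n - 1) s :=
  hom_ext (f := coeff n ∘ₗ raise) (g := (n : ℂ) • coeff (n - 1)) (fun m v => by
    simp only [LinearMap.comp_apply, LinearMap.smul_apply, raise_single, map_smul, coeff_single]
    cases n with
    | zero => simp
    | succ n => by_cases h : m = n <;> simp [h]) s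

theorem exists_coeff_eq_zero (s : Tail R) : ∃ N, ∀ n ≥ N, coeff n s = 0 := by
  refine ⟨(Finsupp.support (s : ℕ →₀ Arc R)).sup id + 1, fun n hn => ?_⟩
  by_contra h
  have := Finset.le_sup (f := id) (Finsupp.mem_support_iff.2 h)
  simp only [id] at this
  omega

theorem induction {p : Tail R → Prop} (h0 : p 0) (hadd : ∀ s t, p s → p t → p (s + t))
    (hs : ∀ n v, p (single n v)) (s : Tail R) : p s :=
  Finsupp.induction_linear (motive := p) s h0 hadd hs

theorem coeff_smul (n : ℕ) (b : Arc R) (s : Tail R) : ∃ N₀, ∀ N ≥ N₀,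
    coeff n (b • s) = ∑ i ∈ Finset.range N, E i b * coeff (n + i) s := by
  induction s using Tail.induction with
  | h0 => exact ⟨0, fun N _ => by simp⟩
  | hadd s t hs ht =>
    obtain ⟨N₁, h₁⟩ := hs
    obtain ⟨N₂, h₂⟩ := ht
    refine ⟨max N₁ N₂, fun N hN => ?_⟩
    simp only [smul_add, map_add, mul_add, Finset.sum_add_distrib]
    rw [← h₁ N (le_of_max_le_left hN), ← h₂ N (le_of_max_le_right hN)]
  | hs m v =>
    refine ⟨m + 1, fun N hN => ?_⟩
    simp only [smul_single, map_sum, coeff_single, mul_ite, mul_zero]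
    rw [← Finset.sum_filter, ← Finset.sum_filter]
    refine Finset.sum_nbij' (fun p => p.1) (fun i => (i, n)) ?_ ?_ ?_ ?_ ?_
    · rintro ⟨i, j⟩ h
      simp only [Finset.mem_filter, mem_antidiagonal, Finset.mem_range] at h ⊢
      omega
    · intro i h
      simp only [Finset.mem_filter, mem_antidiagonal, Finset.mem_range, and_true] at h ⊢
      omega
    · rintro ⟨i, j⟩ h
      simp only [Finset.mem_filter] at h
      rw [h.2]
    · intro i _; rfl
    · intro p _; rfl

theorem raise_smul (b : Arc R) (s : Tail R) : -raise (b • s) = T b • s + b • -raise s := by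
  have := hom_ext (f := raise ∘ₗ act b + act (T b)) (g := act b ∘ₗ raise) (fun m v => by
    have := sum_antidiagonal_split m fun i j => single j (E i b * v)
    simp [act_single, raise_single, E_T, this, add_comm]) s
  simp only [LinearMap.add_apply, LinearMap.comp_apply] at this
  simp only [smul_def, map_neg, ← this]
  abel

theorem map_T_add_raise_smul (b : Arc R) (s : Tail R) :
    map T.toLinearMap (b • s) + raise (b • s) = b • (map T.toLinearMap s + raise s) :=
  hom_ext (f := map T.toLinearMap ∘ₗ act b + raise ∘ₗ act b)
    (g := act b ∘ₗ (map T.toLinearMap + raise)) (fun m v => by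
    have := sum_antidiagonal_split m fun i j => single j (E i b * v)
    simp [act_single, raise_single, map_single, Derivation.leibniz, T_E, this,
      Finset.sum_add_distrib, mul_comm v]
    abel) s

theorem map_mul_smul (b v : Arc R) (s : Tail R) :
    map (LinearMap.mulLeft ℂ v) (b • s) = b • map (LinearMap.mulLeft ℂ v) s :=
  hom_ext (f := map (LinearMap.mulLeft ℂ v) ∘ₗ act b)
    (g := act b ∘ₗ map (LinearMap.mulLeft ℂ v)) (fun m v => by
    simp [act_single, map_single, mul_left_comm]) s

end Tail


variable (R) in
/-- The same space, with the termwise action `(b • s)_n = b s_n`. -/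
def PTail : Type _ := Tail R

namespace PTail
instance : AddCommGroup (PTail R) := inferInstanceAs (AddCommGroup (Tail R))
instance : Module ℂ (PTail R) := inferInstanceAs (Module ℂ (Tail R))

/-- The identity, forgetting the action. -/
def toTail : PTail R ≃ₗ[ℂ] Tail R := LinearEquiv.refl ℂ (Tail R)

/-- The identity, in the other direction. -/
def ofTail : Tail R ≃ₗ[ℂ] PTail R := toTail.symm

@[simp] theorem toTail_ofTail (s : Tail R) : toTail (ofTail s) = s := rfl

instance : Module (Arc R) (PTail R) where
  smul b s := ofTail (Tail.map (LinearMap.mulLeft ℂ b) (toTail s))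
  one_smul s := Tail.hom_ext (f := Tail.map (LinearMap.mulLeft ℂ 1)) (g := LinearMap.id)
    (fun m v => by simp [Tail.map_single]) (toTail s)
  mul_smul b b' s := Tail.hom_ext (f := Tail.map (LinearMap.mulLeft ℂ (b * b')))
    (g := Tail.map (LinearMap.mulLeft ℂ b) ∘ₗ Tail.map (LinearMap.mulLeft ℂ b'))
    (fun m v => by simp [Tail.map_single]) (toTail s)
  smul_zero b := map_zero (Tail.map (LinearMap.mulLeft ℂ b))
  smul_add b s s' := map_add (Tail.map (LinearMap.mulLeft ℂ b)) (toTail s) (toTail s')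
  add_smul b b' s := Tail.hom_ext (f := Tail.map (LinearMap.mulLeft ℂ (b + b')))
    (g := Tail.map (LinearMap.mulLeft ℂ b) + Tail.map (LinearMap.mulLeft ℂ b'))
    (fun m v => by simp [Tail.map_single, add_mul]) (toTail s)
  zero_smul s := Tail.hom_ext (f := Tail.map (LinearMap.mulLeft ℂ 0)) (g := 0)
    (fun m v => by simp [Tail.map_single]) (toTail s)

theorem toTail_smul (b : Arc R) (s : PTail R) :
    toTail (b • s) = Tail.map (LinearMap.mulLeft ℂ b) (toTail s) := rfl

instance : IsScalarTower ℂ (Arc R) (PTail R) :=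
  ⟨fun c b s => Tail.hom_ext (f := Tail.map (LinearMap.mulLeft ℂ (c • b)))
    (g := c • Tail.map (LinearMap.mulLeft ℂ b))
    (fun m v => by simp [Tail.map_single]) (toTail s)⟩

/-- The operator `(c_n) ↦ (T c_n + n c_{n-1})`. -/
def shiftT : PTail R →ₗ[ℂ] PTail R :=
  ofTail.toLinearMap ∘ₗ (Tail.map T.toLinearMap + Tail.raise) ∘ₗ toTail.toLinearMap

theorem toTail_shiftT (s : PTail R) :
    toTail (shiftT s) = Tail.map T.toLinearMap (toTail s) + Tail.raise (toTail s) := rfl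

theorem shiftT_smul (b : Arc R) (s : PTail R) : shiftT (b • s) = T b • s + b • shiftT s :=
  Tail.hom_ext (f := (Tail.map T.toLinearMap + Tail.raise) ∘ₗ Tail.map (LinearMap.mulLeft ℂ b))
    (g := Tail.map (LinearMap.mulLeft ℂ (T b)) +
      Tail.map (LinearMap.mulLeft ℂ b) ∘ₗ (Tail.map T.toLinearMap + Tail.raise))
    (fun m w => by
      have hT (u : Arc R) : T.toLinearMap u = T u := rfl
      simp only [LinearMap.comp_apply, LinearMap.add_apply, Tail.map_single, Tail.raise_single,
        LinearMap.mulLeft_apply, hT,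
        Derivation.leibniz, smul_eq_mul, map_add, map_smul, mul_comm w]
      abel) (toTail s)

end PTail

section products
variable [PoissonAlgebra R]
open PoissonAlgebra PTail

theorem exists_baseProd : ∃ D : Derivation ℂ (Arc R) (R →ₗ[ℂ] PTail R),
    (∀ y x, D (ι y) x = ofTail (Tail.single 0 (ι (bracket x y)))) ∧
    ∀ u x, D (T u) x = shiftT (D u x) := by
  let δ : (R →ₗ[ℂ] PTail R) →ₗ[ℂ] (R →ₗ[ℂ] PTail R) :=
    { toFun φ := shiftT ∘ₗ φ
      map_add' φ ψ := LinearMap.comp_add _ _ _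
      map_smul' c φ := LinearMap.comp_smul _ _ _ }
  let d : R →ₗ[ℂ] (R →ₗ[ℂ] PTail R) :=
    ((bracket (R := R)).compr₂ (ofTail.toLinearMap ∘ₗ Tail.single 0 ∘ₗ ι.toLinearMap)).flip
  obtain ⟨D, h1, h2⟩ := exists_liftDer δ (fun v φ => LinearMap.ext fun x =>
    shiftT_smul v (φ x)) d (fun a b => LinearMap.ext fun x => by
      change Tail.single 0 (ι (bracket x (a * b))) =
        Tail.map (LinearMap.mulLeft ℂ (ι a)) (Tail.single 0 (ι (bracket x b))) +
        Tail.map (LinearMap.mulLeft ℂ (ι b)) (Tail.single 0 (ι (bracket x a)))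
      rw [Tail.map_single, Tail.map_single, ← map_add, leibniz, map_add, map_mul, map_mul,
        LinearMap.mulLeft_apply, LinearMap.mulLeft_apply, add_comm, mul_comm (ι b)])
  exact ⟨D, fun y x => by rw [h1]; rfl, fun u x => by rw [h2]; rfl⟩

/-- For `x ∈ R`, `c ∈ J_∞ R`, the sequence `n ↦ x_(n) c`. -/
def baseProd : Derivation ℂ (Arc R) (R →ₗ[ℂ] PTail R) := exists_baseProd.choose

theorem baseProd_ι (x y : R) : toTail (baseProd (ι y) x) = Tail.single 0 (ι (bracket x y)) := by
  rw [baseProd, exists_baseProd.choose_spec.1]; rfl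

theorem baseProd_T (u : Arc R) (x : R) : baseProd (T u) x = shiftT (baseProd u x) :=
  exists_baseProd.choose_spec.2 u x

theorem baseProd_mul (u v : Arc R) (x : R) : toTail (baseProd (u * v) x) =
    Tail.map (LinearMap.mulLeft ℂ u) (toTail (baseProd v x)) +
    Tail.map (LinearMap.mulLeft ℂ v) (toTail (baseProd u x)) := by
  rw [Derivation.leibniz]; rfl

theorem bracket_mul_left (a b c : R) : bracket (a * b) c = a * bracket b c + b * bracket a c := by
  have h (x y : R) : bracket x y = -bracket y x := by
    have := bracket_self (x + y)
    simp only [map_add, LinearMap.add_apply, bracket_self, zero_add, add_zero] at this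
    exact eq_neg_of_add_eq_zero_right (by rw [add_comm] ; exact (add_comm _ _).trans this)
  rw [h, leibniz, h c a, h c b]; ring

theorem baseProd_mul_left (a b : R) (c : Arc R) : toTail (baseProd c (a * b)) =
    ι a • toTail (baseProd c b) + ι b • toTail (baseProd c a) := by
  induction c using Arc.induction with
  | hι y => simp [baseProd_ι, Tail.smul_single, E_zero, bracket_mul_left]
  | hT u hu =>
    simp only [baseProd_T, toTail_shiftT, hu, map_add]
    rw [← Tail.map_T_add_raise_smul, ← Tail.map_T_add_raise_smul]
    abel
  | hadd u v hu hv => simp [hu, hv]; abel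
  | hmul u v hu hv =>
    simp only [baseProd_mul, hu, hv, map_add, Tail.map_mul_smul, smul_add]
    abel

theorem exists_prodTail : ∃ F : Derivation ℂ (Arc R) (Arc R →ₗ[ℂ] Tail R),
    (∀ x c, F (ι x) c = toTail (baseProd c x)) ∧ ∀ u c, F (T u) c = -Tail.raise (F u c) := by
  let δ : (Arc R →ₗ[ℂ] Tail R) →ₗ[ℂ] (Arc R →ₗ[ℂ] Tail R) :=
    { toFun φ := (-Tail.raise) ∘ₗ φ
      map_add' φ ψ := LinearMap.comp_add _ _ _
      map_smul' c φ := LinearMap.comp_smul _ _ _ }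
  let d : R →ₗ[ℂ] (Arc R →ₗ[ℂ] Tail R) :=
    (baseProd.toLinearMap.compr₂ toTail.toLinearMap).flip
  obtain ⟨D, h1, h2⟩ := exists_liftDer δ (fun v φ => LinearMap.ext fun x =>
    Tail.raise_smul v (φ x)) d (fun a b => LinearMap.ext fun c => baseProd_mul_left a b c)
  exact ⟨D, fun y x => by rw [h1]; rfl, fun u x => by rw [h2]; rfl⟩

/-- The sequence `n ↦ a_(n) c`, for `a c ∈ J_∞ R`. -/
def prodTail : Derivation ℂ (Arc R) (Arc R →ₗ[ℂ] Tail R) := exists_prodTail.choose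

theorem prodTail_ι (x : R) (c : Arc R) : prodTail (ι x) c = toTail (baseProd c x) :=
  exists_prodTail.choose_spec.1 x c

theorem prodTail_T (u c : Arc R) : prodTail (T u) c = -Tail.raise (prodTail u c) :=
  exists_prodTail.choose_spec.2 u c

theorem prodTail_mul (u v c : Arc R) :
    prodTail (u * v) c = u • prodTail v c + v • prodTail u c := by
  rw [Derivation.leibniz]; rfl

theorem prodTail_mul_right (u b c : Arc R) : prodTail u (b * c) =
    Tail.map (LinearMap.mulLeft ℂ b) (prodTail u c) +
    Tail.map (LinearMap.mulLeft ℂ c) (prodTail u b) := by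
  induction u using Arc.induction with
  | hι x => simp only [prodTail_ι, baseProd_mul]
  | hT u hu =>
    have h (v : Arc R) (s : Tail R) : Tail.map (LinearMap.mulLeft ℂ v) (Tail.raise s) =
        Tail.raise (Tail.map (LinearMap.mulLeft ℂ v) s) :=
      Tail.hom_ext (f := Tail.map (LinearMap.mulLeft ℂ v) ∘ₗ Tail.raise)
        (g := Tail.raise ∘ₗ Tail.map (LinearMap.mulLeft ℂ v))
        (fun m w => by simp [Tail.map_single, Tail.raise_single]) s
    simp only [prodTail_T, hu, map_add, map_neg, h]; abel
  | hadd u v hu hv => simp [hu, hv]; abel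
  | hmul u v hu hv => 
    simp only [prodTail_mul, hu, hv, map_add, Tail.map_mul_smul, smul_add]
    abel

theorem prodTail_T_right (u c : Arc R) : prodTail u (T c) =
    Tail.map T.toLinearMap (prodTail u c) + Tail.raise (prodTail u c) := by
  induction u using Arc.induction with
  | hι x => simp only [prodTail_ι, baseProd_T, toTail_shiftT]
  | hT u hu =>
    have h (s : Tail R) : Tail.map T.toLinearMap (Tail.raise s) =
        Tail.raise (Tail.map T.toLinearMap s) :=
      Tail.hom_ext (f := Tail.map T.toLinearMap ∘ₗ Tail.raise)
        (g := Tail.raise ∘ₗ Tail.map T.toLinearMap)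
        (fun m w => by simp [Tail.map_single, Tail.raise_single]) s
    simp only [prodTail_T, hu, map_add, map_neg, h]; abel
  | hadd u v hu hv => simp [hu, hv]; abel
  | hmul u v hu hv =>
    simp only [prodTail_mul, hu, hv, ← Tail.map_T_add_raise_smul, map_add]
    abel

/-- The `n`-th products `a_(n) b`, `n ≥ 0`, of the vertex Poisson algebra `J_∞ R`. They are the
unique bilinear products with `x_(n) y = δ_{n,0} {x, y}` for `x y ∈ R` (`nprod_ι_ι`),
`(T a)_(n) = -n a_(n-1)` (`nprod_T_left`), and the two Leibniz rules
`a_(n) (b c) = (a_(n) b) c + b (a_(n) c)` (`nprod_mul_right`) and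
`(a b)_(n) c = ∑ i, (T^i b / i!) (a_(n+i) c) + (T^i a / i!) (b_(n+i) c)` (`nprod_mul_left`), with
`x_(n) (T c) = T (x_(n) c) + n x_(n-1) c` (`nprod_T_right`). -/
def nprod (n : ℕ) (a b : Arc R) : Arc R := Tail.coeff n (prodTail a b)

theorem nprod_ι_ι (n : ℕ) (x y : R) :
    nprod n (ι x) (ι y) = if n = 0 then ι (bracket x y) else 0 := by
  rw [nprod, prodTail_ι, baseProd_ι, Tail.coeff_single]
  simp [eq_comm]

theorem exists_nprod_eq_zero (a b : Arc R) : ∃ N, ∀ n ≥ N, nprod n a b = 0 :=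
  Tail.exists_coeff_eq_zero _

theorem nprod_mul_right (n : ℕ) (a b c : Arc R) :
    nprod n a (b * c) = nprod n a b * c + b * nprod n a c := by
  simp only [nprod, prodTail_mul_right, map_add, Tail.coeff_map, LinearMap.mulLeft_apply]
  ring

theorem nprod_T_left (n : ℕ) (a b : Arc R) :
    nprod n (T a) b = -((n : ℂ) • nprod (n - 1) a b) := by
  simp only [nprod, prodTail_T, map_neg, Tail.coeff_raise]

theorem nprod_T_right (n : ℕ) (a b : Arc R) :
    nprod n a (T b) = T (nprod n a b) + (n : ℂ) • nprod (n - 1) a b := by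
  simp only [nprod, prodTail_T_right, map_add, Tail.coeff_map, Tail.coeff_raise]
  rfl

theorem nprod_mul_left (n : ℕ) (a b c : Arc R) : nprod n (a * b) c =
    ∑ᶠ i, (E i b * nprod (n + i) a c + E i a * nprod (n + i) b c) := by
  obtain ⟨N₁, h₁⟩ := Tail.coeff_smul n b (prodTail a c)
  obtain ⟨N₂, h₂⟩ := Tail.coeff_smul n a (prodTail b c)
  obtain ⟨M₁, g₁⟩ := exists_nprod_eq_zero a c
  obtain ⟨M₂, g₂⟩ := exists_nprod_eq_zero b c
  rw [finsum_eq_sum_of_support_subset (s := Finset.range (N₁ + N₂ + M₁ + M₂)),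
    Finset.sum_add_distrib]
  · rw [nprod, prodTail_mul, map_add, h₁ (N₁ + N₂ + M₁ + M₂) (by omega),
      h₂ (N₁ + N₂ + M₁ + M₂) (by omega), add_comm]
    rfl
  · intro i hi
    by_contra h
    simp only [Finset.coe_range, Set.mem_Iio, not_lt] at h
    exact hi (by simp [g₁ (n + i) (by omega), g₂ (n + i) (by omega)])

end products
end Arc
end ArcAlgebra

section Points

variable (A : Type*) [CommRing A] [Algebra ℂ A]

/-- The `ℂ`-valued points of `Spec A`. -/
def Pt : Type _ := A →ₐ[ℂ] ℂ

variable {A}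

instance : FunLike (Pt A) A ℂ := inferInstanceAs (FunLike (A →ₐ[ℂ] ℂ) A ℂ)
instance : AlgHomClass (Pt A) ℂ A ℂ := inferInstanceAs (AlgHomClass (A →ₐ[ℂ] ℂ) ℂ A ℂ)

/-- A point, as the algebra homomorphism `A → ℂ` that it is. -/
def Pt.toAlgHom (x : Pt A) : A →ₐ[ℂ] ℂ := x

/-- The maximal ideal `𝔪_x` of a point `x`. -/
def Pt.maxIdeal (x : Pt A) : Ideal A := RingHom.ker x

/-- The Zariski topology on the set of `ℂ`-valued points. -/
instance : TopologicalSpace (Pt A) :=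
  TopologicalSpace.induced
    (fun x => (⟨x.maxIdeal, RingHom.ker_isPrime x⟩ : PrimeSpectrum A)) inferInstance

end Points

section Poisson

variable {R : Type*} [CommRing R] [Algebra ℂ R] [PoissonAlgebra R]

/-- Poisson ideals of `R`. -/
def IsPoissonIdeal (I : Ideal R) : Prop := ∀ a : R, ∀ f ∈ I, PoissonAlgebra.bracket a f ∈ I

/-- The Poisson core of `I`: the biggest Poisson ideal contained in `I`. -/
def poissonCore (I : Ideal R) : Ideal R := sSup {J | IsPoissonIdeal J ∧ J ≤ I}

theorem isGreatest_poissonCore (I : Ideal R) :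
    IsGreatest {J | IsPoissonIdeal J ∧ J ≤ I} (poissonCore I) := by
  refine ⟨⟨fun a f hf => ?_, sSup_le fun J hJ => hJ.2⟩, fun J hJ => le_sSup hJ⟩
  rw [poissonCore, sSup_eq_iSup'] at hf
  refine Submodule.iSup_induction _ (motive := fun f => PoissonAlgebra.bracket a f ∈ poissonCore I)
    hf (fun J f hf => le_sSup J.2 (J.2.1 a f hf)) (by simp) fun f g hf hg => ?_
  rw [map_add]
  exact add_mem hf hg

/-- The symplectic core of `x`: the class of `x` for `𝒫_R(𝔪_x) = 𝒫_R(𝔪_y)`. -/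
def symplecticCore (x : Pt R) : Set (Pt R) :=
  {y | poissonCore y.maxIdeal = poissonCore x.maxIdeal}

/-- Chiral Poisson ideals of `J_∞ R`: ideals stable under all `a_(n)`, `n ≥ 0`. -/
def IsChiralPoissonIdeal (I : Ideal (Arc R)) : Prop :=
  ∀ (a : Arc R) (n : ℕ), ∀ u ∈ I, Arc.nprod n a u ∈ I

/-- The chiral Poisson core of `I`: the biggest chiral Poisson ideal contained in `I`. -/
def chiralPoissonCore (I : Ideal (Arc R)) : Ideal (Arc R) :=
  sSup {J | IsChiralPoissonIdeal J ∧ J ≤ I}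

theorem isGreatest_chiralPoissonCore (I : Ideal (Arc R)) :
    IsGreatest {J | IsChiralPoissonIdeal J ∧ J ≤ I} (chiralPoissonCore I) := by
  refine ⟨⟨fun a n f hf => ?_, sSup_le fun J hJ => hJ.2⟩, fun J hJ => le_sSup hJ⟩
  rw [chiralPoissonCore, sSup_eq_iSup'] at hf
  refine Submodule.iSup_induction _ (motive := fun f => Arc.nprod n a f ∈ chiralPoissonCore I)
    hf (fun J f hf => le_sSup J.2 (J.2.1 a n f hf)) (by simp [Arc.nprod]) fun f g hf hg => ?_
  rw [show Arc.nprod n a (f + g) = Arc.nprod n a f + Arc.nprod n a g by simp [Arc.nprod]]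
  exact add_mem hf hg

/-- The chiral symplectic core of `y` in `J_∞ X`: its class for `𝒫(𝔪_y) = 𝒫(𝔪_z)`, with `𝒫` the
chiral Poisson core in `J_∞ R`. -/
def chiralSymplecticCore (y : Pt (Arc R)) : Set (Pt (Arc R)) :=
  {z | chiralPoissonCore z.maxIdeal = chiralPoissonCore y.maxIdeal}

/-- `y` is reached from `x` along an integral curve `σ`, defined on a complex disc, of a Hamiltonian
vector field `{a, -}`. -/
def HamiltonianFlow (x y : Pt R) : Prop :=
  ∃ (a : R) (r : ℝ) (σ : ℂ → Pt R),
    (∀ z ∈ Metric.ball (0 : ℂ) r, ∀ f : R,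
      HasDerivAt (fun w => σ w f) (σ z (PoissonAlgebra.bracket a f)) z) ∧
    σ 0 = x ∧ ∃ z ∈ Metric.ball (0 : ℂ) r, σ z = y

/-- The symplectic leaf through `x`: all points that can be reached from `x` by travelling along
finitely many integral curves of Hamiltonian vector fields. -/
def symplecticLeaf (x : Pt R) : Set (Pt R) := {y | Relation.EqvGen HamiltonianFlow x y}

end Poisson

section ArcPoints

variable {R : Type*} [CommRing R] [Algebra ℂ R]

/-- The base point `π_{∞,0}(y)` of an arc `y`. -/
def basePt (y : Pt (Arc R)) : Pt R := y.toAlgHom.comp Arc.ι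

/-- The constant arc `ι_∞(x)` at `x`; as a point of `J_∞ R` it sends `T^j f` to `0` for `j > 0`. -/
def constArc (x : Pt R) : Pt (Arc R) := Arc.lift 0 x.toAlgHom

/-- For `S` locally closed in `X` (with its reduced structure), the subset `J_∞ S` of `J_∞ X`. The arc
`γ : R → ℂ⟦t⟧`, `f ↦ ∑ j, y(T^j f) t^j / j!`, of a point `y` factors through the closure of `S` iff it
kills all functions vanishing on `S`; it then factors through the open subset `S` of that closure
iff its base point is in `S`, because `ℂ⟦t⟧` is local. -/
def arcSet (S : Set (Pt R)) : Set (Pt (Arc R)) :=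
  {y | (∀ f : R, (∀ x ∈ S, x f = 0) → ∀ j : ℕ, y (Arc.T^[j] (Arc.ι f)) = 0) ∧ basePt y ∈ S}

end ArcPoints
end
end ArcPoisson

open ArcPoisson

namespace ArcPoisson

/-! ### Primes and derivations in characteristic zero -/

section Derivations

open Finset.HasAntidiagonal (antidiagonal)

/-! Write V(Q) for the points at which a prime Q of R vanishes, and J_∞V(Q) for the arcs in V(Q). In
characteristic zero minimal primes are stable under derivations (`minimalPrimes_stable`), so the
minimal primes of R are Poisson ideals. Every arc kills one of them
(`exists_minimalPrime_diffIdeal_le`), so J_∞X is the union of finitely many sets J_∞V(Q), and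
constant arcs show that none contains another. What remains concerns one prime Poisson ideal Q
(`arcSet_closures`).

Irreducibility. Let N consist of the F such that gF lies in the differential ideal generated by Q
for some g ∉ Q. It is prime, being the kernel of a map to a polynomial ring over Frac(R/Q) whose
variables are the jets of local coordinates b_j (`exists_genericIdeal`). Kolchin's theorem
(`eq_zero_of_mul_mem_diffIdeal`) says that N vanishes on all of J_∞V(Q). Indeed an arc is a point of
V(Q) over the algebraic closure K of ℂ((t)). It is the origin of a formal curve over K on which g
does not vanish identically (`exists_generization`). Letting d/dt act on coefficients, one sees that
F vanishes along the curve, hence at its origin. So J_∞V(Q) is the zero locus of N.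

Nondegeneracy. The bracket has generic rank d = dim R/Q on V(Q) (`exists_det_bracket_ne_zero`). If
the rank were at most r < d, the part of rank r would be foliated by the flows of r commuting vector
fields (`exists_flowBox`, `FlowBox.exists_charts`). Each leaf there is covered by countably many
plaques (`exists_plaques_leaf`), which have Hausdorff dimension at most 2r in the coordinates of a
Noether normalization. Finitely many leaves would then cover a nonempty open subset of ℂ^d, which
has dimension 2d.

Chiral cores. Poisson ideals do not separate points of a leaf, so there are finitely many Poisson
cores, and those equal to Q occur on a nonempty open part of V(Q). Let J be a chiral Poisson ideal
that contains the differential ideal of Q but is not inside N. Choose a jet polynomial of least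
degree in J and outside N, with jets of order at most m+1. On it a_(m+1) acts as (m+1)! ∑ {a, b_j}
∂/∂(T^(m+1) b_j), which lowers the degree. By nondegeneracy this is nonzero for some a unless the
polynomial has degree zero, so J contains a function outside Q (`exists_ι_mem_of_chiral`). If J
vanished at an arc whose base point has Poisson core Q, then J ∩ R would be a Poisson ideal inside
the maximal ideal of that point, hence inside Q. So N is the chiral core of each arc of V(Q) based
in the symplectic core. These arcs form a nonempty open, hence dense, part of the irreducible set
J_∞V(Q), and their closure is that set. -/

theorem derivation_iterate_mul {A : Type*} [CommRing A] [Algebra ℂ A] (D : Derivation ℂ A A)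
    (n : ℕ) (f g : A) : D^[n] (f * g) =
      ∑ p ∈ antidiagonal n, (n.choose p.1) • (D^[p.1] f * D^[p.2] g) := by
  induction n with
  | zero => simp
  | succ n ih =>
    rw [Function.iterate_succ_apply', ih,
      Finset.sum_antidiagonal_choose_succ_nsmul (fun i j => D^[i] f * D^[j] g) n, map_sum,
      ← Finset.sum_add_distrib]
    refine Finset.sum_congr rfl fun p hp => ?_
    rw [map_nsmul, Derivation.leibniz, nsmul_add, smul_eq_mul, smul_eq_mul,
      Function.iterate_succ_apply', Function.iterate_succ_apply', mul_comm (D^[p.2] g)]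
    have : n.choose p.2 = n.choose p.1 := by
      rw [← Finset.HasAntidiagonal.mem_antidiagonal.1 hp, Nat.choose_symm_add]
    rw [this]

/-- The biggest ideal contained in `P` that is stable under a derivation. -/
def derivCore {A : Type*} [CommRing A] [Algebra ℂ A] (D : Derivation ℂ A A) (P : Ideal A) :
    Ideal A where
  carrier := {f | ∀ n, D^[n] f ∈ P}
  zero_mem' n := by rw [iterate_map_zero]; exact P.zero_mem
  add_mem' hf hg n := by rw [iterate_map_add]; exact P.add_mem (hf n) (hg n)
  smul_mem' a f hf n := by
    rw [smul_eq_mul, derivation_iterate_mul]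
    exact sum_mem fun p _ => nsmul_mem (P.mul_mem_left _ (hf _)) _

variable {A : Type*} [CommRing A] [Algebra ℂ A] {D : Derivation ℂ A A} {P : Ideal A}

theorem mem_derivCore {f : A} : f ∈ derivCore D P ↔ ∀ n, D^[n] f ∈ P := Iff.rfl

theorem derivCore_le : derivCore D P ≤ P := fun _ hf => hf 0

theorem derivCore_stable {f : A} (hf : f ∈ derivCore D P) : D f ∈ derivCore D P := fun n => by
  rw [← Function.iterate_succ_apply]; exact hf _

theorem le_derivCore {J : Ideal A} (hJ : ∀ f ∈ J, D f ∈ J) (h : J ≤ P) : J ≤ derivCore D P :=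
  fun f hf n => h <| by
    induction n with
    | zero => exact hf
    | succ n ih => rw [Function.iterate_succ_apply']; exact hJ _ ih

/-- If m and n are least with D^m f ∉ P and D^n g ∉ P, then all terms of D^(m+n)(fg) lie in P except
a binomial multiple of D^m f · D^n g, and the binomial coefficient is invertible. -/
theorem derivCore_isPrime [hP : P.IsPrime] : (derivCore D P).IsPrime := by
  refine ⟨fun h => hP.ne_top (top_le_iff.1 (h ▸ derivCore_le)), fun {f g} hfg => ?_⟩
  by_contra! H
  obtain ⟨hf, hg⟩ := H
  simp only [mem_derivCore, not_forall] at hf hg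
  classical
  have hm := Nat.find_spec hf
  have hn := Nat.find_spec hg
  set m := Nat.find hf with hm'
  set n := Nat.find hg with hn'
  have key := hfg (m + n)
  rw [derivation_iterate_mul, ← Finset.add_sum_erase _ _
    (Finset.HasAntidiagonal.mem_antidiagonal.2 (rfl : (m, n).1 + (m, n).2 = m + n))] at key
  have h2 : ∑ p ∈ (antidiagonal (m + n)).erase (m, n),
      ((m + n).choose p.1) • (D^[p.1] f * D^[p.2] g) ∈ P := by
    refine sum_mem fun p hp => nsmul_mem ?_ _
    rw [Finset.mem_erase, Finset.HasAntidiagonal.mem_antidiagonal] at hp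
    rcases lt_trichotomy p.1 m with h | h | h
    · exact P.mul_mem_right _ (not_not.1 (Nat.find_min hf h))
    · exact absurd (Prod.ext h (by simp only; omega)) hp.1
    · exact P.mul_mem_left _ (not_not.1 (Nat.find_min hg (by omega)))
  have h3 := (Ideal.add_mem_iff_left P h2).1 key
  have h4 : ((m + n).choose m : ℂ) ≠ 0 := by
    exact_mod_cast (Nat.choose_pos (Nat.le_add_right m n)).ne'
  have h5 : D^[m] f * D^[n] g ∈ P := by
    rw [← inv_smul_smul₀ h4 (D^[m] f * D^[n] g), Nat.cast_smul_eq_nsmul]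
    exact Submodule.smul_of_tower_mem P _ h3
  exact (hP.mem_or_mem h5).elim hm hn

/-- The derivation core of Q is a prime between J and Q, so minimality makes it equal to Q. -/
theorem minimalPrimes_stable {J Q : Ideal A} (hJ : ∀ f ∈ J, D f ∈ J) (hQ : Q ∈ J.minimalPrimes)
    {f : A} (hf : f ∈ Q) : D f ∈ Q := by
  have := hQ.1.1
  exact derivCore_le (derivCore_stable
    (hQ.2 ⟨derivCore_isPrime (D := D) (P := Q), le_derivCore hJ hQ.1.2⟩ derivCore_le hf))

end Derivations

/-! ### Zariski topology and Nullstellensatz on complex points -/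

section Points

variable {A : Type*} [CommRing A] [Algebra ℂ A]

theorem Pt.mem_maxIdeal {x : Pt A} {f : A} : f ∈ x.maxIdeal ↔ x f = 0 := Iff.rfl

instance (x : Pt A) : x.maxIdeal.IsPrime := RingHom.ker_isPrime x

theorem Pt.isClosed_iff {S : Set (Pt A)} :
    IsClosed S ↔ ∃ I : Ideal A, S = {x | I ≤ x.maxIdeal} := by
  rw [isClosed_induced_iff]
  constructor
  · rintro ⟨t, ht, rfl⟩
    obtain ⟨I, rfl⟩ := (PrimeSpectrum.isClosed_iff_zeroLocus_ideal t).1 ht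
    exact ⟨I, rfl⟩
  · rintro ⟨I, rfl⟩
    exact ⟨_, PrimeSpectrum.isClosed_zeroLocus I, rfl⟩

/-- The ideal of functions vanishing on `S`. -/
def vanIdeal (S : Set (Pt A)) : Ideal A := ⨅ x ∈ S, x.maxIdeal

theorem mem_vanIdeal {S : Set (Pt A)} {f : A} : f ∈ vanIdeal S ↔ ∀ x ∈ S, x f = 0 := by
  simp [vanIdeal, Pt.mem_maxIdeal]

theorem closure_eq_zeroLocus (S : Set (Pt A)) : closure S = {x | vanIdeal S ≤ x.maxIdeal} := by
  refine subset_antisymm (closure_minimal (fun x hx f hf => mem_vanIdeal.1 hf x hx)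
    (Pt.isClosed_iff.2 ⟨_, rfl⟩)) fun x hx => ?_
  obtain ⟨I, hI⟩ := Pt.isClosed_iff.1 (isClosed_closure (s := S))
  rw [hI]
  change I ≤ x.maxIdeal
  refine le_trans (fun f hf => mem_vanIdeal.2 fun y hy => ?_) (show vanIdeal S ≤ _ from hx)
  have : y ∈ {x : Pt A | I ≤ x.maxIdeal} := hI ▸ subset_closure hy
  exact this hf

theorem isOpen_ne_zero (f : A) : IsOpen {x : Pt A | x f ≠ 0} := by
  rw [← isClosed_compl_iff, Pt.isClosed_iff]
  refine ⟨Ideal.span {f}, ?_⟩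
  ext x
  simp [Pt.mem_maxIdeal]

/-- A field that is countably generated as a `ℂ`-algebra is `ℂ`. -/
theorem algebraMap_bijective_of_countable_adjoin {k : Type*} [Field k] [Algebra ℂ k] {s : Set k}
    (hs : s.Countable) (h : Algebra.adjoin ℂ s = ⊤) :
    Function.Bijective (algebraMap ℂ k) := by
  refine ⟨(algebraMap ℂ k).injective, ?_⟩
  have halg : Algebra.IsAlgebraic ℂ k := by
    rw [Algebra.isAlgebraic_def]
    intro x
    by_contra hx
    -- A transcendental x yields continuum many linearly independent elements 1/(x - c), but a
    -- countably generated algebra has countable dimension.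
    have h2 := (show Transcendental ℂ x from hx).linearIndependent_sub_inv.cardinal_lift_le_rank
    have h3 : Module.rank ℂ k ≤ Cardinal.aleph0 := by
      have hspan : Submodule.span ℂ (Submonoid.closure s : Set k) = ⊤ := by
        rw [← Algebra.adjoin_eq_span, h]; rfl
      have hc : (Submonoid.closure s : Set k).Countable := by
        have := hs.to_subtype
        rw [Submonoid.closure_eq_mrange, MonoidHom.coe_mrange]
        have : Countable (FreeMonoid s) := inferInstanceAs (Countable (List s))
        exact Set.countable_range _
      rw [← rank_top, ← hspan]
      exact (rank_span_le _).trans (Cardinal.le_aleph0_iff_set_countable.2 hc)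
    rw [Cardinal.mk_complex] at h2
    have h4 := h2.trans (Cardinal.lift_le.2 h3)
    simp only [Cardinal.lift_continuum, Cardinal.lift_aleph0] at h4
    exact absurd h4 (not_le.2 Cardinal.aleph0_lt_continuum)
  exact (IsAlgClosed.algebraMap_bijective_of_isIntegral (k := ℂ) (K := k)).2

/-- The Nullstellensatz for countably generated `ℂ`-algebras. -/
theorem exists_pt_ne_zero {s : Set A} (hs : s.Countable) (h : Algebra.adjoin ℂ s = ⊤)
    {P : Ideal A} [hP : P.IsPrime] {f : A} (hf : f ∉ P) :
    ∃ x : Pt A, P ≤ x.maxIdeal ∧ x f ≠ 0 := by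
  -- A residue field of (A/P)_f is generated by the images of s and 1/f, so it is ℂ. The resulting
  -- point lies in V(P) and cannot kill f.
  let B := Localization.Away (Ideal.Quotient.mk P f)
  have hf0 : Ideal.Quotient.mk P f ≠ 0 := fun h => hf (Ideal.Quotient.eq_zero_iff_mem.1 h)
  have : IsDomain B := IsLocalization.isDomain_localization (powers_le_nonZeroDivisors_of_noZeroDivisors hf0)
  obtain ⟨m, hm⟩ := Ideal.exists_maximal B
  let := Ideal.Quotient.field m
  let g : A →ₐ[ℂ] B := (IsScalarTower.toAlgHom ℂ (A ⧸ P) B).comp (Ideal.Quotient.mkₐ ℂ P)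
  let π : B →ₐ[ℂ] B ⧸ m := Ideal.Quotient.mkₐ ℂ m
  let u : B := IsLocalization.Away.invSelf (Ideal.Quotient.mk P f)
  have hu : g f * u = 1 := IsLocalization.Away.mul_invSelf (S := B) (Ideal.Quotient.mk P f)
  have hgen : Algebra.adjoin ℂ ((fun a => π (g a)) '' s ∪ {π u}) = ⊤ := by
    rw [eq_top_iff]
    rintro z -
    obtain ⟨z, rfl⟩ := Ideal.Quotient.mk_surjective z
    obtain ⟨n, a, ha⟩ := IsLocalization.Away.surj (S := B) (Ideal.Quotient.mk P f) z
    obtain ⟨a, rfl⟩ := Ideal.Quotient.mk_surjective a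
    have hz : z = g a * u ^ n := by
      have : g a = z * g f ^ n := ha.symm
      rw [this, mul_assoc, ← mul_pow, hu, one_pow, mul_one]
    have hga : ∀ a, π (g a) ∈ Algebra.adjoin ℂ ((fun a => π (g a)) '' s ∪ {π u}) := fun a => by
      have ha : a ∈ Algebra.adjoin ℂ s := h ▸ Algebra.mem_top
      induction ha using Algebra.adjoin_induction with
      | mem a ha => exact Algebra.subset_adjoin (.inl ⟨a, ha, rfl⟩)
      | algebraMap c => rw [AlgHom.commutes, AlgHom.commutes]; exact Subalgebra.algebraMap_mem _ c
      | add a b _ _ ha hb => rw [map_add, map_add]; exact add_mem ha hb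
      | mul a b _ _ ha hb => rw [map_mul, map_mul]; exact mul_mem ha hb
    change π z ∈ _
    rw [hz, map_mul, map_pow]
    exact mul_mem (hga a) (pow_mem (Algebra.subset_adjoin (.inr rfl)) n)
  have hb := algebraMap_bijective_of_countable_adjoin ((hs.image _).union (Set.countable_singleton _))
    hgen
  let e : ℂ ≃ₐ[ℂ] B ⧸ m := AlgEquiv.ofBijective (Algebra.ofId ℂ _) hb
  let x : A →ₐ[ℂ] ℂ := e.symm.toAlgHom.comp (π.comp g)
  refine ⟨x, fun a ha => ?_, fun h0 => ?_⟩
  · change e.symm (π (algebraMap (A ⧸ P) B (Ideal.Quotient.mk P a))) = 0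
    rw [Ideal.Quotient.eq_zero_iff_mem.2 ha, map_zero, map_zero, map_zero]
  · have h1 : π (g f) = 0 := (map_eq_zero_iff e.symm e.symm.injective).1 h0
    have := congrArg π hu
    rw [map_mul, h1, zero_mul, map_one] at this
    exact zero_ne_one this

theorem exists_pt_ne_zero_of_finiteType [Algebra.FiniteType ℂ A]
    {P : Ideal A} [hP : P.IsPrime] {f : A} (hf : f ∉ P) :
    ∃ x : Pt A, P ≤ x.maxIdeal ∧ x f ≠ 0 := by
  obtain ⟨s, hs⟩ := Algebra.FiniteType.out (R := ℂ) (A := A)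
  exact exists_pt_ne_zero s.countable_toSet hs hf

/-- The Nullstellensatz enters as the hypothesis `h`, so that the lemma serves both R, which is
finitely generated, and J_∞R, which is only countably generated. -/
theorem isIrreducible_of_prime {P : Ideal A} [hP : P.IsPrime]
    (h : ∀ f ∉ P, ∃ x : Pt A, P ≤ x.maxIdeal ∧ x f ≠ 0) :
    IsIrreducible {x : Pt A | P ≤ x.maxIdeal} := by
  obtain ⟨x, hx, -⟩ := h 1 ((Ideal.ne_top_iff_one P).1 hP.ne_top)
  refine ⟨⟨x, hx⟩, ?_⟩
  rw [isPreirreducible_iff_isClosed_union_isClosed]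
  intro z₁ z₂ h₁ h₂ hz
  obtain ⟨I, rfl⟩ := Pt.isClosed_iff.1 h₁
  obtain ⟨J, rfl⟩ := Pt.isClosed_iff.1 h₂
  by_contra! H
  have key : ∀ I : Ideal A, ¬ {x : Pt A | P ≤ x.maxIdeal} ⊆ {x | I ≤ x.maxIdeal} →
      ∃ f ∈ I, f ∉ P := fun I hI => by
    by_contra! H
    exact hI fun x hx => le_trans (b := P) H hx
  obtain ⟨f, hf, hfP⟩ := key I H.1
  obtain ⟨g, hg, hgP⟩ := key J H.2
  obtain ⟨y, hy, hne⟩ := h (f * g) fun h => (hP.mem_or_mem h).elim hfP hgP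
  rw [map_mul] at hne
  rcases hz hy with h | h
  · exact left_ne_zero_of_mul hne (h hf)
  · exact right_ne_zero_of_mul hne (h hg)

theorem vanIdeal_zeroLocus {P : Ideal A}
    (h : ∀ f ∉ P, ∃ x : Pt A, P ≤ x.maxIdeal ∧ x f ≠ 0) :
    vanIdeal {x : Pt A | P ≤ x.maxIdeal} = P := by
  ext f
  rw [mem_vanIdeal]
  refine ⟨fun hf => ?_, fun hf x hx => hx hf⟩
  by_contra hfP
  obtain ⟨x, hx, hne⟩ := h f hfP
  exact hne (hf x hx)

theorem vanIdeal_isPrime_of_isIrreducible {Y : Set (Pt A)} (hY : IsIrreducible Y) :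
    (vanIdeal Y).IsPrime := by
  obtain ⟨⟨x, hx⟩, hpre⟩ := hY
  refine ⟨(Ideal.ne_top_iff_one _).2 fun h => ?_, fun {f g} hfg => ?_⟩
  · have := mem_vanIdeal.1 h x hx
    rw [map_one] at this
    exact one_ne_zero this
  · by_contra! H
    simp only [mem_vanIdeal, not_forall] at H
    obtain ⟨⟨y, hy, hfy⟩, ⟨z, hz, hgz⟩⟩ := H
    obtain ⟨w, hw, hfw, hgw⟩ := hpre _ _ (isOpen_ne_zero f) (isOpen_ne_zero g) ⟨y, hy, hfy⟩
      ⟨z, hz, hgz⟩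
    have := mem_vanIdeal.1 hfg w hw
    rw [map_mul] at this
    exact (mul_eq_zero.1 this).elim hfw hgw

theorem irreducibleComponents_pt [Algebra.FiniteType ℂ A] : irreducibleComponents (Pt A) =
    (fun Q : Ideal A => {x : Pt A | Q ≤ x.maxIdeal}) '' minimalPrimes A := by
  have hnull : ∀ P : Ideal A, P.IsPrime → ∀ f ∉ P, ∃ x : Pt A, P ≤ x.maxIdeal ∧ x f ≠ 0 :=
    fun P hP f hf => exists_pt_ne_zero_of_finiteType hf
  ext Y
  constructor
  · intro hY
    have hcl : IsClosed Y := isClosed_of_mem_irreducibleComponents Y hY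
    have hp := vanIdeal_isPrime_of_isIrreducible hY.1
    obtain ⟨Q, hQ, hle⟩ := Ideal.exists_minimalPrimes_le (J := vanIdeal Y) (bot_le : (⊥ : Ideal A) ≤ _)
    have := hQ.1.1
    refine ⟨Q, hQ, ?_⟩
    have hsub : Y ⊆ {x : Pt A | Q ≤ x.maxIdeal} := fun x hx =>
      hle.trans fun f hf => mem_vanIdeal.1 hf x hx
    exact subset_antisymm (hY.2 (isIrreducible_of_prime (hnull Q this)) hsub) hsub
  · rintro ⟨Q, hQ, rfl⟩
    have := hQ.1.1
    refine ⟨isIrreducible_of_prime (hnull Q this), fun Z hZ hle => ?_⟩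
    have hp := vanIdeal_isPrime_of_isIrreducible hZ
    have h1 : vanIdeal Z ≤ Q := by
      rw [← vanIdeal_zeroLocus (hnull Q this)]
      exact fun f hf => mem_vanIdeal.2 fun x hx => mem_vanIdeal.1 hf x (hle hx)
    have h2 := hQ.2 ⟨hp, bot_le⟩ h1
    exact fun x hx f hf => mem_vanIdeal.1 (h2 hf) x hx

end Points
end ArcPoisson

namespace ArcPoisson

/-! ### Leaves, Poisson cores and their finiteness -/

section PoissonCores

variable {R : Type*} [CommRing R] [Algebra ℂ R] [PoissonAlgebra R]

/-- The Hamiltonian derivation `{a, -}`. -/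
noncomputable def hamiltonian (a : R) : Derivation ℂ R R :=
  Derivation.mk' (PoissonAlgebra.bracket a) fun b c => by
    rw [PoissonAlgebra.leibniz, smul_eq_mul, smul_eq_mul, add_comm, mul_comm c]

theorem hamiltonian_apply (a b : R) : hamiltonian a b = PoissonAlgebra.bracket a b := rfl

theorem isPoissonIdeal_poissonCore (I : Ideal R) : IsPoissonIdeal (poissonCore I) :=
  (isGreatest_poissonCore I).1.1

theorem poissonCore_le (I : Ideal R) : poissonCore I ≤ I := (isGreatest_poissonCore I).1.2

theorem le_poissonCore {I J : Ideal R} (hJ : IsPoissonIdeal J) (h : J ≤ I) : J ≤ poissonCore I :=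
  (isGreatest_poissonCore I).2 ⟨hJ, h⟩

theorem isPoissonIdeal_of_mem_minimalPrimes {Q : Ideal R} (hQ : Q ∈ minimalPrimes R) :
    IsPoissonIdeal Q := fun a f hf =>
  minimalPrimes_stable (D := hamiltonian a) (J := ⊥) (fun f hf => by
    rw [Ideal.mem_bot] at hf ⊢; rw [hf, map_zero]) hQ hf

theorem iteratedDeriv_integralCurve {a : R} {r : ℝ} {σ : ℂ → Pt R}
    (hσ : ∀ z ∈ Metric.ball (0 : ℂ) r, ∀ f : R,
      HasDerivAt (fun w => σ w f) (σ z (PoissonAlgebra.bracket a f)) z) (f : R) (n : ℕ) :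
    ∀ z ∈ Metric.ball (0 : ℂ) r,
      iteratedDeriv n (fun w => σ w f) z = σ z ((hamiltonian a)^[n] f) := by
  induction n with
  | zero => intro z _; simp
  | succ n ih =>
    intro z hz
    rw [iteratedDeriv_succ, Function.iterate_succ_apply',
      Filter.EventuallyEq.deriv_eq (f := fun w => σ w ((hamiltonian a)^[n] f))]
    · exact (hσ z hz _).deriv
    · filter_upwards [Metric.isOpen_ball.mem_nhds hz] with w hw using ih w hw

/-- Along the curve f is holomorphic, and its derivatives at z are the values of the iterates of {a,
-} on f. These lie in I and so vanish at σ z, and the identity theorem spreads the vanishing over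
the disc. -/
theorem integralCurve_eq_zero {a : R} {r : ℝ} {σ : ℂ → Pt R}
    (hσ : ∀ z ∈ Metric.ball (0 : ℂ) r, ∀ f : R,
      HasDerivAt (fun w => σ w f) (σ z (PoissonAlgebra.bracket a f)) z) {I : Ideal R}
    (hI : IsPoissonIdeal I) {z w : ℂ} (hz : z ∈ Metric.ball (0 : ℂ) r)
    (hw : w ∈ Metric.ball (0 : ℂ) r) (h : I ≤ (σ z).maxIdeal) : I ≤ (σ w).maxIdeal := by
  intro f hf
  have hd : DifferentiableOn ℂ (fun w => σ w f) (Metric.ball 0 r) := fun w hw =>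
    (hσ w hw f).differentiableAt.differentiableWithinAt
  obtain ⟨δ, hδ, hsub⟩ := Metric.mem_nhds_iff.1 (Metric.isOpen_ball.mem_nhds hz)
  have hit : ∀ n, (hamiltonian a)^[n] f ∈ I := fun n => by
    induction n with
    | zero => exact hf
    | succ n ih => rw [Function.iterate_succ_apply']; exact hI a _ ih
  have hev : (fun w => σ w f) =ᶠ[nhds z] 0 := by
    filter_upwards [Metric.ball_mem_nhds z hδ] with v hv
    have := Complex.hasSum_taylorSeries_on_ball (hd.mono hsub) hv
    refine this.unique ?_
    have h0 : ∀ n, iteratedDeriv n (fun w => σ w f) z = 0 := fun n => by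
      rw [iteratedDeriv_integralCurve hσ f n z hz]; exact h (hit n)
    simp only [h0, smul_zero]
    exact hasSum_zero
  exact (hd.analyticOnNhd Metric.isOpen_ball).eqOn_zero_of_preconnected_of_eventuallyEq_zero
    (convex_ball _ _).isPreconnected hz hev hw

theorem HamiltonianFlow.le_maxIdeal_iff {x y : Pt R} (h : HamiltonianFlow x y) {I : Ideal R}
    (hI : IsPoissonIdeal I) : I ≤ x.maxIdeal ↔ I ≤ y.maxIdeal := by
  obtain ⟨a, r, σ, hσ, rfl, z, hz, rfl⟩ := h
  have h0 : (0 : ℂ) ∈ Metric.ball (0 : ℂ) r := by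
    rw [Metric.mem_ball, dist_self]
    exact dist_nonneg.trans_lt (Metric.mem_ball.1 hz)
  exact ⟨integralCurve_eq_zero hσ hI h0 hz, integralCurve_eq_zero hσ hI hz h0⟩

theorem le_maxIdeal_iff_of_mem_leaf {x y : Pt R} (h : y ∈ symplecticLeaf x) {I : Ideal R}
    (hI : IsPoissonIdeal I) : I ≤ x.maxIdeal ↔ I ≤ y.maxIdeal := by
  replace h : Relation.EqvGen HamiltonianFlow x y := h
  induction h with
  | rel x y h => exact h.le_maxIdeal_iff hI
  | refl x => rfl
  | symm x y _ h => exact h.symm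
  | trans x y z _ _ h₁ h₂ => exact h₁.trans h₂

theorem poissonCore_eq_of_mem_leaf {x y : Pt R} (h : y ∈ symplecticLeaf x) :
    poissonCore y.maxIdeal = poissonCore x.maxIdeal := by
  refine le_antisymm (le_poissonCore (isPoissonIdeal_poissonCore _) ?_)
    (le_poissonCore (isPoissonIdeal_poissonCore _) ?_)
  · exact (le_maxIdeal_iff_of_mem_leaf h (isPoissonIdeal_poissonCore _)).2 (poissonCore_le _)
  · exact (le_maxIdeal_iff_of_mem_leaf h (isPoissonIdeal_poissonCore _)).1 (poissonCore_le _)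

theorem finite_poissonCores (hfin : (Set.range fun x : Pt R => symplecticLeaf x).Finite) :
    (Set.range fun x : Pt R => poissonCore x.maxIdeal).Finite := by
  -- The core is constant on a leaf, so it is a function of the leaf as a set. The supremum over the
  -- leaf defines this function without choosing a point.
  refine (hfin.image fun S => ⨆ y ∈ S, poissonCore y.maxIdeal).subset ?_
  rintro _ ⟨x, rfl⟩
  refine ⟨_, ⟨x, rfl⟩, le_antisymm (iSup₂_le fun y hy => (poissonCore_eq_of_mem_leaf hy).le) ?_⟩
  exact le_iSup₂_of_le (f := fun y (_ : y ∈ symplecticLeaf x) => poissonCore y.maxIdeal) x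
    (Relation.EqvGen.refl x) le_rfl

/-- Otherwise each of the finitely many cores C of points of V(Q) contains some f_C ∉ Q. The product
of the f_C is outside the prime Q, hence nonzero at some x in V(Q), although the core of x vanishes
at x. -/
theorem exists_poissonCore_eq [Algebra.FiniteType ℂ R]
    (hfin : (Set.range fun x : Pt R => poissonCore x.maxIdeal).Finite) {Q : Ideal R}
    [hQ : Q.IsPrime] (hP : IsPoissonIdeal Q) : ∃ x : Pt R, poissonCore x.maxIdeal = Q := by
  by_contra! H
  have h1 : ∀ C : Ideal R, ∃ f, f ∉ Q ∧ ((∃ x : Pt R, Q ≤ x.maxIdeal ∧ poissonCore x.maxIdeal = C) →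
      f ∈ C) := fun C => by
    by_cases hC : ∃ x : Pt R, Q ≤ x.maxIdeal ∧ poissonCore x.maxIdeal = C
    · obtain ⟨x, hx, rfl⟩ := hC
      obtain ⟨f, hf, hfQ⟩ := SetLike.not_le_iff_exists.1 fun h =>
        H x (le_antisymm h (le_poissonCore hP hx))
      exact ⟨f, hfQ, fun _ => hf⟩
    · exact ⟨1, (Ideal.ne_top_iff_one Q).1 hQ.ne_top, fun h => absurd h hC⟩
  choose f hfQ hf using h1
  obtain ⟨x, hx, hne⟩ := exists_pt_ne_zero_of_finiteType (P := Q) (f := ∏ C ∈ hfin.toFinset, f C)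
    fun h => by
      obtain ⟨C, -, hC⟩ := (hQ.prod_mem_iff).1 h
      exact hfQ C hC
  rw [map_prod, Finset.prod_ne_zero_iff] at hne
  exact hne (poissonCore x.maxIdeal) (by simp)
    (poissonCore_le x.maxIdeal (hf (poissonCore x.maxIdeal) ⟨x, hx, rfl⟩))

/-- The points to be removed are those where some core not inside Q vanishes. By finiteness they
form a closed set. -/
theorem exists_isOpen_poissonCore_eq_iff
    (hfin : (Set.range fun x : Pt R => poissonCore x.maxIdeal).Finite) {Q : Ideal R}
    (hP : IsPoissonIdeal Q) : ∃ U : Set (Pt R), IsOpen U ∧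
      ∀ y : Pt R, poissonCore y.maxIdeal = Q ↔ Q ≤ y.maxIdeal ∧ y ∈ U := by
  refine ⟨(⋃ C ∈ (Set.range fun x : Pt R => poissonCore x.maxIdeal) ∩ {C | ¬ C ≤ Q},
    {y : Pt R | C ≤ y.maxIdeal})ᶜ, ?_, fun y => ?_⟩
  · rw [isOpen_compl_iff]
    exact (hfin.subset Set.inter_subset_left).isClosed_biUnion fun C _ => Pt.isClosed_iff.2 ⟨C, rfl⟩
  · simp only [Set.mem_compl_iff, Set.mem_iUnion, not_exists]
    constructor
    · rintro rfl
      refine ⟨poissonCore_le _, fun C hC hCy => ?_⟩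
      obtain ⟨⟨x, rfl⟩, hC⟩ := hC
      exact hC (le_poissonCore (isPoissonIdeal_poissonCore _) hCy)
    · rintro ⟨h1, h2⟩
      refine le_antisymm ?_ (le_poissonCore hP h1)
      by_contra h
      exact h2 _ ⟨⟨y, rfl⟩, h⟩ (poissonCore_le _)

end PoissonCores
end ArcPoisson

namespace ArcPoisson

/-! ### Extension of derivations and local coordinates -/

section DerivationExtension

theorem derivation_sum_apply {A M ι : Type*} [CommRing A] [Algebra ℂ A] [AddCommGroup M]
    [Module ℂ M] [Module A M] (s : Finset ι) (D : ι → Derivation ℂ A M) (f : A) :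
    (∑ i ∈ s, D i) f = ∑ i ∈ s, D i f := by
  rw [← Derivation.coeFnAddMonoidHom_apply, map_sum, Finset.sum_apply]
  rfl

/-- The localization P → Frac P is étale, and Frac P → K is algebraic, hence separable in
characteristic zero. The gain is that derivations extend uniquely from P to K. -/
theorem formallyEtale_of_isAlgebraic (P K : Type*) [CommRing P] [IsDomain P] [Field K] [CharZero K]
    [Algebra P K] [FaithfulSMul P K] [Algebra.IsAlgebraic P K] : Algebra.FormallyEtale P K := by
  let F := FractionRing P
  let : Algebra F K := FractionRing.liftAlgebra P K
  have : IsScalarTower P F K := FractionRing.isScalarTower_liftAlgebra P K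
  have : CharZero F := ⟨fun m n h => Nat.cast_injective (R := K) (by
    have := congrArg (algebraMap F K) h
    rwa [map_natCast, map_natCast] at this)⟩
  have : Algebra.IsAlgebraic F K := Algebra.IsAlgebraic.extendScalars (IsFractionRing.injective P F)
  have : Algebra.FormallyEtale P F := Algebra.FormallyEtale.of_isLocalization (nonZeroDivisors P)
  have : Algebra.FormallyEtale F K := Algebra.FormallyEtale.of_isSeparable F K
  exact Algebra.FormallyEtale.comp P F K

variable {A B M : Type*} [CommRing A] [CommRing B] [Algebra ℂ A] [Algebra ℂ B] [Algebra A B]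
  [IsScalarTower ℂ A B] [AddCommGroup M] [Module ℂ M] [Module B M] [IsScalarTower ℂ B M]

/-- For étale B the differentials of B are the base change of those of A. -/
theorem exists_derivation_extension [Module A M] [IsScalarTower ℂ A M] [IsScalarTower A B M]
    [Algebra.FormallyEtale A B] (D : Derivation ℂ A M) :
    ∃ D' : Derivation ℂ B M, ∀ a, D' (algebraMap A B a) = D a := by
  have h := KaehlerDifferential.isBaseChange_of_formallyEtale ℂ A B
  refine ⟨(h.lift D.liftKaehlerDifferential).compDer (KaehlerDifferential.D ℂ B), fun a => ?_⟩
  have := h.lift_eq D.liftKaehlerDifferential (KaehlerDifferential.D ℂ A a)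
  rw [KaehlerDifferential.map_D, Derivation.liftKaehlerDifferential_comp_D] at this
  exact this

theorem derivation_ext_of_formallyEtale [Algebra.FormallyEtale A B] {D₁ D₂ : Derivation ℂ B M}
    (h : ∀ a, D₁ (algebraMap A B a) = D₂ (algebraMap A B a)) : D₁ = D₂ := by
  have hb := KaehlerDifferential.isBaseChange_of_formallyEtale ℂ A B
  have key : D₁.liftKaehlerDifferential = D₂.liftKaehlerDifferential := by
    refine hb.algHom_ext _ _ fun x => ?_
    have hx : x ∈ Submodule.span A (Set.range (KaehlerDifferential.D ℂ A)) := by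
      rw [KaehlerDifferential.span_range_derivation]; trivial
    induction hx using Submodule.span_induction with
    | mem x hx =>
      obtain ⟨a, rfl⟩ := hx
      simp only [KaehlerDifferential.map_D, Derivation.liftKaehlerDifferential_comp_D, h]
    | zero => simp
    | add x y _ _ hx hy => simp only [map_add, hx, hy]
    | smul a x _ hx =>
      simp only [map_smul]
      rw [← algebraMap_smul B a ((KaehlerDifferential.map ℂ ℂ A B) x), map_smul, map_smul, hx]
  ext f
  rw [← Derivation.liftKaehlerDifferential_comp_D, key, Derivation.liftKaehlerDifferential_comp_D]

/-- A derivation is the ε-part of a ring homomorphism p ↦ p + ε D p into a square-zero extension,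
and such a homomorphism is determined freely by its values on constants and variables. The given `d`
need not vanish on the coefficient field. -/
theorem exists_mvPolynomial_derivation {σ K : Type*} [Field K] [Algebra ℂ K]
    (d : Derivation ℂ K (MvPolynomial σ K)) (g : σ → MvPolynomial σ K) :
    ∃ D : Derivation ℂ (MvPolynomial σ K) (MvPolynomial σ K),
      (∀ a, D (.C a) = d a) ∧ ∀ i, D (.X i) = g i := by
  let f : K →+* TrivSqZeroExt (MvPolynomial σ K) (MvPolynomial σ K) :=
    { toFun a := .inl (.C a) + .inr (d a)
      map_zero' := by simp
      map_one' := by simp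
      map_add' a b := by simp only [map_add, TrivSqZeroExt.inl_add, TrivSqZeroExt.inr_add]; abel
      map_mul' a b := by
        refine TrivSqZeroExt.ext ?_ ?_
        · simp
        · simp [MvPolynomial.smul_eq_C_mul, mul_comm (d a)] }
  have hf1 : ∀ a, (f a).fst = .C a := fun a => by simp [f]
  have hf2 : ∀ a, (f a).snd = d a := fun a => by simp [f]
  let F : MvPolynomial σ K →+* TrivSqZeroExt (MvPolynomial σ K) (MvPolynomial σ K) :=
    MvPolynomial.eval₂Hom f fun i => .inl (.X i) + .inr (g i)
  have hC : ∀ a, F (.C a) = f a := fun a => MvPolynomial.eval₂Hom_C _ _ _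
  have hX : ∀ i, F (.X i) = .inl (.X i) + .inr (g i) := fun a => MvPolynomial.eval₂Hom_X' _ _ _
  have hfst : ∀ p, (F p).fst = p := fun p => by
    induction p using MvPolynomial.induction_on with
    | C a => rw [hC, hf1]
    | add p q hp hq => rw [map_add, TrivSqZeroExt.fst_add, hp, hq]
    | mul_X p i hp => rw [map_mul, TrivSqZeroExt.fst_mul, hp, hX]; simp
  have hsnd : ∀ p q, (F (p * q)).snd = p * (F q).snd + q * (F p).snd := fun p q => by
    rw [map_mul, TrivSqZeroExt.snd_mul, hfst, hfst, smul_eq_mul, op_smul_eq_smul, smul_eq_mul]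
  refine ⟨Derivation.mk' { toFun p := (F p).snd, map_add' p q := by simp, map_smul' c p := ?_ } ?_,
    fun a => ?_, fun i => ?_⟩
  · have : c • p = MvPolynomial.C (algebraMap ℂ K c) * p := by
      rw [← MvPolynomial.smul_eq_C_mul, algebraMap_smul]
    rw [this, hsnd, hC, hf2, Derivation.map_algebraMap, mul_zero, add_zero,
      ← MvPolynomial.smul_eq_C_mul, algebraMap_smul]
    rfl
  · exact hsnd
  · change (F (.C a)).snd = d a
    rw [hC, hf2]
  · change (F (.X i)).snd = g i
    rw [hX]; simp

end DerivationExtension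

/-- Local coordinates `b` on an integral subscheme, given by a map `φ` to a field: dual derivations
of the field, and a separable algebraic relation for every function. -/
structure Coordinates {R K : Type*} [CommRing R] [Algebra ℂ R] [Field K] [Algebra ℂ K]
    (φ : R →ₐ[ℂ] K) (d : ℕ) where
  b : Fin d → R
  der : Fin d → Derivation ℂ K K
  der_b : ∀ j k, der j (φ (b k)) = if j = k then 1 else 0
  derivation_eq : ∀ (D : Derivation ℂ K K) (f : K), D f = ∑ j, D (φ (b j)) * der j f
  exists_relation : ∀ f : R, ∃ p : Polynomial (MvPolynomial (Fin d) ℂ),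
    φ (p.eval₂ (MvPolynomial.aeval b).toRingHom f) = 0 ∧
    φ (p.derivative.eval₂ (MvPolynomial.aeval b).toRingHom f) ≠ 0

/-- Take a nonzero relation of least degree. Its derivative is nonzero in characteristic zero and
has smaller degree, so it is not a relation. -/
theorem exists_separable_relation {P K : Type*} [CommRing P] [IsDomain P] [Field K] [CharZero K]
    [Algebra P K] [FaithfulSMul P K] {f : K} (hf : IsAlgebraic P f) :
    ∃ p : Polynomial P, p.aeval f = 0 ∧ p.derivative.aeval f ≠ 0 := by
  classical
  have hex : ∃ n, ∃ p : Polynomial P, p ≠ 0 ∧ p.aeval f = 0 ∧ p.natDegree = n := by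
    obtain ⟨p, hp, h⟩ := hf
    exact ⟨_, p, hp, h, rfl⟩
  obtain ⟨p, hp, h, hn⟩ := Nat.find_spec hex
  by_cases hd : p.derivative.aeval f = 0
  · have hP : CharZero P := by
      refine ⟨fun m n hmn => ?_⟩
      have := congrArg (algebraMap P K) hmn
      simpa using this
    by_cases h0 : p.natDegree = 0
    · obtain ⟨c, rfl⟩ := Polynomial.natDegree_eq_zero.1 h0
      have hc : c = 0 := FaithfulSMul.algebraMap_injective P K (by rw [map_zero, ← h, Polynomial.aeval_C])
      exact absurd (by rw [hc, map_zero]) hp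
    · have hlt := Polynomial.natDegree_derivative_lt h0
      have hne : p.derivative ≠ 0 := fun h1 =>
        h0 (Polynomial.derivative_eq_zero.1 h1)
      exact absurd ⟨_, hne, hd, rfl⟩ (Nat.find_min hex (hn ▸ hlt))
  · exact ⟨p, h, hd⟩

theorem exists_coordinates {R : Type*} [CommRing R] [Algebra ℂ R] [Algebra.FiniteType ℂ R]
    {Q : Ideal R} [Q.IsPrime] : ∃ (d : ℕ) (c : Coordinates
      ((IsScalarTower.toAlgHom ℂ (R ⧸ Q) (FractionRing (R ⧸ Q))).comp (Ideal.Quotient.mkₐ ℂ Q)) d),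
      ((Ideal.Quotient.mkₐ ℂ Q).comp (MvPolynomial.aeval c.b)).IsIntegral ∧
      Function.Injective ((Ideal.Quotient.mkₐ ℂ Q).comp (MvPolynomial.aeval (R := ℂ) c.b)) := by
  let A := R ⧸ Q
  let K := FractionRing A
  set φ : R →ₐ[ℂ] K :=
    (IsScalarTower.toAlgHom ℂ (R ⧸ Q) (FractionRing (R ⧸ Q))).comp (Ideal.Quotient.mkₐ ℂ Q) with hφ
  -- The coordinates are lifts to R of the variables of a Noether normalization P → R/Q. Integrality
  -- and injectivity are kept for the dimension count in the rank argument.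
  obtain ⟨d, g, hg, hint⟩ := exists_integral_inj_algHom_of_fg ℂ A
  choose b hb using fun j => Ideal.Quotient.mk_surjective (I := Q) (g (.X j))
  have hgb : (Ideal.Quotient.mkₐ ℂ Q).comp (MvPolynomial.aeval b) = g :=
    MvPolynomial.algHom_ext fun j => by simpa using hb j
  let P := MvPolynomial (Fin d) ℂ
  let : Algebra P A := g.toAlgebra
  have : IsScalarTower ℂ P A := IsScalarTower.of_algebraMap_eq fun c => (g.commutes c).symm
  have hgK : ∀ p : P, algebraMap P K p = algebraMap A K (g p) := fun p =>
    IsScalarTower.algebraMap_apply P A K p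
  have : IsScalarTower ℂ P K := IsScalarTower.of_algebraMap_eq fun c => by
    rw [hgK, AlgHom.commutes]; rfl
  have hinj : Function.Injective (algebraMap P K) := fun p q h =>
    hg (IsFractionRing.injective A K (by rwa [hgK, hgK] at h))
  have : FaithfulSMul P K := (faithfulSMul_iff_algebraMap_injective P K).2 hinj
  have : CharZero K := charZero_of_injective_algebraMap (algebraMap ℂ K).injective
  have : Algebra.IsIntegral P A := ⟨hint⟩
  have : Algebra.IsAlgebraic P A := inferInstance
  have : Algebra.IsAlgebraic A K :=
    (IsFractionRing.comap_isAlgebraic_iff (A := A) (K := K) (C := K)).2 inferInstance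
  have : Algebra.IsAlgebraic P K := Algebra.IsAlgebraic.trans P A K
  have := formallyEtale_of_isAlgebraic P K
  have hφb : ∀ p : P, algebraMap P K p = φ (MvPolynomial.aeval b p) := fun p => by
    rw [hgK, ← hgb]; rfl
  have hφX : ∀ j, φ (b j) = algebraMap P K (.X j) := fun j => by rw [hφb, MvPolynomial.aeval_X]
  -- The partial derivatives of P extend to K because K is algebraic, hence étale, over P.
  -- Uniqueness of extensions then gives the chain rule `derivation_eq`.
  choose der hder using fun j : Fin d => exists_derivation_extension (B := K)
    (MvPolynomial.mkDerivation ℂ (A := K) fun k : Fin d => if j = k then (1 : K) else 0)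
  have hder_b : ∀ j k, der j (φ (b k)) = if j = k then 1 else 0 := fun j k => by
    rw [hφX, hder, MvPolynomial.mkDerivation_X]
  refine ⟨d, ⟨b, der, hder_b, fun D f => ?_, fun f => ?_⟩, ?_, ?_⟩
  · have : D = ∑ j, D (φ (b j)) • der j := by
      refine derivation_ext_of_formallyEtale (A := P) fun p => ?_
      have : (D.compAlgebraMap P : Derivation ℂ P K) =
          (∑ j, D (φ (b j)) • der j : Derivation ℂ K K).compAlgebraMap P := by
        refine MvPolynomial.derivation_ext fun k => ?_
        change D (algebraMap P K (.X k)) = (∑ j, D (φ (b j)) • der j : Derivation ℂ K K)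
          (algebraMap P K (.X k))
        rw [← hφX, derivation_sum_apply]
        simp [hder_b]
      exact Derivation.congr_fun this p
    conv_lhs => rw [this]
    rw [derivation_sum_apply]
    simp
  · obtain ⟨p, h1, h2⟩ := exists_separable_relation (P := P)
      (Algebra.IsAlgebraic.isAlgebraic (R := P) (φ f))
    have key : ∀ q : Polynomial P,
        φ (q.eval₂ (MvPolynomial.aeval b).toRingHom f) = q.aeval (φ f) := fun q => by
      rw [Polynomial.aeval_def]
      have := Polynomial.hom_eval₂ q (MvPolynomial.aeval (R := ℂ) b).toRingHom φ.toRingHom f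
      refine this.trans ?_
      congr 1
      exact RingHom.ext fun p => (hφb p).symm
    exact ⟨p, by rw [key, h1], by rw [key]; exact h2⟩
  · change ((Ideal.Quotient.mkₐ ℂ Q).comp (MvPolynomial.aeval b)).IsIntegral
    rw [hgb]; exact hint
  · change Function.Injective ((Ideal.Quotient.mkₐ ℂ Q).comp (MvPolynomial.aeval b))
    rw [hgb]; exact hg
end ArcPoisson

namespace ArcPoisson
open ArcPoisson.Arc (ι T)

/-! ### Jet coordinates on the arc space and the generic ideal -/

section ArcCoordinates

variable {R K : Type*} [CommRing R] [Algebra ℂ R] [Field K] [Algebra ℂ K]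

/-- The differential ideal of `J_∞ R` generated by an ideal of `R`. -/
noncomputable def diffIdeal (Q : Ideal R) : Ideal (Arc R) :=
  Ideal.span {u | ∃ f ∈ Q, ∃ j : ℕ, u = T^[j] (ι f)}

theorem iterate_T_mem_diffIdeal {Q : Ideal R} {f : R} (hf : f ∈ Q) (j : ℕ) :
    T^[j] (ι f) ∈ diffIdeal Q := Ideal.subset_span ⟨f, hf, j, rfl⟩

theorem ι_mem_diffIdeal {Q : Ideal R} {f : R} (hf : f ∈ Q) : ι f ∈ diffIdeal Q :=
  iterate_T_mem_diffIdeal hf 0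

theorem derivation_diffIdeal_stable {Q : Ideal R} (D : Derivation ℂ (Arc R) (Arc R))
    (h : ∀ f ∈ Q, ∀ j : ℕ, D (T^[j] (ι f)) ∈ diffIdeal Q) {u : Arc R} (hu : u ∈ diffIdeal Q) :
    D u ∈ diffIdeal Q := by
  induction hu using Submodule.span_induction with
  | mem u hu =>
    obtain ⟨f, hf, j, rfl⟩ := hu
    exact h f hf j
  | zero => rw [map_zero]; exact zero_mem _
  | add u v _ _ hu hv => rw [map_add]; exact add_mem hu hv
  | smul a u hu' hu =>
    rw [smul_eq_mul, Derivation.leibniz, smul_eq_mul, smul_eq_mul]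
    exact add_mem (Ideal.mul_mem_left _ _ hu) (Ideal.mul_mem_right _ _ hu')

theorem T_mem_diffIdeal {Q : Ideal R} {u : Arc R} (hu : u ∈ diffIdeal Q) : T u ∈ diffIdeal Q :=
  derivation_diffIdeal_stable T (fun f hf j => by
    rw [← Function.iterate_succ_apply' (f := T)]; exact iterate_T_mem_diffIdeal hf _) hu

/-- Polynomials in the jets `T^(m+1) (b j)`, with coefficients in `R`. -/
noncomputable def jetEval {d : ℕ} (b : Fin d → R) : MvPolynomial (Fin d × ℕ) R →+* Arc R :=
  MvPolynomial.eval₂Hom (ι : R →ₐ[ℂ] Arc R).toRingHom fun i => T^[i.2 + 1] (ι (b i.1))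

variable {d : ℕ} (b : Fin d → R)

theorem jetEval_C (f : R) : jetEval b (.C f) = ι f := MvPolynomial.eval₂Hom_C _ _ _

theorem jetEval_X (i : Fin d × ℕ) : jetEval b (.X i) = T^[i.2 + 1] (ι (b i.1)) :=
  MvPolynomial.eval₂Hom_X' _ _ _

theorem ι_mem_range_jetEval (f : R) : ι f ∈ (jetEval b).range := ⟨_, jetEval_C b f⟩

theorem iterate_T_mem_range_jetEval (j : Fin d) (m : ℕ) :
    T^[m + 1] (ι (b j)) ∈ (jetEval b).range := ⟨_, jetEval_X b (j, m)⟩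

theorem jetEval_mem_diffIdeal {Q : Ideal R} {p : MvPolynomial (Fin d × ℕ) R}
    (hp : ∀ s, p.coeff s ∈ Q) : jetEval b p ∈ diffIdeal Q := by
  rw [p.as_sum, map_sum]
  refine sum_mem fun s _ => ?_
  rw [← mul_one (p.coeff s), ← MvPolynomial.C_mul_monomial, map_mul, jetEval_C]
  exact Ideal.mul_mem_right _ _ (ι_mem_diffIdeal (hp s))

theorem T_aeval_mem_range_jetEval (a : MvPolynomial (Fin d) ℂ) :
    T (ι (MvPolynomial.aeval b a)) ∈ (jetEval b).range := by
  induction a using MvPolynomial.induction_on with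
  | C a => 
    rw [← MvPolynomial.algebraMap_eq, AlgHom.commutes, AlgHom.commutes, Derivation.map_algebraMap]
    exact zero_mem _
  | add p q hp hq => simp only [map_add]; exact add_mem hp hq
  | mul_X p j hp =>
    simp only [map_mul, Derivation.leibniz, smul_eq_mul, MvPolynomial.aeval_X]
    exact add_mem (mul_mem (ι_mem_range_jetEval b _) (iterate_T_mem_range_jetEval b j 0))
      (mul_mem (ι_mem_range_jetEval b _) hp)

/-- By the chain rule T(q(f)) = q'(f) T f plus the contribution of the coefficients of q. Those are
polynomials in b, so that contribution only involves the first jets of b. -/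
theorem T_eval₂_sub_mem_range_jetEval (f : R) (q : Polynomial (MvPolynomial (Fin d) ℂ)) :
    T (ι (q.eval₂ (MvPolynomial.aeval b).toRingHom f)) -
      ι (q.derivative.eval₂ (MvPolynomial.aeval b).toRingHom f) * T (ι f) ∈
      (jetEval b).range := by
  induction q using Polynomial.induction_on' with
  | add p q hp hq =>
    have := add_mem hp hq
    simp only [Polynomial.eval₂_add, map_add]
    convert this using 1
    ring
  | monomial n a =>
    simp only [Polynomial.eval₂_monomial, Polynomial.derivative_monomial, map_mul, map_pow,
      Derivation.leibniz, Derivation.leibniz_pow, smul_eq_mul, nsmul_eq_mul, map_natCast]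
    convert mul_mem (pow_mem (ι_mem_range_jetEval b f) n) (T_aeval_mem_range_jetEval b a) using 1
    change ι (MvPolynomial.aeval b a) * _ + _ * T (ι (MvPolynomial.aeval b a)) -
      ι (MvPolynomial.aeval b a) * _ * _ * _ = _
    ring

variable {b} {φ : R →ₐ[ℂ] K}

/-- Up to a nonzero function, every element is a polynomial in the jets of coordinates. -/
def IsJetPoly (φ : R →ₐ[ℂ] K) (b : Fin d → R) (u : Arc R) : Prop :=
  ∃ g, φ g ≠ 0 ∧ ∃ p ∈ (jetEval b).range, ι g * u - p ∈ diffIdeal (RingHom.ker φ)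

theorem IsJetPoly.of_mem {u : Arc R} (h : u ∈ (jetEval b).range) : IsJetPoly φ b u :=
  ⟨1, by simp, u, h, by simp⟩

theorem IsJetPoly.add {u v : Arc R} (hu : IsJetPoly φ b u) (hv : IsJetPoly φ b v) :
    IsJetPoly φ b (u + v) := by
  obtain ⟨g, hg, p, hp, h⟩ := hu
  obtain ⟨g', hg', p', hp', h'⟩ := hv
  refine ⟨g * g', by simp [hg, hg'], ι g' * p + ι g * p', add_mem
    (mul_mem (ι_mem_range_jetEval b _) hp) (mul_mem (ι_mem_range_jetEval b _) hp'), ?_⟩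
  convert add_mem (Ideal.mul_mem_left _ (ι g') h) (Ideal.mul_mem_left _ (ι g) h') using 1
  rw [map_mul]; ring

theorem IsJetPoly.mul {u v : Arc R} (hu : IsJetPoly φ b u) (hv : IsJetPoly φ b v) :
    IsJetPoly φ b (u * v) := by
  obtain ⟨g, hg, p, hp, h⟩ := hu
  obtain ⟨g', hg', p', hp', h'⟩ := hv
  refine ⟨g * g', by simp [hg, hg'], p * p', mul_mem hp hp', ?_⟩
  convert add_mem (Ideal.mul_mem_left _ (ι g' * v) h) (Ideal.mul_mem_left _ p h') using 1
  rw [map_mul]; ring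

theorem IsJetPoly.of_mul {u : Arc R} {g : R} (hg : φ g ≠ 0) (h : IsJetPoly φ b (ι g * u)) :
    IsJetPoly φ b u := by
  obtain ⟨g', hg', p', hp', h'⟩ := h
  exact ⟨g' * g, by simp [hg, hg'], p', hp', by rwa [map_mul, mul_assoc]⟩

theorem IsJetPoly.of_sub_mem {u v : Arc R} (hv : IsJetPoly φ b v)
    (h : u - v ∈ diffIdeal (RingHom.ker φ)) : IsJetPoly φ b u := by
  obtain ⟨g, hg, p, hp, h'⟩ := hv
  refine ⟨g, hg, p, hp, ?_⟩
  convert add_mem h' (Ideal.mul_mem_left _ (ι g) h) using 1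
  ring

/-- Apply T to a separable relation q(f) = 0: modulo the differential ideal, q'(f) T f becomes a jet
polynomial, and q'(f) is generically nonzero. -/
theorem isJetPoly_T_ι (c : Coordinates φ d) (f : R) : IsJetPoly φ c.b (T (ι f)) := by
  obtain ⟨q, h0, hq⟩ := c.exists_relation f
  refine ⟨_, hq, _, neg_mem (T_eval₂_sub_mem_range_jetEval c.b f q), ?_⟩
  convert T_mem_diffIdeal (ι_mem_diffIdeal (RingHom.mem_ker.2 h0)) using 1
  ring

theorem isJetPoly_T_of_mem_range (c : Coordinates φ d) {p : Arc R} (hp : p ∈ (jetEval c.b).range) :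
    IsJetPoly φ c.b (T p) := by
  obtain ⟨p, rfl⟩ := hp
  induction p using MvPolynomial.induction_on with
  | C f => rw [jetEval_C]; exact isJetPoly_T_ι c f
  | add p q hp hq => rw [map_add, map_add]; exact hp.add hq
  | mul_X p i hp =>
    rw [map_mul, Derivation.leibniz, smul_eq_mul, smul_eq_mul, jetEval_X,
      ← Function.iterate_succ_apply' (f := T)]
    exact .add (.mul (.of_mem ⟨p, rfl⟩) (.of_mem (iterate_T_mem_range_jetEval _ _ _)))
      (.mul (.of_mem (iterate_T_mem_range_jetEval _ _ _)) hp)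

theorem isJetPoly (c : Coordinates φ d) (u : Arc R) : IsJetPoly φ c.b u := by
  induction u using Arc.induction with
  | hι a => exact .of_mem (ι_mem_range_jetEval _ _)
  | hT u hu =>
    have hu' := hu
    obtain ⟨g, hg, p, hp, h⟩ := hu
    -- Differentiating g u ≡ p gives g T u ≡ T p - T(g) u, whose right side is already known to be a
    -- jet polynomial up to denominators.
    refine .of_mul hg (.of_sub_mem (v := T p + -1 * (T (ι g) * u)) (.add (isJetPoly_T_of_mem_range c hp)
      (.mul (.of_mem (neg_mem (one_mem _))) (.mul (isJetPoly_T_ι c g) hu'))) ?_)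
    convert T_mem_diffIdeal h using 1
    rw [map_sub, Derivation.leibniz, smul_eq_mul, smul_eq_mul]; ring
  | hadd u v hu hv => exact hu.add hv
  | hmul u v hu hv => exact hu.mul hv

theorem exists_jetMap (c : Coordinates φ d) :
    ∃ Ψ : Arc R →ₐ[ℂ] MvPolynomial (Fin d × ℕ) K,
      (∀ p, Ψ (jetEval c.b p) = MvPolynomial.map φ.toRingHom p) ∧
      ∀ u ∈ diffIdeal (RingHom.ker φ), Ψ u = 0 := by
  -- The variable x_(j,m) stands for T^(m+1) b_j. Accordingly the derivation on K[x] is f ↦ ∑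
  -- x_(j,0) ∂_j f on K and sends x_(j,m) to x_(j,m+1). The universal property of J_∞R then provides
  -- the map.
  let δ : Derivation ℂ K (MvPolynomial (Fin d × ℕ) K) :=
    Derivation.mk' (∑ j, (LinearMap.mulLeft ℂ (MvPolynomial.X (j, 0))) ∘ₗ
      ((IsScalarTower.toAlgHom ℂ K (MvPolynomial (Fin d × ℕ) K)).toLinearMap ∘ₗ
        (c.der j).toLinearMap)) fun a b => by
      simp [Finset.smul_sum, ← Finset.sum_add_distrib, MvPolynomial.smul_eq_C_mul,
        MvPolynomial.algebraMap_eq]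
      refine Finset.sum_congr rfl fun j _ => by ring
  have hδ : ∀ a, δ a = ∑ j, MvPolynomial.X (j, 0) * MvPolynomial.C (c.der j a) := fun a => by
    simp [δ, MvPolynomial.algebraMap_eq]
  obtain ⟨D, hD, hDX⟩ := exists_mvPolynomial_derivation δ fun i => .X (i.1, i.2 + 1)
  let Ψ := Arc.lift D ((IsScalarTower.toAlgHom ℂ K (MvPolynomial (Fin d × ℕ) K)).comp φ)
  have hι : ∀ f, Ψ (ι f) = .C (φ f) := fun f => Arc.lift_ι _ _ f
  have hT : ∀ m u, Ψ (T^[m] u) = D^[m] (Ψ u) := fun m u => by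
    induction m with
    | zero => rfl
    | succ m ih => rw [Function.iterate_succ_apply', Function.iterate_succ_apply', Arc.lift_T, ih]
  have hX : ∀ i : Fin d × ℕ, Ψ (T^[i.2 + 1] (ι (c.b i.1))) = .X i := fun ⟨j, m⟩ => by
    rw [hT, hι]
    induction m with
    | zero =>
      simp [hD, hδ, c.der_b]
    | succ m ih => rw [Function.iterate_succ_apply', ih, hDX]
  refine ⟨Ψ, fun p => ?_, fun u hu => ?_⟩
  · induction p using MvPolynomial.induction_on with
    | C f => rw [jetEval_C, hι, MvPolynomial.map_C]; rfl
    | add p q hp hq => simp only [map_add, hp, hq]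
    | mul_X p i hp => simp only [map_mul, hp, jetEval_X, hX, MvPolynomial.map_X]
  · have : diffIdeal (RingHom.ker φ) ≤ RingHom.ker Ψ := Ideal.span_le.2 fun u hu => by
      obtain ⟨f, hf, j, rfl⟩ := hu
      change Ψ _ = 0
      rw [hT, hι, RingHom.mem_ker.1 hf, map_zero, iterate_map_zero]
    exact this hu

/-- N is the kernel of the jet map. If u is killed and g u ≡ p for a jet polynomial p, then p is
killed too, so its coefficients vanish under φ and p itself lies in the differential ideal. -/
theorem exists_genericIdeal (c : Coordinates φ d) : ∃ N : Ideal (Arc R), N.IsPrime ∧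
    (∀ u, u ∈ N ↔ ∃ g, φ g ≠ 0 ∧ ι g * u ∈ diffIdeal (RingHom.ker φ)) ∧
    ∀ p, jetEval c.b p ∈ N ↔ MvPolynomial.map φ.toRingHom p = 0 := by
  obtain ⟨Ψ, h1, h2⟩ := exists_jetMap c
  have hι : ∀ f, Ψ (ι f) = .C (φ f) := fun f => by
    rw [← jetEval_C c.b, h1, MvPolynomial.map_C]; rfl
  refine ⟨RingHom.ker Ψ, RingHom.ker_isPrime Ψ, fun u => ⟨fun h => ?_, ?_⟩, fun p => ?_⟩
  · obtain ⟨g, hg, _, ⟨p, rfl⟩, hp⟩ := isJetPoly c u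
    refine ⟨g, hg, ?_⟩
    have h3 := h2 _ hp
    rw [map_sub, map_mul, RingHom.mem_ker.1 h, mul_zero, zero_sub, neg_eq_zero, h1] at h3
    rw [← sub_add_cancel (ι g * u) (jetEval c.b p)]
    refine add_mem hp (jetEval_mem_diffIdeal _ fun s => ?_)
    have := congrArg (MvPolynomial.coeff s) h3
    rwa [MvPolynomial.coeff_map, MvPolynomial.coeff_zero] at this
  · rintro ⟨g, hg, h⟩
    have := h2 _ h
    rw [map_mul, hι] at this
    exact (mul_eq_zero.1 this).resolve_left (by simpa using hg)
  · rw [RingHom.mem_ker, h1]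

end ArcCoordinates
end ArcPoisson

namespace ArcPoisson
open ArcPoisson.Arc (ι T nprod)
open ArcPoisson.PoissonAlgebra (bracket)

/-! ### Chiral Poisson ideals at a generic point -/

section Chiral

variable {R : Type*} [CommRing R] [Algebra ℂ R] [PoissonAlgebra R]

/-- The operator `a_(n)` as a derivation of `J_∞ R`. -/
noncomputable def nprodDer (n : ℕ) (a : Arc R) : Derivation ℂ (Arc R) (Arc R) :=
  Derivation.mk' (Arc.Tail.coeff n ∘ₗ Arc.prodTail a) fun b c => by
    have := Arc.nprod_mul_right n a b c
    change nprod n a (b * c) = b * nprod n a c + c * nprod n a b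
    rw [this]; ring

theorem nprodDer_apply (n : ℕ) (a b : Arc R) : nprodDer n a b = nprod n a b := rfl

/-- The falling factorial accumulates from the terms n a_(n-1) when a_(n) is moved past T. It is
zero for n > m, where the truncated exponent `m - n` has no meaning. -/
theorem nprod_ι_iterate_T (n m : ℕ) (a f : R) : nprod n (ι a) (T^[m] (ι f)) =
    (m.descFactorial n : ℂ) • T^[m - n] (ι (bracket a f)) := by
  induction m generalizing n with
  | zero =>
    rw [Function.iterate_zero_apply, Arc.nprod_ι_ι]
    cases n <;> simp
  | succ m ih =>
    rw [Function.iterate_succ_apply', Arc.nprod_T_right, ih, ih]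
    cases n with
    | zero => simp [Function.iterate_succ_apply']
    | succ k =>
      rw [Derivation.map_smul, ← Function.iterate_succ_apply' (f := T), smul_smul,
        Nat.add_sub_cancel, Nat.succ_descFactorial_succ, Nat.add_sub_add_right]
      rcases lt_trichotomy k m with h | rfl | h
      · rw [show (m - (k + 1)).succ = m - k by omega, ← add_smul, Nat.descFactorial_succ]
        congr 1
        push_cast [h.le]
        ring
      · simp
      · simp [Nat.descFactorial_of_lt h]

theorem isChiralPoissonIdeal_of_ι {I : Ideal (Arc R)}
    (h : ∀ (a : R) (n : ℕ), ∀ u ∈ I, nprod n (ι a) u ∈ I) : IsChiralPoissonIdeal I := by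
  intro a
  induction a using Arc.induction with
  | hι a => exact h a
  | hT a ha =>
    intro n u hu
    rw [Arc.nprod_T_left]
    exact neg_mem (Submodule.smul_of_tower_mem I _ (ha _ u hu))
  | hadd a b ha hb =>
    intro n u hu
    have : nprod n (a + b) u = nprod n a u + nprod n b u := by simp [nprod]
    rw [this]
    exact add_mem (ha n u hu) (hb n u hu)
  | hmul a b ha hb =>
    intro n u hu
    rw [Arc.nprod_mul_left]
    exact finsum_induction (· ∈ I) (zero_mem _) (fun _ _ => add_mem) fun i =>
      add_mem (I.mul_mem_left _ (ha _ u hu)) (I.mul_mem_left _ (hb _ u hu))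

theorem isChiralPoissonIdeal_diffIdeal {Q : Ideal R} (hQ : IsPoissonIdeal Q) :
    IsChiralPoissonIdeal (diffIdeal Q) :=
  isChiralPoissonIdeal_of_ι fun a n _ hu =>
    derivation_diffIdeal_stable (nprodDer n (ι a)) (fun f hf j => by
      rw [nprodDer_apply, nprod_ι_iterate_T]
      exact Submodule.smul_of_tower_mem _ _ (iterate_T_mem_diffIdeal (hQ a f hf) _)) hu

theorem isPoissonIdeal_comap_ι {J : Ideal (Arc R)} (hJ : IsChiralPoissonIdeal J) :
    IsPoissonIdeal (J.comap (ι : R →ₐ[ℂ] Arc R)) := fun a f hf => by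
  have := hJ (ι a) 0 (ι f) hf
  rwa [Arc.nprod_ι_ι, if_pos rfl] at this

theorem isChiralPoissonIdeal_sup {I J : Ideal (Arc R)} (hI : IsChiralPoissonIdeal I)
    (hJ : IsChiralPoissonIdeal J) : IsChiralPoissonIdeal (I ⊔ J) := fun a n u hu => by
  obtain ⟨v, hv, w, hw, rfl⟩ := Submodule.mem_sup.1 hu
  rw [← nprodDer_apply, map_add]
  exact Submodule.add_mem_sup (hI a n v hv) (hJ a n w hw)

variable {K : Type*} [Field K] [Algebra ℂ K] {φ : R →ₐ[ℂ] K} {d : ℕ}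

theorem isChiralPoissonIdeal_generic {N : Ideal (Arc R)} (hφ : IsPoissonIdeal (RingHom.ker φ))
    (hN : ∀ u, u ∈ N ↔ ∃ g, φ g ≠ 0 ∧ ι g * u ∈ diffIdeal (RingHom.ker φ)) :
    IsChiralPoissonIdeal N := fun a n u hu => by
  rw [hN] at hu ⊢
  obtain ⟨g, hg, h⟩ := hu
  -- The square clears the derivative of g: g · a_(n)(g u) = g² a_(n) u + a_(n)(g) · g u.
  refine ⟨g * g, by simp [hg], ?_⟩
  have h1 := isChiralPoissonIdeal_diffIdeal hφ a n _ h
  rw [Arc.nprod_mul_right] at h1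
  have := sub_mem (Ideal.mul_mem_left _ (ι g) h1) (Ideal.mul_mem_left _ (nprod n a (ι g)) h)
  convert this using 1
  rw [map_mul]; ring

/-- The operator a_(m+1) is a derivation that kills R and all T^k b_j with k ≤ m, and sends T^(m+1)
b_j, the variable (j, m), to (m+1)! {a, b_j}. So only the top jets contribute. -/
theorem nprod_jetEval (b : Fin d → R) (m : ℕ) (a : R) {p : MvPolynomial (Fin d × ℕ) R}
    (hp : ∀ i ∈ p.vars, i.2 ≤ m) : nprod (m + 1) (ι a) (jetEval b p) =
      jetEval b (∑ j, .C (((m + 1).factorial : ℂ) • bracket a (b j)) *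
        MvPolynomial.pderiv (j, m) p) := by
  replace hp : p ∈ MvPolynomial.supported R {i : Fin d × ℕ | i.2 ≤ m} :=
    MvPolynomial.mem_supported.2 fun i hi => hp i hi
  rw [MvPolynomial.supported_eq_adjoin_X] at hp
  induction hp using Algebra.adjoin_induction with
  | mem p hp =>
    classical
    obtain ⟨⟨k, n⟩, hn, rfl⟩ := hp
    rw [jetEval_X, nprod_ι_iterate_T]
    simp only [MvPolynomial.pderiv_X, Pi.single_apply, Prod.mk.injEq]
    rcases (show n ≤ m from hn).lt_or_eq with h | rfl
    · rw [Nat.descFactorial_of_lt (by omega), Nat.cast_zero, zero_smul,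
        Finset.sum_eq_zero fun j _ => by simp [h.ne], map_zero]
    · rw [Finset.sum_eq_single k (fun j _ hj => by simp [Ne.symm hj]) (by simp)]
      rw [Nat.descFactorial_self]
      simp [jetEval_C]
  | algebraMap f =>
    rw [MvPolynomial.algebraMap_eq, jetEval_C, Arc.nprod_ι_ι]
    simp
  | add p q _ _ hp hq =>
    rw [map_add, ← nprodDer_apply, map_add, nprodDer_apply, nprodDer_apply, hp, hq]
    simp only [map_add, mul_add, Finset.sum_add_distrib]
  | mul p q _ _ hp hq =>
    rw [map_mul, Arc.nprod_mul_right, hp, hq, ← map_mul, ← map_mul, ← map_add]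
    congr 1
    rw [Finset.sum_mul, Finset.mul_sum, ← Finset.sum_add_distrib]
    refine Finset.sum_congr rfl fun j _ => ?_
    rw [Derivation.leibniz, smul_eq_mul, smul_eq_mul]; ring

-- Coefficients killed by φ are dropped, so that every variable that remains really occurs over K.
-- Otherwise such coefficients could raise the apparent highest jet order.
omit [PoissonAlgebra R] in
theorem exists_restrict_support (b : Fin d → R) (p : MvPolynomial (Fin d × ℕ) R) :
    ∃ q, MvPolynomial.map φ.toRingHom q = MvPolynomial.map φ.toRingHom p ∧
      (∀ s, q.coeff s ≠ 0 → φ (p.coeff s) ≠ 0) ∧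
      jetEval b p - jetEval b q ∈ diffIdeal (RingHom.ker φ) := by
  classical
  let P := MvPolynomial.map φ.toRingHom p
  let q : MvPolynomial (Fin d × ℕ) R := ∑ s ∈ P.support, MvPolynomial.monomial s (p.coeff s)
  have hP : ∀ s, P.coeff s = φ (p.coeff s) := fun s => MvPolynomial.coeff_map _ _ _
  have hq : ∀ s, q.coeff s = if φ (p.coeff s) ≠ 0 then p.coeff s else 0 := fun s => by
    rw [MvPolynomial.coeff_sum]
    simp only [MvPolynomial.coeff_monomial, Finset.sum_ite_eq', MvPolynomial.mem_support_iff, hP]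
  have hφq : ∀ s, φ (q.coeff s) = φ (p.coeff s) := fun s => by
    rw [hq]; split_ifs with h
    · rfl
    · rw [map_zero, not_not.1 h]
  refine ⟨q, MvPolynomial.ext _ _ fun s => ?_, fun s hs => ?_, ?_⟩
  · rw [MvPolynomial.coeff_map, MvPolynomial.coeff_map]; exact hφq s
  · rw [hq] at hs
    by_contra h
    exact hs (if_neg (not_not.2 h))
  · rw [← map_sub]
    refine jetEval_mem_diffIdeal b fun s => ?_
    rw [MvPolynomial.coeff_sub, RingHom.mem_ker, map_sub, hφq, sub_self]

/-- At a generic point where the Poisson bracket is nondegenerate, a chiral Poisson ideal that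
contains more than the generic ideal contains a nonzero function. -/
theorem exists_ι_mem_of_chiral (c : Coordinates φ d)
    {a : Fin d → R} (hdet : (Matrix.of fun i j => φ (bracket (a i) (c.b j))).det ≠ 0)
    {J : Ideal (Arc R)} (hJ : IsChiralPoissonIdeal J) (hle : diffIdeal (RingHom.ker φ) ≤ J)
    {p : MvPolynomial (Fin d × ℕ) R} (hpJ : jetEval c.b p ∈ J)
    (hp : MvPolynomial.map φ.toRingHom p ≠ 0) : ∃ u, φ u ≠ 0 ∧ ι u ∈ J := by
  classical
  -- Descent on the degree, counting only the terms whose coefficient is nonzero under φ.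
  have hex : ∃ n, ∃ p : MvPolynomial (Fin d × ℕ) R, jetEval c.b p ∈ J ∧
      MvPolynomial.map φ.toRingHom p ≠ 0 ∧ ∀ s, φ (p.coeff s) ≠ 0 → s.degree ≤ n := by
    refine ⟨p.support.sup Finsupp.degree, p, hpJ, hp, fun s hs => Finset.le_sup ?_⟩
    rw [MvPolynomial.mem_support_iff]
    rintro h
    rw [h, map_zero] at hs
    exact hs rfl
  obtain ⟨p, hpJ, hp, hdeg⟩ := Nat.find_spec hex
  have hmin := fun {n} => Nat.find_min hex (m := n)
  set n := Nat.find hex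
  have hcoeff : ∀ p : MvPolynomial (Fin d × ℕ) R, ∀ s,
      (MvPolynomial.map φ.toRingHom p).coeff s = φ (p.coeff s) :=
    fun p s => MvPolynomial.coeff_map _ _ _
  -- In degree zero the polynomial is, modulo the differential ideal, its constant term, which is
  -- the desired function.
  by_cases hconst : ∀ s, φ (p.coeff s) ≠ 0 → s = 0
  · refine ⟨p.coeff 0, fun h0 => hp (MvPolynomial.ext _ _ fun s => ?_), ?_⟩
    · rw [hcoeff, MvPolynomial.coeff_zero]
      by_contra h
      exact h (hconst s h ▸ h0)
    · have : jetEval c.b (p - .C (p.coeff 0)) ∈ diffIdeal (RingHom.ker φ) := by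
        refine jetEval_mem_diffIdeal _ fun s => ?_
        rw [RingHom.mem_ker, MvPolynomial.coeff_sub, MvPolynomial.coeff_C, map_sub]
        split_ifs with h
        · rw [h, sub_self]
        · rw [map_zero, sub_zero]
          by_contra h'
          exact h (hconst s h').symm
      rw [map_sub, jetEval_C] at this
      simpa using sub_mem hpJ (hle this)
  · exfalso
    push Not at hconst
    obtain ⟨s₀, hs₀, hs₀'⟩ := hconst
    obtain ⟨q, hq, hqs, hqJ⟩ := exists_restrict_support (φ := φ) c.b p
    have hqJ : jetEval c.b q ∈ J := by simpa using sub_mem hpJ (hle hqJ)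
    have hφq : ∀ s, φ (q.coeff s) = φ (p.coeff s) := fun s => by rw [← hcoeff, hq, hcoeff]
    obtain ⟨i₀, hi₀⟩ := Finsupp.ne_iff.1 hs₀'
    have hvar : i₀ ∈ q.vars := (MvPolynomial.mem_vars_iff_mem_support _).2 ⟨s₀, by
      rw [MvPolynomial.mem_support_iff]
      intro h
      exact hs₀ (by rw [← hφq, h, map_zero]), Finsupp.mem_support_iff.2 hi₀⟩
    obtain ⟨i₁, hi₁, hmax⟩ := q.vars.exists_max_image (fun i => i.2) ⟨i₀, hvar⟩
    obtain ⟨j₁, m⟩ := i₁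
    obtain ⟨s₁, hs₁, hs₁'⟩ := (MvPolynomial.mem_vars_iff_mem_support _).1 hi₁
    rw [MvPolynomial.mem_support_iff] at hs₁
    rw [Finsupp.mem_support_iff] at hs₁'
    -- Since m is the highest order, a_(m+1) produces an element of J of smaller degree. By
    -- minimality it must vanish over K.
    have key : ∀ a : R, ∑ j, MvPolynomial.C (φ (bracket a (c.b j))) *
        MvPolynomial.pderiv (j, m) (MvPolynomial.map φ.toRingHom q) = 0 := fun a => by
      by_contra hne
      have h1 := hJ (ι a) (m + 1) _ hqJ
      rw [nprod_jetEval c.b m a hmax] at h1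
      have hn0 : n ≠ 0 := fun h0 => by
        have := hdeg s₀ hs₀
        rw [h0, Nat.le_zero, Finsupp.degree_eq_zero_iff] at this
        exact hs₀' this
      have hmap : MvPolynomial.map φ.toRingHom
          (∑ j, .C (((m + 1).factorial : ℂ) • bracket a (c.b j)) * MvPolynomial.pderiv (j, m) q) =
          ((m + 1).factorial : ℂ) • ∑ j, MvPolynomial.C (φ (bracket a (c.b j))) *
            MvPolynomial.pderiv (j, m) (MvPolynomial.map φ.toRingHom q) := by
        rw [map_sum, Finset.smul_sum]
        refine Finset.sum_congr rfl fun j _ => ?_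
        rw [map_mul, MvPolynomial.map_C, MvPolynomial.pderiv_map]
        change MvPolynomial.C (φ _) * _ = _
        rw [map_smul, ← smul_mul_assoc]
        congr 1
        exact map_smul (IsScalarTower.toAlgHom ℂ K (MvPolynomial (Fin d × ℕ) K)) _ _
      refine hmin (Nat.pred_lt hn0) ⟨_, h1, ?_, fun s hs => ?_⟩
      · rw [hmap]
        exact smul_ne_zero (by exact_mod_cast (Nat.factorial_pos _).ne') hne
      · rw [← hcoeff, hmap, MvPolynomial.coeff_smul, MvPolynomial.coeff_sum] at hs
        obtain ⟨j, -, hj⟩ := Finset.exists_ne_zero_of_sum_ne_zero (right_ne_zero_of_smul hs)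
        rw [MvPolynomial.coeff_C_mul, MvPolynomial.coeff_pderiv, hcoeff, hφq] at hj
        have := hdeg _ (left_ne_zero_of_mul (right_ne_zero_of_mul hj))
        rw [map_add, Finsupp.degree_single] at this
        exact Nat.le_pred_of_lt this
    -- The invertible matrix of brackets turns these relations into the vanishing of each top
    -- partial derivative. A monomial containing (j₁, m) contradicts this in characteristic zero.
    have hzero : ∀ s, (MvPolynomial.pderiv (j₁, m) (MvPolynomial.map φ.toRingHom q)).coeff s = 0 := by
      intro s
      refine congrFun (Matrix.eq_zero_of_mulVec_eq_zero hdet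
        (v := fun j => (MvPolynomial.pderiv (j, m) (MvPolynomial.map φ.toRingHom q)).coeff s) ?_) j₁
      ext i
      have := congrArg (MvPolynomial.coeff s) (key (a i))
      rw [MvPolynomial.coeff_sum] at this
      simpa [Matrix.mulVec, dotProduct, MvPolynomial.coeff_C_mul] using this
    have h2 := hzero (s₁ - Finsupp.single (j₁, m) 1)
    rw [MvPolynomial.coeff_pderiv, Finsupp.sub_add_single_one_cancel hs₁', hcoeff, hφq] at h2
    have : CharZero K := charZero_of_injective_algebraMap (algebraMap ℂ K).injective
    refine (mul_eq_zero.1 h2).elim (hqs s₁ hs₁) ?_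
    exact Nat.cast_add_one_ne_zero _

end Chiral
end ArcPoisson

namespace ArcPoisson
open scoped TensorProduct PowerSeries

/-! ### Base change to a field, and formal branches of curves -/

section BaseChange

/-- A ℂ-basis of K is an A-basis of A ⊗ K, and specialization at a point of A acts on coordinates.
Given nonzero z and w, a point where one coordinate of each stays nonzero maps both to nonzero
elements of the field K. -/
theorem isDomain_tensorProduct {A K : Type*} [CommRing A] [IsDomain A] [Algebra ℂ A]
    [Algebra.FiniteType ℂ A] [Field K] [Algebra ℂ K] : IsDomain (A ⊗[ℂ] K) := by
  let e := Module.Basis.ofVectorSpace ℂ K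
  let E := Algebra.TensorProduct.basis A e
  have key : ∀ (p : Pt A) (z : A ⊗[ℂ] K), e.repr (Algebra.TensorProduct.lift
      ((Algebra.ofId ℂ K).comp p.toAlgHom) (AlgHom.id ℂ K) (fun _ _ => Commute.all _ _) z) =
        (E.repr z).mapRange p (map_zero p) := fun p z => by
    induction z with
    | zero => simp
    | add x y hx hy =>
      rw [map_add, map_add, hx, hy, map_add, Finsupp.mapRange_add (map_add p)]
    | tmul a k =>
      ext i
      rw [Algebra.TensorProduct.lift_tmul, Finsupp.mapRange_apply,
        Algebra.TensorProduct.basis_repr_tmul]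
      change e.repr (algebraMap ℂ K (p a) * k) i = p (a • algebraMap ℂ A (e.repr k i))
      rw [← Algebra.smul_def, map_smul, Finsupp.smul_apply, smul_eq_mul, smul_eq_mul, map_mul,
        AlgHomClass.commutes]
      rfl
  have : Nontrivial (A ⊗[ℂ] K) := inferInstance
  have : NoZeroDivisors (A ⊗[ℂ] K) := ⟨fun {z w} hzw => by
    by_contra! H
    obtain ⟨hz, hw⟩ := H
    obtain ⟨i, hi⟩ := Finsupp.ne_iff.1 (E.repr.map_ne_zero_iff.2 hz)
    obtain ⟨j, hj⟩ := Finsupp.ne_iff.1 (E.repr.map_ne_zero_iff.2 hw)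
    obtain ⟨p, -, hp⟩ := exists_pt_ne_zero_of_finiteType (P := (⊥ : Ideal A))
      (f := E.repr z i * E.repr w j) (mul_ne_zero hi hj)
    rw [map_mul] at hp
    have h0 := congrArg (Algebra.TensorProduct.lift
      ((Algebra.ofId ℂ K).comp p.toAlgHom) (AlgHom.id ℂ K) (fun _ _ => Commute.all _ _)) hzw
    rw [map_mul, map_zero, mul_eq_zero] at h0
    rcases h0 with h0 | h0
    · have := DFunLike.congr_fun (key p z) i
      rw [h0, map_zero] at this
      exact left_ne_zero_of_mul hp this.symm
    · have := DFunLike.congr_fun (key p w) j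
      rw [h0, map_zero] at this
      exact right_ne_zero_of_mul hp this.symm⟩
  exact NoZeroDivisors.to_isDomain _

end BaseChange

section Curves

variable {K : Type*} [Field K]

/-- Expansion of the elements of a discrete valuation ring with a coefficient field as power series
in a uniformizer. -/
theorem exists_taylorHom {O : Type*} [CommRing O] [IsDomain O] [IsDiscreteValuationRing O]
    [Algebra K O] (a : O →ₐ[K] K) : ∃ τ : O →ₐ[K] K⟦X⟧, Function.Injective τ ∧
      ∀ f, PowerSeries.constantCoeff (τ f) = a f := by
  have ha : RingHom.ker a = IsLocalRing.maximalIdeal O := by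
    have : (RingHom.ker a).IsMaximal := RingHom.ker_isMaximal_of_surjective a
      fun k => ⟨algebraMap K O k, a.commutes k⟩
    exact IsLocalRing.eq_maximalIdeal this
  obtain ⟨π, hπ⟩ := IsDiscreteValuationRing.exists_irreducible O
  have haπ : a π = 0 := by
    rw [← RingHom.mem_ker, ha]; exact (IsLocalRing.mem_maximalIdeal _).2 hπ.not_isUnit
  -- Division by the uniformizer: f = a(f) + π r(f). The n-th Taylor coefficient of f will be a(r^n
  -- f).
  have hex : ∀ f, ∃ g, f = algebraMap K O (a f) + π * g := fun f => by
    have : f - algebraMap K O (a f) ∈ IsLocalRing.maximalIdeal O := by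
      rw [← ha, RingHom.mem_ker, map_sub, a.commutes, Algebra.algebraMap_self_apply, sub_self]
    rw [hπ.maximalIdeal_eq, Ideal.mem_span_singleton] at this
    obtain ⟨g, hg⟩ := this
    exact ⟨g, by rw [← hg]; ring⟩
  choose r hr using hex
  have hr_unique : ∀ f c g, f = algebraMap K O c + π * g → c = a f ∧ g = r f := fun f c g h => by
    have h1 : c = a f := by rw [h]; simp [haπ]
    refine ⟨h1, mul_left_cancel₀ hπ.ne_zero (add_left_cancel (a := algebraMap K O (a f)) ?_)⟩
    rw [← hr, ← h1, ← h]
  have hradd : ∀ f g, r (f + g) = r f + r g := fun f g =>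
    (hr_unique _ (a f + a g) _ (by conv_lhs => rw [hr f, hr g]
                                   rw [map_add]; ring)).2.symm
  have hrmul : ∀ f g, r (f * g) = algebraMap K O (a f) * r g + r f * g := fun f g =>
    (hr_unique _ (a f * a g) _ (by
      conv_lhs => rw [hr f]
      rw [map_mul]
      conv_lhs => rw [add_mul]; lhs; rw [hr g]
      ring)).2.symm
  have hrC : ∀ c, r (algebraMap K O c) = 0 := fun c =>
    (hr_unique _ c 0 (by rw [mul_zero, add_zero])).2.symm
  let t : O → K⟦X⟧ := fun f => PowerSeries.mk fun n => a (r^[n] f)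
  have ht : ∀ f n, PowerSeries.coeff n (t f) = a (r^[n] f) := fun f n => PowerSeries.coeff_mk _ _
  have ht_succ : ∀ f n, PowerSeries.coeff (n + 1) (t f) = PowerSeries.coeff n (t (r f)) :=
    fun f n => by rw [ht, ht, Function.iterate_succ_apply]
  have ht0 : ∀ f, PowerSeries.constantCoeff (t f) = a f := fun f => by
    rw [← PowerSeries.coeff_zero_eq_constantCoeff_apply, ht]; rfl
  have ht_add : ∀ f g, t (f + g) = t f + t g := fun f g => by
    ext n
    induction n generalizing f g with
    | zero => simp [ht0]
    | succ n ih => rw [ht_succ, hradd, ih, map_add, map_add, ht_succ, ht_succ]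
  have htC : ∀ c, t (algebraMap K O c) = PowerSeries.C c := fun c => by
    ext n
    cases n with
    | zero => simp [ht]
    | succ n =>
      have hr0 : r 0 = 0 := by simpa using hrC 0
      rw [ht_succ, hrC, ht, Function.iterate_fixed hr0, map_zero, PowerSeries.coeff_C,
        if_neg n.succ_ne_zero]
  have ht_expand : ∀ f, t f = PowerSeries.C (a f) + PowerSeries.X * t (r f) := fun f => by
    ext n
    cases n with
    | zero => simp [ht]
    | succ n => rw [ht_succ, map_add, PowerSeries.coeff_succ_X_mul, PowerSeries.coeff_C]; simp
  have ht_mul : ∀ f g, t (f * g) = t f * t g := fun f g => by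
    ext n
    induction n generalizing f g with
    | zero => simp [ht0]
    | succ n ih =>
      rw [ht_succ, hrmul, ht_add, map_add, ih, ih, htC, ht_expand f, add_mul, map_add,
        PowerSeries.coeff_C_mul, PowerSeries.coeff_C_mul, mul_assoc, PowerSeries.coeff_succ_X_mul,
        ht_succ]
  let τ : O →ₐ[K] K⟦X⟧ :=
    { toFun := t
      map_one' := by rw [← map_one (algebraMap K O), htC, map_one]
      map_zero' := by rw [← map_zero (algebraMap K O), htC, map_zero]
      map_add' := ht_add
      map_mul' := ht_mul
      commutes' := htC }
  refine ⟨τ, (injective_iff_map_eq_zero τ).2 fun f hf => ?_, fun f => ?_⟩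
  · by_contra hne
    -- A nonzero element is a unit times π^n, and π expands to the variable.
    obtain ⟨n, u, rfl⟩ := IsDiscreteValuationRing.eq_unit_mul_pow_irreducible hne hπ
    have hτπ : τ π = PowerSeries.X := by
      have h1 : r π = 1 := (hr_unique π 0 1 (by simp)).2.symm
      change t π = _
      rw [ht_expand, h1, haπ, map_zero, zero_add, ← map_one (algebraMap K O), htC, map_one, mul_one]
    rw [map_mul, map_pow, hτπ] at hf
    rcases mul_eq_zero.1 hf with h | h
    · exact (u.isUnit.map τ).ne_zero h
    · exact pow_ne_zero n PowerSeries.X_ne_zero h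
  · exact ht0 f

/-- A point of an affine curve over an algebraically closed field of characteristic zero is the
origin of a nonconstant formal branch. -/
theorem exists_branch [CharZero K] [IsAlgClosed K] {C : Type*} [CommRing C] [IsDomain C]
    [Algebra K C] [Algebra (Polynomial K) C] [IsScalarTower K (Polynomial K) C]
    [FaithfulSMul (Polynomial K) C] [Module.Finite (Polynomial K) C] (η : C →ₐ[K] K) :
    ∃ τ : C →ₐ[K] K⟦X⟧, Function.Injective τ ∧ ∀ f, PowerSeries.constantCoeff (τ f) = η f := by
  let P := Polynomial K
  let F := FractionRing P
  let L := FractionRing C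
  let : Algebra F L := FractionRing.liftAlgebra P L
  have : IsScalarTower P F L := FractionRing.isScalarTower_liftAlgebra P L
  have : FiniteDimensional F L := .of_isLocalization P C (nonZeroDivisors P)
  have : CharZero F := charZero_of_injective_algebraMap (algebraMap K F).injective
  -- The normalization of the curve. A maximal ideal M of D above the given point has residue field
  -- K and a discrete valuation ring as localization, so functions can be expanded there.
  let D := integralClosure P L
  have : IsDedekindDomain D := integralClosure.isDedekindDomain P F L
  let : Algebra C D := ((algebraMap C L).codRestrict D.toSubring fun f =>
    (Algebra.IsIntegral.isIntegral (R := P) f).algebraMap).toAlgebra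
  have : IsScalarTower C D L := IsScalarTower.of_algebraMap_eq fun f => rfl
  have : IsScalarTower P C D := IsScalarTower.of_algebraMap_eq fun f => Subtype.ext
    (IsScalarTower.algebraMap_apply P C L f)
  have : IsScalarTower K C D := IsScalarTower.of_algebraMap_eq fun f => Subtype.ext
    (IsScalarTower.algebraMap_apply K C L f)
  have : IsScalarTower K P D := IsScalarTower.of_algebraMap_eq fun f => by
    rw [IsScalarTower.algebraMap_apply K C D, IsScalarTower.algebraMap_apply P C D,
      ← IsScalarTower.algebraMap_apply K P C]
  have : FaithfulSMul C D := (faithfulSMul_iff_algebraMap_injective C D).2 fun f g h =>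
    FaithfulSMul.algebraMap_injective C L (congrArg Subtype.val h)
  have : Algebra.IsIntegral C D := Algebra.IsIntegral.tower_top P
  have : (RingHom.ker η).IsPrime := RingHom.ker_isPrime _
  obtain ⟨M, hM, hMη⟩ := Ideal.exists_ideal_over_prime_of_isIntegral_of_isDomain (S := D)
    (RingHom.ker η) (by
      rw [(RingHom.injective_iff_ker_eq_bot _).1 (FaithfulSMul.algebraMap_injective C D)]
      exact bot_le)
  have hX : algebraMap P D (.X - .C (η (algebraMap P C .X))) ∈ M := by
    rw [IsScalarTower.algebraMap_apply P C D, ← Ideal.mem_comap, hMη, RingHom.mem_ker, map_sub,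
      map_sub, sub_eq_zero]
    change _ = η (algebraMap P C (algebraMap K P _))
    rw [← IsScalarTower.algebraMap_apply, η.commutes]; rfl
  -- M contains X - c, where c is the X-coordinate of the point.
  have hM0 : M ≠ ⊥ := fun h => by
    rw [h, Ideal.mem_bot, IsScalarTower.algebraMap_apply P C D] at hX
    exact Polynomial.X_sub_C_ne_zero _ (FaithfulSMul.algebraMap_injective P C
      (FaithfulSMul.algebraMap_injective C D (by rw [hX, map_zero, map_zero])))
  -- D is integral over K[X], and K[X] acts on D/M through evaluation at c.
  have hint : Algebra.IsIntegral K (D ⧸ M) := ⟨fun x => by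
    obtain ⟨x, rfl⟩ := Ideal.Quotient.mk_surjective x
    obtain ⟨p, hp, hpx⟩ := Algebra.IsIntegral.isIntegral (R := P) x
    let e : P →+* K := Polynomial.evalRingHom (η (algebraMap P C .X))
    refine ⟨p.map e, hp.map e, ?_⟩
    rw [Polynomial.eval₂_map]
    have he : (algebraMap K (D ⧸ M)).comp e = (Ideal.Quotient.mk M).comp (algebraMap P D) := by
      refine Polynomial.ringHom_ext (fun c => ?_) ?_
      · change algebraMap K (D ⧸ M) ((Polynomial.C c).eval _) = Ideal.Quotient.mk M
          (algebraMap P D (algebraMap K P c))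
        rw [Polynomial.eval_C, ← IsScalarTower.algebraMap_apply]
        rfl
      · rw [map_sub, ← Ideal.Quotient.mk_eq_mk_iff_sub_mem] at hX
        refine Eq.trans ?_ hX.symm
        change algebraMap K (D ⧸ M) (Polynomial.X.eval _) = Ideal.Quotient.mk M
          (algebraMap P D (algebraMap K P _))
        rw [Polynomial.eval_X, ← IsScalarTower.algebraMap_apply]
        rfl
    rw [he, ← Polynomial.hom_eval₂, hpx, map_zero]⟩
  have hbij := IsAlgClosed.algebraMap_bijective_of_isIntegral (k := K) (K := D ⧸ M)
  let ρ : D →ₐ[K] K := (AlgEquiv.ofBijective (Algebra.ofId K (D ⧸ M)) hbij).symm.toAlgHom.comp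
    (Ideal.Quotient.mkₐ K M)
  have hρ : ∀ x, ρ x = 0 ↔ x ∈ M := fun x => by
    rw [← Ideal.Quotient.eq_zero_iff_mem]
    exact (AlgEquiv.ofBijective (Algebra.ofId K (D ⧸ M)) hbij).symm.map_eq_zero_iff
  have hρη : ∀ f, ρ (algebraMap C D f) = η f := fun f => by
    have : f - algebraMap K C (η f) ∈ M.comap (algebraMap C D) := by
      rw [hMη, RingHom.mem_ker, map_sub, η.commutes]; exact sub_self _
    rw [Ideal.mem_comap, ← hρ, map_sub, map_sub, ← IsScalarTower.algebraMap_apply, ρ.commutes,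
      sub_eq_zero] at this
    exact this
  let O := Localization.AtPrime M
  have : IsDiscreteValuationRing O :=
    IsLocalization.AtPrime.isDiscreteValuationRing_of_dedekind_domain D hM0 O
  let a : O →ₐ[K] K :=
    { IsLocalization.lift (M := M.primeCompl) (S := O) (g := ρ.toRingHom) fun y =>
        isUnit_iff_ne_zero.2 fun h => y.2 ((hρ _).1 h) with
      commutes' := fun c => by
        change IsLocalization.lift _ (algebraMap K O c) = _
        rw [IsScalarTower.algebraMap_apply K D O, IsLocalization.lift_eq]
        exact ρ.commutes c }
  obtain ⟨τ, hτ, hτa⟩ := exists_taylorHom (O := O) a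
  refine ⟨(τ.comp (IsScalarTower.toAlgHom K D O)).comp (IsScalarTower.toAlgHom K C D),
    hτ.comp ((IsLocalization.injective O M.primeCompl_le_nonZeroDivisors).comp
      (FaithfulSMul.algebraMap_injective C D)), fun f => ?_⟩
  refine (hτa _).trans ((IsLocalization.lift_eq _ _).trans (hρη f))

end Curves
end ArcPoisson

namespace ArcPoisson
open ArcPoisson.Arc (ι T)
open scoped TensorProduct PowerSeries

/-! ### Moving a point off a hypersurface along a formal curve -/

section Generization

variable {K : Type*} [Field K] [Algebra ℂ K] [IsAlgClosed K]

/-- A `K`-point of an affine variety is the origin of a formal curve that is not contained in a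
given hypersurface. -/
theorem exists_generization {A : Type*} [CommRing A] [IsDomain A] [Algebra ℂ A]
    [Algebra.FiniteType ℂ A] (γ : A →ₐ[ℂ] K) {g : A} (hg : g ≠ 0) :
    ∃ ξ : A →ₐ[ℂ] K⟦X⟧, ξ g ≠ 0 ∧ ∀ f, PowerSeries.constantCoeff (ξ f) = γ f := by
  -- If g is nonzero at γ, the constant curve works.
  by_cases hγ : γ g ≠ 0
  · refine ⟨(IsScalarTower.toAlgHom ℂ K K⟦X⟧).comp γ, fun h => hγ ?_, fun f => ?_⟩
    · exact (map_eq_zero_iff _ PowerSeries.C_injective).1 h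
    · exact PowerSeries.constantCoeff_C _
  rw [not_not] at hγ
  have : CharZero K := charZero_of_injective_algebraMap (algebraMap ℂ K).injective
  obtain ⟨d, ν, hν, hint⟩ := exists_integral_inj_algHom_of_fg ℂ A
  let P := MvPolynomial (Fin d) ℂ
  let : Algebra P A := ν.toAlgebra
  have : Algebra.IsIntegral P A := ⟨hint⟩
  -- A nonzero multiple f of g inside the polynomial ring. Avoiding f = 0 in affine space is enough
  -- to avoid g = 0.
  obtain ⟨f, hfg, hf0⟩ : ∃ f : P, ν f ∈ Ideal.span {g} ∧ f ≠ 0 := by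
    obtain ⟨f, hf, hf0⟩ := Submodule.exists_mem_ne_zero_of_ne_bot
      (Ideal.comap_ne_bot_of_integral_mem (R := P) (I := Ideal.span {g}) hg
        (Ideal.mem_span_singleton_self g) (hint g))
    exact ⟨f, hf, hf0⟩
  let PK := MvPolynomial (Fin d) K
  let B := K ⊗[ℂ] A
  have : IsDomain (A ⊗[ℂ] K) := isDomain_tensorProduct
  have : IsDomain B := (Algebra.TensorProduct.comm ℂ K A).toMulEquiv.isDomain (A ⊗[ℂ] K)
  let j : A →ₐ[ℂ] B := Algebra.TensorProduct.includeRight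
  let ν' : PK →ₐ[K] B := MvPolynomial.aeval fun i => j (ν (.X i))
  have hν'C : ∀ p : P, ν' (MvPolynomial.map (algebraMap ℂ K) p) = j (ν p) := fun p => by
    rw [MvPolynomial.aeval_map_algebraMap]
    exact DFunLike.congr_fun (MvPolynomial.algHom_ext (f := MvPolynomial.aeval fun i => j (ν (.X i)))
      (g := j.comp ν) fun i => by simp) p
  have hν' : Function.Injective ν' := by
    have h1 : Function.Injective (Algebra.TensorProduct.map (AlgHom.id K K) ν) :=
      Module.Flat.lTensor_preserves_injective_linearMap (M := K) ν.toLinearMap hν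
    have h2 : ν' = (Algebra.TensorProduct.map (AlgHom.id K K) ν).comp
        (MvPolynomial.algebraTensorAlgEquiv ℂ K).symm.toAlgHom :=
      MvPolynomial.algHom_ext fun i => by
        simp [ν', j]
        rfl
    rw [h2]
    exact h1.comp (MvPolynomial.algebraTensorAlgEquiv ℂ K).symm.injective
  let : Algebra PK B := ν'.toAlgebra
  have : IsScalarTower K PK B := IsScalarTower.of_algebraMap_eq fun c => (ν'.commutes c).symm
  have : FaithfulSMul PK B := (faithfulSMul_iff_algebraMap_injective _ _).2 hν'
  have : Algebra.FiniteType K B := inferInstance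
  have : Algebra.FiniteType PK B := Algebra.FiniteType.of_restrictScalars_finiteType K PK B
  have hBint : Algebra.IsIntegral PK B := ⟨fun z => by
    induction z using TensorProduct.induction_on with
    | zero => exact isIntegral_zero
    | add x y hx hy => exact hx.add hy
    | tmul k a =>
      have h1 : IsIntegral PK (j a) := by
        obtain ⟨p, hp, hpa⟩ := hint a
        refine ⟨p.map (MvPolynomial.map (algebraMap ℂ K)), hp.map _, ?_⟩
        rw [Polynomial.eval₂_map]
        have : (algebraMap PK B).comp (MvPolynomial.map (algebraMap ℂ K)) =
            j.toRingHom.comp ν.toRingHom := RingHom.ext hν'C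
        rw [this]
        have h0 := congrArg j.toRingHom hpa
        rw [Polynomial.hom_eval₂, map_zero] at h0
        exact h0
      have h2 : k ⊗ₜ[ℂ] a = algebraMap PK B (.C k) * j a := by
        change _ = ν' (.C k) * (1 ⊗ₜ a)
        rw [MvPolynomial.algHom_C, Algebra.TensorProduct.algebraMap_apply,
          Algebra.TensorProduct.tmul_mul_tmul]
        simp
      rw [h2]
      exact isIntegral_algebraMap.mul h1⟩
  have : Module.Finite PK B := Algebra.IsIntegral.finite
  let η : B →ₐ[K] K := Algebra.TensorProduct.lift (AlgHom.id K K) γ fun _ _ => Commute.all _ _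
  have hηj : ∀ a, η (j a) = γ a := fun a => by
    change η (1 ⊗ₜ a) = _
    rw [Algebra.TensorProduct.lift_tmul, map_one, one_mul]
  have hfK : MvPolynomial.map (algebraMap ℂ K) f ≠ 0 := fun h =>
    hf0 (MvPolynomial.map_injective _ (algebraMap ℂ K).injective (by rw [h, map_zero]))
  obtain ⟨w, hw⟩ : ∃ w : Fin d → K, MvPolynomial.eval w (MvPolynomial.map (algebraMap ℂ K) f) ≠ 0 := by
    by_contra! H
    exact hfK (MvPolynomial.funext fun w => by rw [H, map_zero])
  let c : Fin d → K := fun i => γ (ν (.X i))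
  have hc : ∀ p : PK, MvPolynomial.eval c p = η (ν' p) := fun p => by
    rw [← MvPolynomial.coe_aeval_eq_eval]
    exact DFunLike.congr_fun (MvPolynomial.algHom_ext (f := MvPolynomial.aeval c)
      (g := η.comp ν') fun i => by simp [ν', hηj, c]) p
  have hcf : MvPolynomial.eval c (MvPolynomial.map (algebraMap ℂ K) f) = 0 := by
    rw [hc, hν'C, hηj]
    obtain ⟨a, ha⟩ := Ideal.mem_span_singleton.1 hfg
    rw [ha, map_mul, hγ, zero_mul]
  have hwc : w ≠ c := fun h => hw (h ▸ hcf)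
  obtain ⟨i₀, hi₀⟩ := Function.ne_iff.1 hwc
  -- The line through the image c of γ (parameter 0) and a point w with f(w) ≠ 0 (parameter 1).
  let l : PK →ₐ[K] Polynomial K :=
    MvPolynomial.aeval fun i => Polynomial.C (c i) + Polynomial.X * Polynomial.C (w i - c i)
  have hl0 : ∀ p, (l p).eval 0 = MvPolynomial.eval c p := fun p => by
    rw [← MvPolynomial.coe_aeval_eq_eval]
    exact DFunLike.congr_fun (MvPolynomial.algHom_ext
      (f := (Polynomial.aeval (0 : K)).comp l) (g := MvPolynomial.aeval c) fun i => by simp [l]) p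
  have hl1 : ∀ p, (l p).eval 1 = MvPolynomial.eval w p := fun p => by
    rw [← MvPolynomial.coe_aeval_eq_eval]
    exact DFunLike.congr_fun (MvPolynomial.algHom_ext
      (f := (Polynomial.aeval (1 : K)).comp l) (g := MvPolynomial.aeval w) fun i => by simp [l]) p
  have hls : Function.Surjective l := by
    rw [← AlgHom.range_eq_top, ← top_le_iff, ← Polynomial.adjoin_X, Algebra.adjoin_le_iff,
      Set.singleton_subset_iff]
    refine ⟨.C (w i₀ - c i₀)⁻¹ * (.X i₀ - .C (c i₀)), ?_⟩
    have hlC : ∀ k, l (.C k) = .C k := fun k => MvPolynomial.algHom_C l k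
    have hlX : l (.X i₀) = Polynomial.C (c i₀) + Polynomial.X * Polynomial.C (w i₀ - c i₀) :=
      MvPolynomial.aeval_X _ _
    change l _ = _
    rw [map_mul, map_sub, hlC, hlC, hlX, add_sub_cancel_left, mul_comm, mul_assoc, ← map_mul,
      mul_inv_cancel₀ (sub_ne_zero.2 hi₀), map_one, mul_one]
  have : (RingHom.ker l).IsPrime := RingHom.ker_isPrime _
  have : (RingHom.ker η).IsPrime := RingHom.ker_isPrime _
  -- Going down lifts the line to an irreducible curve B/p through the point η. The curve is finite
  -- over the line, so it has a formal branch at η.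
  obtain ⟨p, hpη, hp, hpl⟩ := Ideal.exists_ideal_le_liesOver_of_le (p := RingHom.ker l)
    (q := (RingHom.ker η).under PK) (RingHom.ker η) (fun x hx => by
      change η (ν' x) = 0
      rw [← hc, ← hl0, RingHom.mem_ker.1 hx, Polynomial.eval_zero])
  have hpl : ∀ x : PK, l x = 0 ↔ ν' x ∈ p := fun x => by
    rw [← RingHom.mem_ker, hpl.over]; rfl
  let C := B ⧸ p
  let e := Ideal.quotientKerAlgEquivOfSurjective hls
  let Φ : (PK ⧸ RingHom.ker l) →ₐ[K] C := Ideal.Quotient.liftₐ (RingHom.ker l)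
    ((Ideal.Quotient.mkₐ K p).comp ν') fun x hx =>
      Ideal.Quotient.eq_zero_iff_mem.2 ((hpl x).1 hx)
  let θ : Polynomial K →ₐ[K] C := Φ.comp e.symm.toAlgHom
  have hθ : ∀ x : PK, θ (l x) = Ideal.Quotient.mk p (ν' x) := fun x => by
    have : e.symm (l x) = Ideal.Quotient.mk _ x := by
      rw [AlgEquiv.symm_apply_eq]; rfl
    change Φ (e.symm (l x)) = _
    rw [this]
    rfl
  have hθinj : Function.Injective θ := (injective_iff_map_eq_zero θ).2 fun q hq => by
    obtain ⟨x, rfl⟩ := hls q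
    rw [hθ, Ideal.Quotient.eq_zero_iff_mem] at hq
    exact (hpl x).2 hq
  let : Algebra (Polynomial K) C := θ.toAlgebra
  have : IsScalarTower K (Polynomial K) C :=
    IsScalarTower.of_algebraMap_eq fun c => (θ.commutes c).symm
  have : FaithfulSMul (Polynomial K) C := (faithfulSMul_iff_algebraMap_injective _ _).2 hθinj
  have : Module.Finite (Polynomial K) C := by
    obtain ⟨S, hS⟩ := Module.Finite.fg_top (R := PK) (M := C)
    refine ⟨⟨S, top_le_iff.1 fun x _ => ?_⟩⟩
    have hx : x ∈ Submodule.span PK (S : Set C) := hS ▸ Submodule.mem_top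
    induction hx using Submodule.span_induction with
    | mem x hx => exact Submodule.subset_span hx
    | zero => exact zero_mem _
    | add x y _ _ hx hy => exact add_mem (hx trivial) (hy trivial)
    | smul a x _ hx =>
      have : a • x = l a • x := by
        rw [Algebra.smul_def (l a)]
        change _ = θ (l a) * x
        rw [hθ, Algebra.smul_def]
        rfl
      rw [this]
      exact Submodule.smul_mem _ _ (hx trivial)
  obtain ⟨τ, hτ, hτη⟩ := exists_branch
    (Ideal.Quotient.liftₐ p η fun x hx => RingHom.mem_ker.1 (hpη hx))
  refine ⟨((τ.restrictScalars ℂ).comp (Ideal.Quotient.mkₐ ℂ p)).comp j, fun h => ?_, fun a => ?_⟩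
  · have h0 : Ideal.Quotient.mk p (j g) = 0 := hτ (h.trans (map_zero τ).symm)
    -- If g vanished on the branch, hence on the curve, then f would vanish on the line, contrary to
    -- its value at parameter 1.
    obtain ⟨a, ha⟩ := Ideal.mem_span_singleton.1 hfg
    have h1 := (hpl (MvPolynomial.map (algebraMap ℂ K) f)).2 (by
      rw [← Ideal.Quotient.eq_zero_iff_mem, hν'C, ha, map_mul, map_mul, h0, zero_mul])
    exact hw (by rw [← hl1, h1, Polynomial.eval_zero])
  · exact (hτη _).trans (hηj a)

end Generization

/-! ### Kolchin's irreducibility theorem -/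

section Kolchin

/-- The derivation of `K⟦X⟧` that acts on the coefficients. -/
noncomputable def coeffDerivation {K : Type*} [Field K] [Algebra ℂ K] (D : Derivation ℂ K K) :
    Derivation ℂ K⟦X⟧ K⟦X⟧ :=
  Derivation.mk'
    { toFun f := PowerSeries.mk fun n => D (PowerSeries.coeff n f)
      map_add' f g := by ext; simp
      map_smul' c f := by
        ext n
        rw [PowerSeries.coeff_mk, RingHom.id_apply]
        have h : ∀ g : K⟦X⟧, PowerSeries.coeff n (c • g) = c • PowerSeries.coeff n g := fun g => by
          rw [← algebraMap_smul K c g, PowerSeries.coeff_smul, algebraMap_smul]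
        rw [h, h, PowerSeries.coeff_mk, D.map_smul] }
    fun f g => by
      ext n
      change PowerSeries.coeff n (PowerSeries.mk fun n => D (PowerSeries.coeff n (f * g))) =
        PowerSeries.coeff n (f * (PowerSeries.mk fun n => D (PowerSeries.coeff n g)) +
          g * (PowerSeries.mk fun n => D (PowerSeries.coeff n f)))
      rw [PowerSeries.coeff_mk, map_add, mul_comm g, PowerSeries.coeff_mul, PowerSeries.coeff_mul,
        PowerSeries.coeff_mul, map_sum, ← Finset.sum_add_distrib]
      refine Finset.sum_congr rfl fun i _ => ?_
      rw [PowerSeries.coeff_mk, PowerSeries.coeff_mk, Derivation.leibniz, smul_eq_mul, smul_eq_mul,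
        mul_comm (PowerSeries.coeff i.2 g)]

theorem constantCoeff_coeffDerivation {K : Type*} [Field K] [Algebra ℂ K] (D : Derivation ℂ K K)
    (f : K⟦X⟧) : PowerSeries.constantCoeff (coeffDerivation D f) =
      D (PowerSeries.constantCoeff f) := by
  rw [← PowerSeries.coeff_zero_eq_constantCoeff_apply, ← PowerSeries.coeff_zero_eq_constantCoeff_apply]
  exact PowerSeries.coeff_mk 0 fun n => D (PowerSeries.coeff n f)

variable {R : Type*} [CommRing R] [Algebra ℂ R]

/-- The arc of a point of the arc space, on all of `J_∞ R`. -/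
theorem exists_arcHom (y : Pt (Arc R)) : ∃ Γ : Arc R →ₐ[ℂ] ℂ⟦X⟧,
    (∀ u, Γ (T u) = PowerSeries.derivative ℂ (Γ u)) ∧
    (∀ u, PowerSeries.constantCoeff (Γ u) = y u) ∧
    ∀ u, (∀ j, y (T^[j] u) = 0) → Γ u = 0 := by
  let t : Arc R → ℂ⟦X⟧ := fun u => PowerSeries.mk fun n => (n.factorial : ℂ)⁻¹ * y (T^[n] u)
  have ht : ∀ u n, PowerSeries.coeff n (t u) = (n.factorial : ℂ)⁻¹ * y (T^[n] u) :=
    fun u n => PowerSeries.coeff_mk _ _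
  have htC : ∀ c : ℂ, t (algebraMap ℂ (Arc R) c) = algebraMap ℂ ℂ⟦X⟧ c := fun c => by
    ext n
    rw [ht, PowerSeries.algebraMap_apply, Algebra.algebraMap_self_apply, PowerSeries.coeff_C]
    cases n with
    | zero => simpa using AlgHomClass.commutes y c
    | succ n =>
      rw [Function.iterate_succ_apply, Derivation.map_algebraMap, iterate_map_zero, map_zero,
        mul_zero, if_neg n.succ_ne_zero]
  let Γ : Arc R →ₐ[ℂ] ℂ⟦X⟧ :=
    { toFun := t
      map_one' := by simpa using htC 1
      map_zero' := by simpa using htC 0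
      map_add' u v := by
        ext n
        rw [map_add, ht, ht, ht, iterate_map_add, map_add, mul_add]
      map_mul' u v := by
        ext n
        rw [PowerSeries.coeff_mul, ht, derivation_iterate_mul, map_sum, Finset.mul_sum]
        refine Finset.sum_congr rfl fun p hp => ?_
        rw [ht, ht, ← Finset.HasAntidiagonal.mem_antidiagonal.1 hp, map_nsmul, map_mul, nsmul_eq_mul,
          Nat.cast_add_choose]
        have h1 : (p.1.factorial : ℂ) ≠ 0 := by exact_mod_cast p.1.factorial_ne_zero
        have h2 : (p.2.factorial : ℂ) ≠ 0 := by exact_mod_cast p.2.factorial_ne_zero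
        have h3 : ((p.1 + p.2).factorial : ℂ) ≠ 0 := by exact_mod_cast (p.1 + p.2).factorial_ne_zero
        field_simp
      commutes' := htC }
  refine ⟨Γ, fun u => ?_, fun u => ?_, fun u hu => ?_⟩
  · ext n
    change PowerSeries.coeff n (t (T u)) = PowerSeries.coeff n (PowerSeries.derivative ℂ (t u))
    rw [PowerSeries.coeff_derivative, ht, ht, Function.iterate_succ_apply, Nat.factorial_succ]
    have h1 : (n.factorial : ℂ) ≠ 0 := by exact_mod_cast n.factorial_ne_zero
    have h2 : (n + 1 : ℂ) ≠ 0 := by exact_mod_cast n.succ_ne_zero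
    push_cast
    field_simp
  · have h0 : PowerSeries.constantCoeff (t u) = y u := by simpa using ht u 0
    exact h0
  · ext n
    change PowerSeries.coeff n (t u) = 0
    rw [ht, hu, mul_zero]

/-- Kolchin's irreducibility theorem: what vanishes generically on the arc space of an irreducible
variety vanishes on it. -/
theorem eq_zero_of_mul_mem_diffIdeal [Algebra.FiniteType ℂ R] {Q : Ideal R} [Q.IsPrime]
    {y : Pt (Arc R)} (hy : diffIdeal Q ≤ y.maxIdeal) {g : R} (hg : g ∉ Q) {F : Arc R}
    (h : ι g * F ∈ diffIdeal Q) : y F = 0 := by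
  obtain ⟨Γ, hΓT, hΓy, hΓ0⟩ := exists_arcHom y
  -- Algebraically closed, so that formal curves through the K-point exist. It is algebraic over
  -- ℂ⟦t⟧, so that d/dt extends to K.
  let K := AlgebraicClosure (FractionRing ℂ⟦X⟧)
  have : FaithfulSMul ℂ⟦X⟧ K := (faithfulSMul_iff_algebraMap_injective _ _).2 (by
    rw [IsScalarTower.algebraMap_eq ℂ⟦X⟧ (FractionRing ℂ⟦X⟧) K]
    exact (algebraMap (FractionRing ℂ⟦X⟧) K).injective.comp (IsFractionRing.injective _ _))
  have : CharZero K := charZero_of_injective_algebraMap (algebraMap ℂ K).injective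
  have : Algebra.IsAlgebraic ℂ⟦X⟧ K :=
    (IsFractionRing.comap_isAlgebraic_iff (A := ℂ⟦X⟧) (K := FractionRing ℂ⟦X⟧) (C := K)).2
      inferInstance
  have := formallyEtale_of_isAlgebraic ℂ⟦X⟧ K
  obtain ⟨D, hD⟩ := exists_derivation_extension (A := ℂ⟦X⟧) (B := K)
    ((Algebra.linearMap ℂ⟦X⟧ K).compDer (PowerSeries.derivative ℂ))
  replace hD : ∀ f : ℂ⟦X⟧, D (algebraMap _ K f) = algebraMap _ K (PowerSeries.derivative ℂ f) := hD
  let κ : ℂ⟦X⟧ →ₐ[ℂ] K := IsScalarTower.toAlgHom ℂ ℂ⟦X⟧ K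
  let γ : R ⧸ Q →ₐ[ℂ] K := Ideal.Quotient.liftₐ Q (κ.comp (Γ.comp ι)) fun f hf => by
    change κ (Γ (ι f)) = 0
    rw [hΓ0 _ fun j => hy (iterate_T_mem_diffIdeal hf j), map_zero]
  obtain ⟨ξ, hξg, hξ⟩ := exists_generization γ
    (g := Ideal.Quotient.mk Q g) (mt Ideal.Quotient.eq_zero_iff_mem.1 hg)
  -- The K⟦s⟧-point ξ prolongs to J_∞R. Because the derivation acts on coefficients only, setting s
  -- = 0 is a differential map and returns the original arc.
  let Ξ : Arc R →ₐ[ℂ] K⟦X⟧ := Arc.lift (coeffDerivation D) (ξ.comp (Ideal.Quotient.mkₐ ℂ Q))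
  have hΞι : ∀ f, Ξ (ι f) = ξ (Ideal.Quotient.mk Q f) := fun f => Arc.lift_ι _ _ _
  have hΞT : ∀ u, Ξ (T u) = coeffDerivation D (Ξ u) := fun u => Arc.lift_T _ _ _
  have hΞΓ : ∀ u, PowerSeries.constantCoeff (Ξ u) = κ (Γ u) := fun u => by
    induction u using Arc.induction with
    | hι f => rw [hΞι, hξ]; rfl
    | hT u hu =>
      rw [hΞT, constantCoeff_coeffDerivation, hu, hΓT]
      exact hD _
    | hadd u v hu hv => rw [map_add, map_add, map_add, map_add, hu, hv]
    | hmul u v hu hv => rw [map_mul, map_mul, map_mul, map_mul, hu, hv]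
  have hΞQ : diffIdeal Q ≤ RingHom.ker Ξ := Ideal.span_le.2 (by
    rintro _ ⟨f, hf, j, rfl⟩
    change Ξ _ = 0
    induction j with
    | zero =>
      rw [Function.iterate_zero_apply, hΞι, Ideal.Quotient.eq_zero_iff_mem.2 hf, map_zero]
    | succ j ih => rw [Function.iterate_succ_apply', hΞT, ih, map_zero])
  -- K⟦s⟧ is a domain, and the image of g in it is nonzero.
  have hF : Ξ F = 0 := by
    have := RingHom.mem_ker.1 (hΞQ h)
    rw [map_mul, hΞι] at this
    exact (mul_eq_zero.1 this).resolve_left hξg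
  have hΓF : Γ F = 0 := FaithfulSMul.algebraMap_injective ℂ⟦X⟧ K (by
    rw [map_zero]
    exact (hΞΓ F).symm.trans (by rw [hF, map_zero]))
  rw [← hΓy, hΓF, map_zero]

end Kolchin
end ArcPoisson

namespace ArcPoisson

/-! ### Majorants for iterated derivations -/

section Majorants

variable {B : Type*} [CommRing B] [Algebra ℂ B]

/-- `f` is a polynomial of degree at most `k` in the elements of `s`, and the absolute values of its
coefficients add up to at most `c`. -/
inductive Sized (s : Set B) : ℕ → ℝ → B → Prop
  | const (z : ℂ) : Sized s 0 ‖z‖ (algebraMap ℂ B z)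
  | gen (u : B) (hu : u ∈ s) : Sized s 1 1 u
  | add {k : ℕ} {c c' : ℝ} {f g : B} : Sized s k c f → Sized s k c' g → Sized s k (c + c') (f + g)
  | mul {k k' : ℕ} {c c' : ℝ} {f g : B} :
      Sized s k c f → Sized s k' c' g → Sized s (k + k') (c * c') (f * g)
  | mono {k k' : ℕ} {c c' : ℝ} {f : B} : Sized s k c f → k ≤ k' → c ≤ c' → Sized s k' c' f

namespace Sized

variable {s : Set B} {k e : ℕ} {c T : ℝ} {f : B}

theorem nonneg (h : Sized s k c f) : 0 ≤ c := by
  induction h with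
  | const z => exact norm_nonneg z
  | gen => exact zero_le_one
  | add _ _ h₁ h₂ => exact add_nonneg h₁ h₂
  | mul _ _ h₁ h₂ => exact mul_nonneg h₁ h₂
  | mono _ _ hc h => exact h.trans hc

theorem smul (z : ℂ) (h : Sized s k c f) : Sized s k (‖z‖ * c) (z • f) := by
  rw [Algebra.smul_def]
  exact (Sized.mul (.const z) h).mono (zero_add k).le le_rfl

theorem zero (k : ℕ) (hc : 0 ≤ c) : Sized s k c (0 : B) := by
  rw [← map_zero (algebraMap ℂ B)]
  exact (Sized.const 0).mono (Nat.zero_le _) (by rwa [norm_zero])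

theorem sum {ι : Type*} {t : Finset ι} {c : ι → ℝ} {f : ι → B} (h : ∀ i ∈ t, Sized s k (c i) (f i)) :
    Sized s k (∑ i ∈ t, c i) (∑ i ∈ t, f i) := by
  classical
  induction t using Finset.induction_on with
  | empty => exact zero k le_rfl
  | insert i t hi ih =>
    rw [Finset.sum_insert hi, Finset.sum_insert hi]
    exact (h i (Finset.mem_insert_self _ _)).add (ih fun j hj => h j (Finset.mem_insert_of_mem hj))

theorem exists_of_adjoin (hs : Algebra.adjoin ℂ s = ⊤) (f : B) : ∃ k c, Sized s k c f := by
  have hf : f ∈ Algebra.adjoin ℂ s := hs ▸ Algebra.mem_top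
  induction hf using Algebra.adjoin_induction with
  | mem u hu => exact ⟨1, 1, .gen u hu⟩
  | algebraMap z => exact ⟨0, _, .const z⟩
  | add f g _ _ hf hg =>
    obtain ⟨k, c, hf⟩ := hf
    obtain ⟨l, c', hg⟩ := hg
    exact ⟨_, _, (hf.mono (le_max_left k l) le_rfl).add (hg.mono (le_max_right k l) le_rfl)⟩
  | mul f g _ _ hf hg =>
    obtain ⟨k, c, hf⟩ := hf
    obtain ⟨l, c', hg⟩ := hg
    exact ⟨_, _, hf.mul hg⟩

theorem norm_le {q : Pt B} {ρ : ℝ} (hρ : 1 ≤ ρ) (hq : ∀ u ∈ s, ‖q u‖ ≤ ρ) (h : Sized s k c f) :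
    ‖q f‖ ≤ c * ρ ^ k := by
  have hρ0 : 0 ≤ ρ := zero_le_one.trans hρ
  induction h with
  | const z => rw [AlgHomClass.commutes, pow_zero, mul_one]; rfl
  | gen u hu => simpa using hq u hu
  | add _ _ h₁ h₂ =>
    rw [map_add, add_mul]
    exact (norm_add_le _ _).trans (add_le_add h₁ h₂)
  | mul hf hg h₁ h₂ =>
    rw [map_mul, norm_mul, pow_add, mul_mul_mul_comm]
    exact mul_le_mul h₁ h₂ (norm_nonneg _) (mul_nonneg hf.nonneg (pow_nonneg hρ0 _))
  | mono h hk hc ih =>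
    exact ih.trans (mul_le_mul hc (pow_le_pow_right₀ hρ hk) (pow_nonneg hρ0 _) (h.nonneg.trans hc))

/-- Each monomial of degree at most k gives at most k terms by the Leibniz rule, and in each one a
generator is replaced by an element of degree e + 1 and size T. -/
theorem derivation {D : Derivation ℂ B B} (hT : 0 ≤ T) (hD : ∀ u ∈ s, Sized s (e + 1) T (D u))
    (h : Sized s k c f) : Sized s (k + e) (k * T * c) (D f) := by
  induction h with
  | const z =>
    rw [Derivation.map_algebraMap]
    exact zero _ (by simp)
  | gen u hu => exact (hD u hu).mono (add_comm e 1).le (by simp)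
  | add _ _ h₁ h₂ =>
    rw [map_add, mul_add]
    exact h₁.add h₂
  | @mul k k' c c' f g hf hg h₁ h₂ =>
    rw [Derivation.leibniz, smul_eq_mul, smul_eq_mul]
    refine ((hf.mul h₂).mono (k' := k + k' + e) (by omega) le_rfl).add
      ((hg.mul h₁).mono (by omega) le_rfl) |>.mono le_rfl (le_of_eq ?_)
    push_cast
    ring
  | mono h hk hc ih =>
    refine ih.mono (by omega) (mul_le_mul (mul_le_mul_of_nonneg_right (by exact_mod_cast hk) hT) hc
      h.nonneg (mul_nonneg (Nat.cast_nonneg _) hT))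

theorem iterate_derivation {D : Derivation ℂ B B} (hT : 0 ≤ T)
    (hD : ∀ u ∈ s, Sized s (e + 1) T (D u)) (h : Sized s k c f) (n : ℕ) :
    Sized s (k + n * e) (c * T ^ n * ∏ i ∈ Finset.range n, ((k + i * e : ℕ) : ℝ)) (D^[n] f) := by
  induction n with
  | zero => simpa using h
  | succ n ih =>
    rw [Function.iterate_succ_apply', Finset.prod_range_succ]
    refine (ih.derivation hT hD).mono (le_of_eq (by ring)) (le_of_eq (by ring))

end Sized

/-- Each factor is at most e(k + 1 + i), and a rising factorial is n! times a binomial coefficient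
below 2^(k+n). The n! will cancel the denominator of the exponential series. -/
theorem prod_add_mul_le (k e n : ℕ) (he : 1 ≤ e) :
    ∏ i ∈ Finset.range n, (k + i * e) ≤ n.factorial * (2 ^ k * (2 * e) ^ n) := by
  have h1 : ∏ i ∈ Finset.range n, (k + i * e) ≤ ∏ i ∈ Finset.range n, (e * (k + 1 + i)) :=
    Finset.prod_le_prod' fun i _ => by nlinarith
  have h2 : ∏ i ∈ Finset.range n, (e * (k + 1 + i)) = e ^ n * (k + 1).ascFactorial n := by
    rw [Finset.prod_mul_distrib, Finset.prod_const, Finset.card_range, Nat.ascFactorial_eq_prod_range]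
  rw [h2, Nat.ascFactorial_eq_factorial_mul_choose] at h1
  refine h1.trans ?_
  have h3 : (k + n).choose n ≤ 2 ^ (k + n) := Nat.choose_le_two_pow _ _
  calc e ^ n * (n.factorial * (k + n).choose n) ≤ e ^ n * (n.factorial * 2 ^ (k + n)) := by gcongr
    _ = _ := by rw [pow_add, mul_pow]; ring

end Majorants

/-! ### Flows of commuting vector fields by exponential series -/

section Flows

variable {B : Type*} [CommRing B] [Algebra ℂ B] {r : ℕ} (Z : Fin r → Derivation ℂ B B)

/-- The linear combination `∑ i, v i • Z i` of vector fields. -/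
noncomputable def vectorField (v : Fin r → ℂ) : Derivation ℂ B B := ∑ i, v i • Z i

theorem vectorField_apply (v : Fin r → ℂ) (f : B) : vectorField Z v f = ∑ i, v i • Z i f := by
  rw [vectorField, derivation_sum_apply]
  rfl

/-- The time-one flow of a derivation, as a formal power series evaluated at a point. -/
noncomputable def expSeries (D : Derivation ℂ B B) (q : Pt B) (f : B) (n : ℕ) : ℂ :=
  (n.factorial : ℂ)⁻¹ * q (D^[n] f)

theorem expSeries_mul (D : Derivation ℂ B B) (q : Pt B) (f g : B) (n : ℕ) :
    expSeries D q (f * g) n =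
      ∑ p ∈ Finset.HasAntidiagonal.antidiagonal n, expSeries D q f p.1 * expSeries D q g p.2 := by
  rw [expSeries, derivation_iterate_mul, map_sum, Finset.mul_sum]
  refine Finset.sum_congr rfl fun p hp => ?_
  rw [expSeries, expSeries, ← Finset.HasAntidiagonal.mem_antidiagonal.1 hp, map_nsmul, map_mul,
    nsmul_eq_mul, Nat.cast_add_choose]
  have h1 : (p.1.factorial : ℂ) ≠ 0 := by exact_mod_cast p.1.factorial_ne_zero
  have h2 : (p.2.factorial : ℂ) ≠ 0 := by exact_mod_cast p.2.factorial_ne_zero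
  have h3 : ((p.1 + p.2).factorial : ℂ) ≠ 0 := by exact_mod_cast (p.1 + p.2).factorial_ne_zero
  field_simp

/-- The Leibniz rule makes the terms multiply as in a Cauchy product, so the sum is an algebra
homomorphism. The flow thus stays in Spec B without any embedding. -/
theorem exists_expPt {D : Derivation ℂ B B} {q : Pt B}
    (h : ∀ f, Summable fun n => ‖expSeries D q f n‖) :
    ∃ p : Pt B, ∀ f, p f = ∑' n, expSeries D q f n := by
  have hC : ∀ z : ℂ, ∑' n, expSeries D q (algebraMap ℂ B z) n = z := fun z => by
    rw [tsum_eq_single 0 fun n hn => ?_]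
    · rw [expSeries, Function.iterate_zero_apply, AlgHomClass.commutes]
      simp
    · obtain ⟨n, rfl⟩ := Nat.exists_eq_succ_of_ne_zero hn
      rw [expSeries, Function.iterate_succ_apply, Derivation.map_algebraMap, iterate_map_zero,
        map_zero, mul_zero]
  let p : B →ₐ[ℂ] ℂ :=
    { toFun := fun f => ∑' n, expSeries D q f n
      map_one' := by simpa using hC 1
      map_mul' := fun f g => by
        rw [tsum_mul_tsum_eq_tsum_sum_antidiagonal_of_summable_norm (h f) (h g)]
        exact tsum_congr (expSeries_mul D q f g)
      map_zero' := by simpa using hC 0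
      map_add' := fun f g => by
        rw [← (h f).of_norm.tsum_add (h g).of_norm]
        refine tsum_congr fun n => ?_
        rw [expSeries, iterate_map_add, map_add, mul_add]
        rfl
      commutes' := hC }
  exact ⟨p, fun f => rfl⟩

open Classical in
/-- The point reached from `q` by the time-one flow of `D`, if the series converges. -/
noncomputable def expPt (D : Derivation ℂ B B) (q : Pt B) : Pt B :=
  if h : ∀ f, Summable fun n => ‖expSeries D q f n‖ then (exists_expPt h).choose else q

theorem expPt_apply {D : Derivation ℂ B B} {q : Pt B}
    (h : ∀ f, Summable fun n => ‖expSeries D q f n‖) (f : B) :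
    expPt D q f = ∑' n, expSeries D q f n := by
  rw [expPt, dif_pos h]
  exact (exists_expPt h).choose_spec f

end Flows
end ArcPoisson

namespace ArcPoisson

section Flows

variable {B : Type*} [CommRing B] [Algebra ℂ B] {r : ℕ} {Z : Fin r → Derivation ℂ B B}

theorem apply_iterate_vectorField (D : Derivation ℂ B B) (q : Pt B) (w : Fin r → ℂ) (n : ℕ) (f : B) :
    q (D^[n] (vectorField Z w f)) = ∑ i, w i * q (D^[n] (Z i f)) := by
  have := map_sum (D.toLinearMap ^ n) (fun i => w i • Z i f) Finset.univ
  simp only [Module.End.pow_apply, map_smul] at this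
  rw [vectorField_apply]
  refine (congrArg q this).trans ?_
  rw [map_sum]
  exact Finset.sum_congr rfl fun i _ => map_smul q _ _

variable (Z) in
/-- Cauchy estimates for iterated linear combinations of the vector fields `Z`, on the set where the
functions in `s` are bounded by `ρ`. -/
def HasMajorant (s : Set B) (ρ C : ℝ) : Prop :=
  ∀ f : B, ∃ c : ℝ, 0 ≤ c ∧ ∀ q : Pt B, (∀ u ∈ s, ‖q u‖ ≤ ρ) → ∀ (v : Fin r → ℂ) (n : ℕ),
    ‖q ((vectorField Z v)^[n] f)‖ ≤ c * n.factorial * (C * ‖v‖) ^ n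

theorem exists_hasMajorant {s : Finset B} (hs : Algebra.adjoin ℂ (s : Set B) = ⊤) (ρ : ℝ) :
    ∃ C > 0, HasMajorant Z s ρ C := by
  classical
  choose k c hkc using Sized.exists_of_adjoin hs
  -- The summand 1 ensures e ≥ 1, which the estimate of the product requires.
  let e := (Finset.univ ×ˢ s).sup (fun p => k (Z p.1 p.2)) + 1
  let T := ∑ p ∈ Finset.univ ×ˢ s, c (Z p.1 p.2)
  have hc0 : ∀ f, 0 ≤ c f := fun f => (hkc f).nonneg
  have hT : 0 ≤ T := Finset.sum_nonneg fun p _ => hc0 _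
  have hZ : ∀ i, ∀ u ∈ s, Sized (s : Set B) (e + 1) T (Z i u) := fun i u hu => by
    have hmem : (i, u) ∈ Finset.univ ×ˢ s := by simp [hu]
    refine (hkc (Z i u)).mono ?_ ?_
    · exact (Finset.le_sup (f := fun p => k (Z p.1 p.2)) hmem).trans (Nat.le_add_right _ 2)
    · exact Finset.single_le_sum (f := fun p => c (Z p.1 p.2)) (fun p _ => hc0 _) hmem
  have hV : ∀ v : Fin r → ℂ, ∀ u ∈ (s : Set B),
      Sized (s : Set B) (e + 1) (r * ‖v‖ * T) (vectorField Z v u) := fun v u hu => by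
    rw [vectorField_apply]
    refine (Sized.sum fun i _ => (hZ i u hu).smul (v i)).mono le_rfl ?_
    rw [← Finset.sum_mul]
    refine mul_le_mul_of_nonneg_right ?_ hT
    calc ∑ i, ‖v i‖ ≤ ∑ _i : Fin r, ‖v‖ := Finset.sum_le_sum fun i _ => norm_le_pi_norm v i
      _ = r * ‖v‖ := by simp
  -- Powers of the bound must increase with the degree, hence a bound at least 1.
  let ρ' := max 1 ρ
  have hρ' : 1 ≤ ρ' := le_max_left _ _
  have hρ0 : 0 ≤ ρ' := zero_le_one.trans hρ'
  let C := r * T * (2 * e) * ρ' ^ e + 1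
  have hC' : 0 ≤ r * T * (2 * e) * ρ' ^ e := by positivity
  refine ⟨C, by positivity, fun f => ⟨c f * 2 ^ k f * ρ' ^ k f, by have := hc0 f; positivity,
    fun q hq v n => ?_⟩⟩
  have h1 := ((hkc f).iterate_derivation (by positivity) (hV v) n).norm_le hρ' fun u hu =>
    (hq u hu).trans (le_max_right _ _)
  refine h1.trans ?_
  have h2 : ∏ i ∈ Finset.range n, ((k f + i * e : ℕ) : ℝ) ≤
      n.factorial * (2 ^ k f * (2 * e) ^ n) := by
    have := prod_add_mul_le (k f) e n (by simp [e])
    exact_mod_cast this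
  calc c f * (r * ‖v‖ * T) ^ n * (∏ i ∈ Finset.range n, ((k f + i * e : ℕ) : ℝ)) *
        ρ' ^ (k f + n * e)
      ≤ c f * (r * ‖v‖ * T) ^ n * (n.factorial * (2 ^ k f * (2 * e) ^ n)) *
        ρ' ^ (k f + n * e) := by
        have := hc0 f
        gcongr
    _ = c f * 2 ^ k f * ρ' ^ k f * n.factorial * (r * T * (2 * e) * ρ' ^ e * ‖v‖) ^ n := by
        rw [pow_add, mul_comm n e, pow_mul]
        simp only [mul_pow]
        ring
    _ ≤ c f * 2 ^ k f * ρ' ^ k f * n.factorial * (C * ‖v‖) ^ n := by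
        have := hc0 f
        gcongr
        simp [C]

variable {s : Set B} {ρ C : ℝ}

theorem HasMajorant.vectorField (h : HasMajorant Z s ρ C) (f : B) : ∃ c : ℝ, 0 ≤ c ∧
    ∀ q : Pt B, (∀ u ∈ s, ‖q u‖ ≤ ρ) → ∀ (v w : Fin r → ℂ) (n : ℕ),
      ‖q ((vectorField Z v)^[n] (vectorField Z w f))‖ ≤
        c * ‖w‖ * n.factorial * (C * ‖v‖) ^ n := by
  choose c hc0 hc using fun i => h (Z i f)
  refine ⟨∑ i, c i, Finset.sum_nonneg fun i _ => hc0 i, fun q hq v w n => ?_⟩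
  rw [apply_iterate_vectorField]
  refine (norm_sum_le _ _).trans ?_
  rw [Finset.sum_mul, Finset.sum_mul, Finset.sum_mul]
  refine Finset.sum_le_sum fun i _ => ?_
  rw [norm_mul]
  calc ‖w i‖ * ‖q ((ArcPoisson.vectorField Z v)^[n] (Z i f))‖
      ≤ ‖w‖ * (c i * n.factorial * (C * ‖v‖) ^ n) :=
        mul_le_mul (norm_le_pi_norm w i) (hc i q hq v n) (norm_nonneg _) (norm_nonneg _)
    _ = _ := by ring

/-- The derivative of `q((v·Z)^n f)` when `q` and `v` vary. -/
theorem hasDerivWithinAt_iterate (hZ : ∀ i j f, Z i (Z j f) = Z j (Z i f)) {γ : ℝ → Pt B}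
    {v : ℝ → Fin r → ℂ} {μ ν : Fin r → ℂ} {S : Set ℝ} {t : ℝ}
    (hγ : ∀ f, HasDerivWithinAt (fun t => γ t f) (γ t (vectorField Z μ f)) S t)
    (hv : HasDerivWithinAt v ν S t) (n : ℕ) (f : B) :
    HasDerivWithinAt (fun t => γ t ((vectorField Z (v t))^[n] f))
      (γ t ((vectorField Z (v t))^[n] (vectorField Z μ f)) +
        n * γ t ((vectorField Z (v t))^[n - 1] (vectorField Z ν f))) S t := by
  have hcomm : ∀ (i : Fin r) (w : Fin r → ℂ) (f : B),
      vectorField Z w (Z i f) = Z i (vectorField Z w f) := fun i w f => by simp only [vectorField_apply, map_sum, Derivation.map_smul, hZ]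
  induction n generalizing f with
  | zero => simpa using hγ f
  | succ n ih =>
    -- The innermost factor is peeled off, so that v(t) appears as scalar coefficients and the
    -- induction hypothesis applies to each Z_i f. Commutativity then reassembles the terms.
    have h1 : (fun t => γ t ((vectorField Z (v t))^[n + 1] f)) = fun t =>
        ∑ i, v t i * γ t ((vectorField Z (v t))^[n] (Z i f)) := by
      funext t
      rw [Function.iterate_succ_apply, apply_iterate_vectorField]
    rw [h1]
    refine (HasDerivWithinAt.fun_sum (u := Finset.univ) fun i _ =>
      (hasDerivWithinAt_pi.1 hv i).mul (ih (Z i f))).congr_deriv ?_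
    simp only [hcomm, mul_add, Finset.sum_add_distrib]
    rw [← apply_iterate_vectorField, ← apply_iterate_vectorField, ← Function.iterate_succ_apply]
    have h3 : ∑ i, v t i * (n * γ t ((vectorField Z (v t))^[n - 1] (Z i (vectorField Z ν f)))) =
        n * γ t ((vectorField Z (v t))^[n] (vectorField Z ν f)) := by
      cases n with
      | zero => simp
      | succ n =>
        rw [Function.iterate_succ_apply, apply_iterate_vectorField, Finset.mul_sum]
        exact Finset.sum_congr rfl fun i _ => by rw [Nat.add_sub_cancel]; ring
    rw [h3, Nat.add_sub_cancel]
    push_cast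
    ring

theorem norm_expSeries_le {D : Derivation ℂ B B} {q : Pt B} {f : B} {n : ℕ} {a x : ℝ}
    (h : ‖q (D^[n] f)‖ ≤ a * n.factorial * x ^ n) : ‖expSeries D q f n‖ ≤ a * x ^ n := by
  have h1 : (0 : ℝ) < n.factorial := by exact_mod_cast n.factorial_pos
  rw [expSeries, norm_mul, norm_inv, Complex.norm_natCast, inv_mul_le_iff₀ h1]
  linarith

theorem HasMajorant.norm_expSeries_le (h : HasMajorant Z s ρ C) (hC : 0 ≤ C) (f : B) :
    ∃ c : ℝ, 0 ≤ c ∧ ∀ q : Pt B, (∀ u ∈ s, ‖q u‖ ≤ ρ) → ∀ v : Fin r → ℂ, C * ‖v‖ < 1 / 2 →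
      ∀ n, ‖expSeries (ArcPoisson.vectorField Z v) q f n‖ ≤ c * (1 / 2) ^ n := by
  obtain ⟨c, hc, hb⟩ := h f
  refine ⟨c, hc, fun q hq v hv n => (ArcPoisson.norm_expSeries_le (hb q hq v n)).trans ?_⟩
  have := mul_nonneg hC (norm_nonneg v)
  gcongr

theorem HasMajorant.norm_expSeries_vectorField_le (h : HasMajorant Z s ρ C) (hC : 0 ≤ C) (f : B) :
    ∃ c : ℝ, 0 ≤ c ∧ ∀ q : Pt B, (∀ u ∈ s, ‖q u‖ ≤ ρ) → ∀ v w : Fin r → ℂ, C * ‖v‖ < 1 / 2 →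
      ∀ n, ‖expSeries (ArcPoisson.vectorField Z v) q (ArcPoisson.vectorField Z w f) n‖ ≤
        c * ‖w‖ * (1 / 2) ^ n := by
  obtain ⟨c, hc, hb⟩ := h.vectorField f
  refine ⟨c, hc, fun q hq v w hv n => (ArcPoisson.norm_expSeries_le (hb q hq v w n)).trans ?_⟩
  have := mul_nonneg hC (norm_nonneg v)
  gcongr

theorem summable_mul_half_pow (c : ℝ) : Summable fun n : ℕ => c * (1 / 2 : ℝ) ^ n :=
  summable_geometric_two.mul_left c

variable (Z) in
/-- The joint flow of the vector fields `Z`. -/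
noncomputable def flow (q : Pt B) (v : Fin r → ℂ) : Pt B := expPt (vectorField Z v) q

variable {q : Pt B} {v w : Fin r → ℂ}

theorem HasMajorant.summable (h : HasMajorant Z s ρ C) (hC : 0 ≤ C) (hq : ∀ u ∈ s, ‖q u‖ ≤ ρ)
    (hv : C * ‖v‖ < 1 / 2) (f : B) :
    Summable fun n => ‖expSeries (ArcPoisson.vectorField Z v) q f n‖ := by
  obtain ⟨c, -, hb⟩ := h.norm_expSeries_le hC f
  exact Summable.of_nonneg_of_le (fun n => norm_nonneg _) (hb q hq v hv) (summable_mul_half_pow c)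

theorem HasMajorant.flow_apply (h : HasMajorant Z s ρ C) (hC : 0 ≤ C) (hq : ∀ u ∈ s, ‖q u‖ ≤ ρ)
    (hv : C * ‖v‖ < 1 / 2) (f : B) :
    flow Z q v f = ∑' n, expSeries (ArcPoisson.vectorField Z v) q f n :=
  expPt_apply (h.summable hC hq hv) f

theorem HasMajorant.norm_flow_le (h : HasMajorant Z s ρ C) (hC : 0 ≤ C) (f : B) :
    ∃ c : ℝ, ∀ q : Pt B, (∀ u ∈ s, ‖q u‖ ≤ ρ) → ∀ v : Fin r → ℂ, C * ‖v‖ < 1 / 2 →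
      ‖flow Z q v f‖ ≤ c := by
  obtain ⟨c, -, hb⟩ := h.norm_expSeries_le hC f
  refine ⟨∑' n : ℕ, c * (1 / 2 : ℝ) ^ n, fun q hq v hv => ?_⟩
  rw [h.flow_apply hC hq hv]
  exact tsum_of_norm_bounded (summable_mul_half_pow c).hasSum (hb q hq v hv)

theorem HasMajorant.norm_flow_vectorField_le (h : HasMajorant Z s ρ C) (hC : 0 ≤ C) (f : B) :
    ∃ c : ℝ, 0 ≤ c ∧ ∀ q : Pt B, (∀ u ∈ s, ‖q u‖ ≤ ρ) → ∀ v w : Fin r → ℂ, C * ‖v‖ < 1 / 2 →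
      ‖flow Z q v (ArcPoisson.vectorField Z w f)‖ ≤ c * ‖w‖ := by
  obtain ⟨c, hc, hb⟩ := h.norm_expSeries_vectorField_le hC f
  refine ⟨c * 2, by positivity, fun q hq v w hv => ?_⟩
  rw [h.flow_apply hC hq hv]
  refine (tsum_of_norm_bounded (summable_mul_half_pow (c * ‖w‖)).hasSum (hb q hq v w hv)).trans
    (le_of_eq ?_)
  rw [tsum_mul_left, tsum_geometric_two]
  ring

theorem flow_zero (q : Pt B) : flow Z q 0 = q := by
  have h0 : ∀ f, vectorField Z 0 f = 0 := fun f => by simp [vectorField_apply]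
  have h1 : ∀ f n, n ≠ 0 → expSeries (vectorField Z 0) q f n = 0 := fun f n hn => by
    obtain ⟨n, rfl⟩ := Nat.exists_eq_succ_of_ne_zero hn
    rw [expSeries, Function.iterate_succ_apply, h0, iterate_map_zero, map_zero, mul_zero]
  refine DFunLike.ext _ _ fun f => ?_
  rw [flow, expPt_apply fun f => summable_of_ne_finset_zero (s := {0}) fun n hn => by
    rw [h1 f n (by simpa using hn), norm_zero], tsum_eq_single 0 (h1 f)]
  simp [expSeries]

/-- The flow along lines solves the differential equation. -/
theorem HasMajorant.hasDerivAt_flow (h : HasMajorant Z s ρ C) (hC : 0 ≤ C)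
    (hZ : ∀ i j f, Z i (Z j f) = Z j (Z i f)) (hq : ∀ u ∈ s, ‖q u‖ ≤ ρ) {t : ℝ}
    (ht : C * ‖v + t • w‖ < 1 / 2) (f : B) :
    HasDerivAt (fun t : ℝ => flow Z q (v + t • w) f)
      (flow Z q (v + t • w) (ArcPoisson.vectorField Z w f)) t := by
  let U : Set ℝ := {t | C * ‖v + t • w‖ < 1 / 2}
  have hUo : IsOpen U := isOpen_lt (by fun_prop) continuous_const
  have hUc : Convex ℝ U := by
    have h1 : ConvexOn ℝ Set.univ fun t : ℝ => C * ‖v + t • w‖ := by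
      have h2 : ConvexOn ℝ Set.univ fun t : ℝ => ‖v + t • w‖ := by
        have := (convexOn_univ_norm (E := Fin r → ℂ)).comp_affineMap
          (AffineMap.lineMap v (v + w) : ℝ →ᵃ[ℝ] (Fin r → ℂ))
        refine this.congr fun t _ => ?_
        simp [AffineMap.lineMap_apply, add_comm]
      exact h2.smul hC
    have := h1.convex_lt (1 / 2)
    simp only [Set.mem_univ, true_and] at this
    exact this
  let g : ℕ → ℝ → ℂ := fun n t => expSeries (ArcPoisson.vectorField Z (v + t • w)) q f n
  -- The derivative of the n-th term is the term n - 1 of the series of w·Z applied to f. The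
  -- truncated exponent at n = 0 is harmless because of the factor n.
  let g' : ℕ → ℝ → ℂ := fun n t => (n.factorial : ℂ)⁻¹ *
    (n * q ((ArcPoisson.vectorField Z (v + t • w))^[n - 1] (ArcPoisson.vectorField Z w f)))
  have hg0 : ∀ t, g' 0 t = 0 := fun t => by simp [g']
  have hgs : ∀ n t, g' (n + 1) t = expSeries (ArcPoisson.vectorField Z (v + t • w)) q
      (ArcPoisson.vectorField Z w f) n := fun n t => by
    have h1 : (n.factorial : ℂ) ≠ 0 := by exact_mod_cast n.factorial_ne_zero
    have h2 : (n + 1 : ℂ) ≠ 0 := by exact_mod_cast n.succ_ne_zero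
    simp only [g', expSeries, Nat.factorial_succ, Nat.add_sub_cancel]
    push_cast
    field_simp
  obtain ⟨c, hc, hb⟩ := h.norm_expSeries_vectorField_le hC f
  have hg : ∀ n, ∀ t ∈ U, HasDerivAt (g n) (g' n t) t := fun n t _ => by
    have hline : HasDerivAt (fun t : ℝ => v + t • w) w t := by
      simpa using ((hasDerivAt_id t).smul_const w).const_add v
    have := hasDerivWithinAt_iterate hZ (γ := fun _ => q) (v := fun t => v + t • w) (μ := 0) (ν := w)
      (S := Set.univ) (t := t) (fun f => by
        simp only [vectorField_apply, Pi.zero_apply, zero_smul, Finset.sum_const_zero, map_zero]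
        exact hasDerivWithinAt_const _ _ _) hline.hasDerivWithinAt n f
    rw [hasDerivWithinAt_univ] at this
    refine (this.const_mul (n.factorial : ℂ)⁻¹).congr_deriv ?_
    rw [apply_iterate_vectorField]
    simp [g']
  have hbound : ∀ n, ∀ t ∈ U, ‖g' n t‖ ≤ 2 * c * ‖w‖ * (1 / 2) ^ n := fun n t ht => by
    cases n with
    | zero => rw [hg0, norm_zero]; positivity
    | succ n =>
      rw [hgs]
      refine (hb q hq _ w ht n).trans (le_of_eq ?_)
      ring
  have hmain := hasDerivAt_tsum_of_isPreconnected (summable_mul_half_pow (2 * c * ‖w‖)) hUo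
    hUc.isPreconnected hg hbound ht (h.summable hC hq ht f).of_norm ht
  have hsum : ∑' n, g' n t = flow Z q (v + t • w) (ArcPoisson.vectorField Z w f) := by
    rw [Summable.tsum_eq_zero_add (.of_norm_bounded (summable_mul_half_pow _) fun n =>
      hbound n t ht), hg0, zero_add, h.flow_apply hC hq ht]
    exact tsum_congr fun n => hgs n t
  rw [← hsum]
  refine hmain.congr_of_eventuallyEq ?_
  filter_upwards [hUo.mem_nhds ht] with t ht
  exact h.flow_apply hC hq ht f

/-- The flow transports all points of an integral curve to the same point. -/
theorem HasMajorant.flow_eq_flow (h : HasMajorant Z s ρ C) (hC : 0 ≤ C)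
    (hZ : ∀ i j f, Z i (Z j f) = Z j (Z i f)) {γ : ℝ → Pt B} {μ v : ℝ → Fin r → ℂ} {S : Set ℝ}
    (hS : Convex ℝ S) {M : ℝ}
    (hγ : ∀ t ∈ S, ∀ f, HasDerivWithinAt (fun t => γ t f)
      (γ t (ArcPoisson.vectorField Z (μ t) f)) S t)
    (hv : ∀ t ∈ S, HasDerivWithinAt v (-μ t) S t) (hμ : ∀ t ∈ S, ‖μ t‖ ≤ M)
    (hb : ∀ t ∈ S, ∀ u ∈ s, ‖γ t u‖ ≤ ρ) (hv' : ∀ t ∈ S, C * ‖v t‖ < 1 / 2) {t t' : ℝ}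
    (ht : t ∈ S) (ht' : t' ∈ S) : flow Z (γ t) (v t) = flow Z (γ t') (v t') := by
  refine DFunLike.ext _ _ fun f => ?_
  obtain ⟨c, hc, hbound⟩ := h.norm_expSeries_vectorField_le hC f
  have hM : 0 ≤ M := (norm_nonneg _).trans (hμ t ht)
  -- Since v' = -μ, the derivative of the partial sum telescopes: only its last term, taken for μ·Z
  -- f, survives. This tends to zero uniformly, so by the mean value inequality the limit is
  -- constant along the curve.
  let W : ℕ → ℝ → ℂ := fun n t =>
    ∑ i ∈ Finset.range (n + 1), expSeries (ArcPoisson.vectorField Z (v t)) (γ t) f i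
  have hW : ∀ n, ∀ t ∈ S, HasDerivWithinAt (W n) (expSeries (ArcPoisson.vectorField Z (v t)) (γ t)
      (ArcPoisson.vectorField Z (μ t) f) n) S t := fun n t ht => by
    have hneg : ∀ g, ArcPoisson.vectorField Z (-μ t) g = -ArcPoisson.vectorField Z (μ t) g :=
      fun g => by simp [vectorField_apply]
    have key := fun n => (hasDerivWithinAt_iterate hZ (hγ t ht) (hv t ht) n f).const_mul
      (n.factorial : ℂ)⁻¹
    induction n with
    | zero =>
      refine ((key 0).congr_deriv ?_).congr_of_eventuallyEq (.of_forall fun t => ?_) ?_ <;>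
        simp [W, expSeries]
    | succ n ih =>
      have h1 : W (n + 1) = fun t => W n t +
          expSeries (ArcPoisson.vectorField Z (v t)) (γ t) f (n + 1) :=
        funext fun t => Finset.sum_range_succ _ _
      rw [h1]
      refine (ih.add (key (n + 1))).congr_deriv ?_
      have h1 : (n.factorial : ℂ) ≠ 0 := by exact_mod_cast n.factorial_ne_zero
      have h2 : (n + 1 : ℂ) ≠ 0 := by exact_mod_cast n.succ_ne_zero
      simp only [expSeries, Nat.factorial_succ, Nat.add_sub_cancel, hneg, iterate_map_neg, map_neg]
      push_cast
      field_simp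
      ring
  have hdiff : ∀ n, ‖W n t' - W n t‖ ≤ c * M * (1 / 2) ^ n * ‖t' - t‖ := fun n =>
    hS.norm_image_sub_le_of_norm_hasDerivWithin_le (hW n) (fun x hx =>
      (hbound (γ x) (hb x hx) _ _ (hv' x hx) n).trans (by
        have := hμ x hx
        gcongr)) ht ht'
  have hlim : ∀ t ∈ S, Filter.Tendsto (fun n => W n t) Filter.atTop (nhds (flow Z (γ t) (v t) f)) :=
    fun t ht => by
      rw [h.flow_apply hC (hb t ht) (hv' t ht)]
      exact ((h.summable hC (hb t ht) (hv' t ht) f).of_norm.hasSum.tendsto_sum_nat).comp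
        (Filter.tendsto_add_atTop_nat 1)
  have h0 : Filter.Tendsto (fun n : ℕ => c * M * (1 / 2 : ℝ) ^ n * ‖t' - t‖) Filter.atTop (nhds 0) := by
    have := ((tendsto_pow_atTop_nhds_zero_of_lt_one (r := (1 / 2 : ℝ)) (by norm_num)
      (by norm_num)).const_mul (c * M)).mul_const ‖t' - t‖
    simpa using this
  have h1 := squeeze_zero_norm hdiff h0
  exact (sub_eq_zero.1 (tendsto_nhds_unique ((hlim t' ht').sub (hlim t ht)) h1)).symm

end Flows
end ArcPoisson

namespace ArcPoisson
open ArcPoisson.PoissonAlgebra (bracket)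

/-! ### Flow boxes and plaque charts -/

section Charts

variable {R : Type*} [CommRing R] [Algebra ℂ R] [PoissonAlgebra R]

/-- The velocity of `γ` is a bounded linear combination of finitely many Hamiltonian vector
fields. -/
def IsTangentCurve (γ : ℝ → Pt R) (S : Set ℝ) : Prop :=
  ∃ (n : ℕ) (a : Fin n → R) (l : ℝ → Fin n → ℂ) (M : ℝ), ∀ t ∈ S, (∀ i, ‖l t i‖ ≤ M) ∧
    ∀ f, HasDerivWithinAt (fun t => γ t f) (∑ i, l t i * γ t (bracket (a i) f)) S t

theorem IsTangentCurve.mono {γ : ℝ → Pt R} {S S' : Set ℝ} (h : IsTangentCurve γ S) (hS : S' ⊆ S) :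
    IsTangentCurve γ S' := by
  obtain ⟨n, a, l, M, h⟩ := h
  exact ⟨n, a, l, M, fun t ht => ⟨(h t (hS ht)).1, fun f => ((h t (hS ht)).2 f).mono hS⟩⟩

theorem IsTangentCurve.continuousOn {γ : ℝ → Pt R} {S : Set ℝ} (h : IsTangentCurve γ S) :
    ContinuousOn (fun t => ⇑(γ t)) S := by
  obtain ⟨n, a, l, M, h⟩ := h
  exact continuousOn_pi.2 fun f t ht => ((h t ht).2 f).continuousWithinAt

/-- An open subset of the zero locus of `Q` with a map `h` that is constant on tangent curves, such
that the fibres of `h` are parametrized by open subsets of `ℂ^r`. -/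
structure PlaqueChart (Q : Ideal R) (r : ℕ) where
  O : Set (R → ℂ)
  isOpen : IsOpen O
  h : Pt R → Pt R
  h_eq : ∀ (γ : ℝ → Pt R) (S : Set ℝ), Convex ℝ S → IsTangentCurve γ S →
    (∀ t ∈ S, Q ≤ (γ t).maxIdeal ∧ ⇑(γ t) ∈ O) → ∀ t ∈ S, ∀ t' ∈ S, h (γ t) = h (γ t')
  exists_plaque : ∀ c : Pt R, ∃ (Θ : (Fin r → ℂ) → Pt R) (V : Set (Fin r → ℂ)), Convex ℝ V ∧
    (∀ p : Pt R, Q ≤ p.maxIdeal → ⇑p ∈ O → h p = c → ∃ v ∈ V, Θ v = p) ∧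
    (∀ v ∈ V, Q ≤ (Θ v).maxIdeal) ∧
    (∀ v ∈ V, ∀ v' ∈ V, IsTangentCurve (fun t => Θ (v + t • (v' - v))) (Set.Icc 0 1)) ∧
    ∀ f, ∃ K, LipschitzOnWith K (fun v => Θ v f) V

/-- Commuting vector fields spanning the Hamiltonian ones on the part of the zero locus of `Q` where
`Δ` does not vanish. -/
structure FlowBox (Q : Ideal R) (r : ℕ) (Δ : R) (B : Type*) [CommRing B] [Algebra ℂ B] where
  φ : R →ₐ[ℂ] B
  Z : Fin r → Derivation ℂ B B
  c : Fin r → R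
  a : Fin r → R
  N : Fin r → Fin r → B
  φ_eq_zero : ∀ f ∈ Q, φ f = 0
  isUnit : IsUnit (φ Δ)
  exists_lift : ∀ p : Pt R, Q ≤ p.maxIdeal → p Δ ≠ 0 → ∃ q : Pt B, ∀ f, q (φ f) = p f
  exists_num : ∀ b : B, ∃ (f : R) (n : ℕ), b * φ (Δ ^ n) = φ f
  Z_comm : ∀ i j f, Z i (Z j f) = Z j (Z i f)
  bracket_eq : ∀ a f, φ (bracket a f) = ∑ j, φ (bracket a (c j)) * Z j (φ f)
  Z_φ : ∀ k f, Z k (φ f) = ∑ l, N k l * φ (bracket (a l) f)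

namespace FlowBox

variable {Q : Ideal R} {r : ℕ} {Δ : R} {B : Type*} [CommRing B] [Algebra ℂ B]
  (F : FlowBox Q r Δ B)

/-- The image in `Spec R` of a point of the flow box. -/
def restrict (q : Pt B) : Pt R := q.toAlgHom.comp F.φ

theorem restrict_apply (q : Pt B) (f : R) : F.restrict q f = q (F.φ f) := rfl

theorem apply_ne_zero (q : Pt B) (n : ℕ) : q (F.φ (Δ ^ n)) ≠ 0 := by
  rw [map_pow, map_pow]
  exact pow_ne_zero n (F.isUnit.map q).ne_zero

theorem restrict_injective : Function.Injective F.restrict := fun q q' h => by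
  refine DFunLike.ext _ _ fun b => ?_
  obtain ⟨f, n, hf⟩ := F.exists_num b
  have h1 := congrArg q hf
  have h2 := congrArg q' hf
  rw [map_mul] at h1 h2
  have h3 : ∀ f, q (F.φ f) = q' (F.φ f) := fun f => DFunLike.congr_fun h f
  rw [h3, h3, ← h2] at h1
  exact mul_right_cancel₀ (F.apply_ne_zero q' n) h1

theorem le_maxIdeal_restrict (q : Pt B) : Q ≤ (F.restrict q).maxIdeal := fun f hf => by
  rw [Pt.mem_maxIdeal, restrict_apply, F.φ_eq_zero f hf, map_zero]

/-- Tangent curves are integral curves in the flow box. -/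
theorem hasDerivWithinAt_lift {γ : ℝ → Pt R} {γ' : ℝ → Pt B} {S : Set ℝ}
    (hγ : ∀ t ∈ S, ∀ f, γ' t (F.φ f) = γ t f) {n : ℕ} {a : Fin n → R} {l : Fin n → ℂ} {t : ℝ}
    (ht : t ∈ S)
    (h : ∀ f, HasDerivWithinAt (fun t => γ t f) (∑ i, l i * γ t (bracket (a i) f)) S t) (b : B) :
    HasDerivWithinAt (fun t => γ' t b)
      (γ' t (vectorField F.Z (fun j => ∑ i, l i * γ t (bracket (a i) (F.c j))) b)) S t := by
  set μ : Fin r → ℂ := fun j => ∑ i, l i * γ t (bracket (a i) (F.c j)) with hμ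
  have hφ : ∀ f, HasDerivWithinAt (fun t => γ' t (F.φ f)) (γ' t (vectorField F.Z μ (F.φ f))) S t :=
    fun f => by
      refine ((h f).congr (fun t ht => hγ t ht f) (hγ t ht f)).congr_deriv ?_
      rw [vectorField_apply, map_sum]
      simp only [← hγ t ht, F.bracket_eq _ f, map_sum, map_mul, map_smul, smul_eq_mul, hμ,
        Finset.mul_sum, Finset.sum_mul]
      rw [Finset.sum_comm]
      simp only [mul_assoc]
  obtain ⟨f, n, hf⟩ := F.exists_num b
  have hb : ∀ t, γ' t b = γ' t (F.φ f) / γ' t (F.φ (Δ ^ n)) := fun t => by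
    rw [← hf, map_mul, mul_div_cancel_right₀ _ (F.apply_ne_zero _ n)]
  refine (((hφ f).div (hφ (Δ ^ n)) (F.apply_ne_zero _ n)).congr (fun t _ => hb t)
    (hb t)).congr_deriv ?_
  rw [← hf, Derivation.leibniz, map_add, map_mul, smul_eq_mul, smul_eq_mul, map_mul, map_mul]
  have := F.apply_ne_zero (γ' t) n
  field_simp
  ring

variable {s : Finset B} {ρ C : ℝ}

/-- Flowing to the slice `c = y` gives the same result for all points of a tangent curve. -/
theorem flow_slice_eq (hmaj : HasMajorant F.Z s ρ C) (hC : 0 ≤ C) {y : Fin r → ℂ}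
    {γ : ℝ → Pt R} {γ' : ℝ → Pt B} {S : Set ℝ} (hS : Convex ℝ S) (hγ : IsTangentCurve γ S)
    (hγ' : ∀ t ∈ S, ∀ f, γ' t (F.φ f) = γ t f) (hb : ∀ t ∈ S, ∀ u ∈ (s : Set B), ‖γ' t u‖ ≤ ρ)
    (hy : ∀ t ∈ S, C * ‖y - fun j => γ t (F.c j)‖ < 1 / 2) {t t' : ℝ} (ht : t ∈ S) (ht' : t' ∈ S) :
    flow F.Z (γ' t) (y - fun j => γ t (F.c j)) = flow F.Z (γ' t') (y - fun j => γ t' (F.c j)) := by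
  obtain ⟨n, a, l, M, hl⟩ := hγ
  choose cb hcb0 hcb using fun f => hmaj f
  have hM : ∀ i : Fin n, 0 ≤ M := fun i => (norm_nonneg _).trans ((hl t ht).1 i)
  have hnn : ∀ j, 0 ≤ ∑ i, M * cb (F.φ (bracket (a i) (F.c j))) := fun j =>
    Finset.sum_nonneg fun i _ => mul_nonneg (hM i) (hcb0 _)
  have hμ : ∀ t ∈ S, ‖fun j => ∑ i, l t i * γ t (bracket (a i) (F.c j))‖ ≤
      ∑ j, ∑ i, M * cb (F.φ (bracket (a i) (F.c j))) := fun t ht => by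
    refine (pi_norm_le_iff_of_nonneg (Finset.sum_nonneg fun j _ => hnn j)).2 fun j =>
      ((norm_sum_le _ _).trans (Finset.sum_le_sum fun i _ => ?_)).trans
      (Finset.single_le_sum (fun j _ => hnn j) (Finset.mem_univ j))
    rw [norm_mul]
    refine mul_le_mul ((hl t ht).1 i) ?_ (norm_nonneg _) (hM i)
    rw [← hγ' t ht]
    simpa using hcb (F.φ (bracket (a i) (F.c j))) (γ' t) (hb t ht) 0 0
  have hv : ∀ t ∈ S, HasDerivWithinAt (fun t => y - fun j => γ t (F.c j))
      (-fun j => ∑ i, l t i * γ t (bracket (a i) (F.c j))) S t := fun t ht =>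
    hasDerivWithinAt_pi.2 fun j => ((hl t ht).2 (F.c j)).const_sub (y j)
  exact hmaj.flow_eq_flow hC F.Z_comm hS
    (fun t ht f => F.hasDerivWithinAt_lift hγ' ht (hl t ht).2 f) hv hμ hb hy ht ht'

/-- Apply `HasMajorant.flow_eq_flow` to t ↦ flow of q by t v, with remaining vector -t v. The flowed
points satisfy only the weaker bound ρ', hence the second majorant. -/
theorem flow_neg_flow {ρ' C' : ℝ} (hmaj : HasMajorant F.Z s ρ C) (hC : 0 ≤ C)
    (hmaj' : HasMajorant F.Z s ρ' C') (hC' : 0 ≤ C') {q : Pt B} (hq : ∀ u ∈ (s : Set B), ‖q u‖ ≤ ρ)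
    {v : Fin r → ℂ} (hv : C * ‖v‖ < 1 / 2) (hv' : C' * ‖v‖ < 1 / 2)
    (hb : ∀ v : Fin r → ℂ, C * ‖v‖ < 1 / 2 → ∀ u ∈ (s : Set B), ‖flow F.Z q v u‖ ≤ ρ') :
    flow F.Z (flow F.Z q v) (-v) = q := by
  have hle : ∀ t ∈ Set.Icc (0 : ℝ) 1, ‖t • v‖ ≤ ‖v‖ := fun t ht => by
    rw [norm_smul, Real.norm_of_nonneg ht.1]
    exact mul_le_of_le_one_left (norm_nonneg _) ht.2
  have h1 : ∀ t ∈ Set.Icc (0 : ℝ) 1, C * ‖0 + t • v‖ < 1 / 2 := fun t ht => by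
    rw [zero_add]
    exact (mul_le_mul_of_nonneg_left (hle t ht) hC).trans_lt hv
  have h2 : ∀ t ∈ Set.Icc (0 : ℝ) 1, C' * ‖-(t • v)‖ < 1 / 2 := fun t ht => by
    rw [norm_neg]
    exact (mul_le_mul_of_nonneg_left (hle t ht) hC').trans_lt hv'
  have h3 : ∀ t ∈ Set.Icc (0 : ℝ) 1, HasDerivWithinAt (fun t : ℝ => -(t • v)) (-v)
      (Set.Icc 0 1) t := fun t _ => by
    exact (((hasDerivWithinAt_id t (Set.Icc 0 1)).smul_const v).congr_deriv (one_smul _ _)).neg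
  have := hmaj'.flow_eq_flow hC' F.Z_comm (convex_Icc (0 : ℝ) 1)
    (γ := fun t => flow F.Z q (0 + t • v)) (μ := fun _ => v) (M := ‖v‖)
    (fun t ht f => (hmaj.hasDerivAt_flow hC F.Z_comm hq (h1 t ht) f).hasDerivWithinAt)
    h3 (fun _ _ => le_rfl) (fun t ht => hb _ (h1 t ht)) h2
    (Set.right_mem_Icc.2 zero_le_one) (Set.left_mem_Icc.2 zero_le_one)
  simpa only [one_smul, zero_smul, zero_add, neg_zero, flow_zero] using this

/-- The fields Z are combinations of Hamiltonian ones with coefficients `N` in B, and functions in B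
stay bounded along the flow. -/
theorem isTangentCurve_flow (hmaj : HasMajorant F.Z s ρ C) (hC : 0 ≤ C) {w : Pt B}
    (hw : ∀ u ∈ (s : Set B), ‖w u‖ ≤ ρ) {v ν : Fin r → ℂ}
    (hv : ∀ t ∈ Set.Icc (0 : ℝ) 1, C * ‖v + t • ν‖ < 1 / 2) :
    IsTangentCurve (fun t => F.restrict (flow F.Z w (v + t • ν))) (Set.Icc 0 1) := by
  choose cN hcN using fun f => hmaj.norm_flow_le hC f
  refine ⟨r, F.a, fun t l => ∑ m, ν m * flow F.Z w (v + t • ν) (F.N m l),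
    ∑ l, ∑ m, ‖ν m‖ * |cN (F.N m l)|, fun t ht => ⟨fun l => ?_, fun f => ?_⟩⟩
  · refine ((norm_sum_le _ _).trans (Finset.sum_le_sum fun m _ => ?_)).trans
      (Finset.single_le_sum (f := fun l => ∑ m, ‖ν m‖ * |cN (F.N m l)|)
        (fun l _ => Finset.sum_nonneg fun m _ => by positivity) (Finset.mem_univ l))
    rw [norm_mul]
    exact mul_le_mul_of_nonneg_left ((hcN _ w hw _ (hv t ht)).trans (le_abs_self _))
      (norm_nonneg _)
  · refine (hmaj.hasDerivAt_flow hC F.Z_comm hw (hv t ht)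
      (F.φ f)).hasDerivWithinAt.congr_deriv ?_
    rw [vectorField_apply, map_sum]
    simp only [F.Z_φ, map_smul, map_sum, map_mul, smul_eq_mul, Finset.mul_sum, Finset.sum_mul,
      restrict_apply]
    rw [Finset.sum_comm]
    simp only [mul_assoc]

theorem lipschitzOnWith_flow (hmaj : HasMajorant F.Z s ρ C) (hC : 0 ≤ C) {w : Pt B}
    (hw : ∀ u ∈ (s : Set B), ‖w u‖ ≤ ρ) {V : Set (Fin r → ℂ)} (hV : Convex ℝ V)
    (hVC : ∀ v ∈ V, C * ‖v‖ < 1 / 2) (b : B) :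
    ∃ K, LipschitzOnWith K (fun v => flow F.Z w v b) V := by
  obtain ⟨cl, hcl0, hcl⟩ := hmaj.norm_flow_vectorField_le hC b
  refine ⟨⟨cl, hcl0⟩, LipschitzOnWith.of_dist_le_mul fun v' hv' v hv => ?_⟩
  rw [dist_eq_norm, dist_eq_norm]
  have hseg : ∀ t ∈ Set.Icc (0 : ℝ) 1, C * ‖v + t • (v' - v)‖ < 1 / 2 := fun t ht =>
    hVC _ (hV.add_smul_sub_mem hv hv' ht)
  have := (convex_Icc (0 : ℝ) 1).norm_image_sub_le_of_norm_hasDerivWithin_le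
    (f := fun t : ℝ => flow F.Z w (v + t • (v' - v)) b) (C := cl * ‖v' - v‖)
    (fun t ht => (hmaj.hasDerivAt_flow hC F.Z_comm hw (hseg t ht) b).hasDerivWithinAt)
    (fun t ht => hcl w hw _ _ (hseg t ht))
    (Set.left_mem_Icc.2 zero_le_one) (Set.right_mem_Icc.2 zero_le_one)
  simp only [one_smul, zero_smul, add_zero, add_sub_cancel, sub_zero, norm_one, mul_one] at this
  exact this

/-- The bound |q(u)| < ρ on B is expressed through R by writing u as num u / Δ^k, because chart
domains are open for pointwise convergence on R. -/
theorem isOpen_box (ρ : ℝ) (num : B → R) (k : B → ℕ) (ε : ℝ) (y : Fin r → ℂ) :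
    IsOpen {p : R → ℂ | p Δ ≠ 0 ∧
      (∀ u ∈ s, ‖p (num u)‖ < ρ * ‖p Δ‖ ^ k u) ∧ ‖y - fun j => p (F.c j)‖ < ε} := by
  refine IsOpen.inter (s := {p : R → ℂ | p Δ ≠ 0})
    (isOpen_ne_fun (continuous_apply Δ) continuous_const) (IsOpen.inter
    (s := {p : R → ℂ | ∀ u ∈ s, ‖p (num u)‖ < ρ * ‖p Δ‖ ^ k u})
    (t := {p : R → ℂ | ‖y - fun j => p (F.c j)‖ < ε}) ?_ ?_)
  · have h1 : ∀ u ∈ s, IsOpen {p : R → ℂ | ‖p (num u)‖ < ρ * ‖p Δ‖ ^ k u} := fun u _ =>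
      isOpen_lt ((continuous_apply (num u)).norm)
        (continuous_const.mul ((continuous_apply Δ).norm.pow _))
    convert isOpen_biInter_finset h1 using 1
    ext p
    simp
  · exact isOpen_lt (continuous_const.sub (continuous_pi fun j => continuous_apply (F.c j))).norm
      continuous_const

/-- A retraction onto the slice `c = y`. -/
theorem exists_slice {num : B → R} {k : B → ℕ} (hnum : ∀ b, b * F.φ (Δ ^ k b) = F.φ (num b))
    (y : Fin r → ℂ) : ∃ h : Pt R → Pt R, ∀ p : Pt R, Q ≤ p.maxIdeal → p Δ ≠ 0 →
      (∀ u ∈ s, ‖p (num u)‖ < ρ * ‖p Δ‖ ^ k u) → ∃ q : Pt B, (∀ f, q (F.φ f) = p f) ∧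
      (∀ u ∈ (s : Set B), ‖q u‖ ≤ ρ) ∧ h p = F.restrict (flow F.Z q (y - fun j => p (F.c j))) := by
  -- Outside the relevant region the value of the retraction is arbitrary.
  have key : ∀ p : Pt R, ∃ p' : Pt R, Q ≤ p.maxIdeal → p Δ ≠ 0 →
      (∀ u ∈ s, ‖p (num u)‖ < ρ * ‖p Δ‖ ^ k u) → ∃ q : Pt B, (∀ f, q (F.φ f) = p f) ∧
      (∀ u ∈ (s : Set B), ‖q u‖ ≤ ρ) ∧
      p' = F.restrict (flow F.Z q (y - fun j => p (F.c j))) := fun p => by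
    by_cases H : Q ≤ p.maxIdeal ∧ p Δ ≠ 0
    swap
    · exact ⟨p, fun h1 h2 => absurd ⟨h1, h2⟩ H⟩
    obtain ⟨q, hq⟩ := F.exists_lift p H.1 H.2
    refine ⟨_, fun _ _ hu => ⟨q, hq, fun u hus => ?_, rfl⟩⟩
    have h1 := congrArg q (hnum u)
    rw [map_mul, hq, hq, map_pow] at h1
    have h2 := hu u hus
    rw [← h1, norm_mul, norm_pow] at h2
    exact (lt_of_mul_lt_mul_right h2 (by positivity)).le
  choose h hh using key
  exact ⟨h, hh⟩

variable (hs : Algebra.adjoin ℂ (s : Set B) = ⊤)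

include hs in
/-- For a bounded part of the flow box, there is a radius such that the boxes of this radius are
plaque charts. -/
theorem exists_chart (ρ : ℝ) {num : B → R} {k : B → ℕ}
    (hnum : ∀ b, b * F.φ (Δ ^ k b) = F.φ (num b)) : ∃ ε > 0, ∀ y : Fin r → ℂ,
    ∃ C : PlaqueChart Q r, C.O = {p : R → ℂ | p Δ ≠ 0 ∧
      (∀ u ∈ s, ‖p (num u)‖ < ρ * ‖p Δ‖ ^ k u) ∧ ‖y - fun j => p (F.c j)‖ < ε} := by
  obtain ⟨C, hC, hmaj⟩ := exists_hasMajorant (Z := F.Z) hs ρ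
  choose cf hcf using hmaj.norm_flow_le hC.le
  -- Flowing to the slice may leave the region of bound ρ. A second majorant, for ρ', allows flowing
  -- back from the slice.
  obtain ⟨ρ', hρ'⟩ : ∃ ρ', ∀ q : Pt B, (∀ u ∈ (s : Set B), ‖q u‖ ≤ ρ) → ∀ v : Fin r → ℂ,
      C * ‖v‖ < 1 / 2 → ∀ u ∈ (s : Set B), ‖flow F.Z q v u‖ ≤ ρ' :=
    ⟨∑ u ∈ s, |cf u|, fun q hq v hv u hu => (hcf u q hq v hv).trans ((le_abs_self _).trans
      (Finset.single_le_sum (f := fun u => |cf u|) (fun u _ => abs_nonneg _) hu))⟩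
  obtain ⟨C', hC', hmaj'⟩ := exists_hasMajorant (Z := F.Z) hs ρ'
  obtain ⟨ε, hε, hεC, hεC'⟩ : ∃ ε > 0, (∀ v : Fin r → ℂ, ‖v‖ < ε → C * ‖v‖ < 1 / 2) ∧
      ∀ v : Fin r → ℂ, ‖v‖ < ε → C' * ‖v‖ < 1 / 2 := by
    refine ⟨min (1 / (2 * C)) (1 / (2 * C')), by positivity, fun v hv => ?_, fun v hv => ?_⟩
    · have := hv.trans_le (min_le_left _ _)
      rw [lt_div_iff₀ (by positivity)] at this
      linarith
    · have := hv.trans_le (min_le_right _ _)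
      rw [lt_div_iff₀ (by positivity)] at this
      linarith
  refine ⟨ε, hε, fun y => ?_⟩
  obtain ⟨h, hh⟩ := F.exists_slice (s := s) (ρ := ρ) hnum y
  refine ⟨⟨_, F.isOpen_box (s := s) ρ num k ε y, h, fun γ S hS hγ hγO t ht t' ht' => ?_,
    fun c₀ => ?_⟩, rfl⟩
  · have : Nonempty (Pt B) :=
      let ⟨q, _⟩ := hh (γ t) (hγO t ht).1 (hγO t ht).2.1 (hγO t ht).2.2.1
      ⟨q⟩
    choose! γ' hγ' hb hhγ using fun t ht => hh (γ t) (hγO t ht).1 (hγO t ht).2.1 (hγO t ht).2.2.1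
    rw [hhγ t ht, hhγ t' ht', F.flow_slice_eq hmaj hC.le hS hγ hγ' hb
      (fun t ht => hεC _ (hγO t ht).2.2.2) ht ht']
  -- The plaque over c₀ is parametrized by flowing from the corresponding slice point w. The
  -- parameter of p is c(p) - y. Without such a w the plaque is empty.
  · by_cases hne : ∃ w : Pt B, F.restrict w = c₀ ∧ ∀ u ∈ (s : Set B), ‖w u‖ ≤ ρ'
    swap
    · refine ⟨fun _ => c₀, ∅, convex_empty, fun p hp hpO hpc => (hne ?_).elim, ?_, ?_,
        fun f => ⟨0, ?_⟩⟩
      · obtain ⟨q, hq, hqb, hhq⟩ := hh p hp hpO.1 hpO.2.1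
        exact ⟨_, hhq.symm.trans hpc, hρ' q hqb _ (hεC _ hpO.2.2)⟩
      all_goals simp
    obtain ⟨w, rfl, hw⟩ := hne
    refine ⟨fun v => F.restrict (flow F.Z w v), Metric.ball 0 ε, convex_ball _ _,
      fun p hp hpO hpc => ?_, fun v _ => F.le_maxIdeal_restrict _, fun v hv v' hv' => ?_,
      fun f => ?_⟩
    · obtain ⟨q, hq, hqb, hhq⟩ := hh p hp hpO.1 hpO.2.1
      rw [hhq] at hpc
      refine ⟨-(y - fun j => p (F.c j)), by rw [mem_ball_zero_iff, norm_neg]; exact hpO.2.2, ?_⟩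
      dsimp only
      rw [← F.restrict_injective hpc, F.flow_neg_flow hmaj hC.le hmaj' hC'.le hqb (hεC _ hpO.2.2)
        (hεC' _ hpO.2.2) (hρ' q hqb)]
      exact DFunLike.ext _ _ hq
    · refine F.isTangentCurve_flow hmaj' hC'.le hw fun t ht => hεC' _ ?_
      have := (convex_ball (0 : Fin r → ℂ) ε).add_smul_sub_mem hv hv' ht
      rwa [mem_ball_zero_iff] at this
    · exact F.lipschitzOnWith_flow hmaj' hC'.le hw (convex_ball _ _)
        (fun v hv => hεC' _ (mem_ball_zero_iff.1 hv)) (F.φ f)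

-- Integer bounds ρ exhaust the flow box, and for each of them the radius ε does not depend on y, so
-- y may range over a countable dense set.
include F hs in
theorem exists_charts : ∃ 𝒞 : Set (PlaqueChart Q r), 𝒞.Countable ∧
    ∀ p : Pt R, Q ≤ p.maxIdeal → p Δ ≠ 0 → ∃ C ∈ 𝒞, ⇑p ∈ C.O := by
  choose num k hnum using F.exists_num
  choose ε hε C hC using fun ρ : ℕ => F.exists_chart hs (ρ : ℝ) hnum
  obtain ⟨D, hDc, hD⟩ := TopologicalSpace.exists_countable_dense (Fin r → ℂ)
  refine ⟨(fun x : ℕ × (Fin r → ℂ) => C x.1 x.2) '' (Set.univ ×ˢ D),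
    (Set.countable_univ.prod hDc).image _, fun p hp hpΔ => ?_⟩
  obtain ⟨q, hq⟩ := F.exists_lift p hp hpΔ
  obtain ⟨ρ, hρ⟩ := exists_nat_gt (∑ u ∈ s, ‖q u‖)
  obtain ⟨y, hyD, hy⟩ := hD.exists_dist_lt (fun j => p (F.c j)) (hε ρ)
  refine ⟨_, ⟨(ρ, y), ⟨trivial, hyD⟩, rfl⟩, ?_⟩
  rw [hC]
  refine ⟨hpΔ, fun u hu => ?_, by rwa [dist_comm, dist_eq_norm] at hy⟩
  have h1 := congrArg q (hnum u)
  rw [map_mul, hq, hq, map_pow] at h1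
  rw [← h1, norm_mul, norm_pow]
  refine mul_lt_mul_of_pos_right ?_ (by positivity)
  exact (Finset.single_le_sum (f := fun u => ‖q u‖) (fun u _ => norm_nonneg _) hu).trans_lt hρ

end FlowBox

end Charts
end ArcPoisson

namespace ArcPoisson
open ArcPoisson.PoissonAlgebra (bracket)

/-! ### Minors of the bracket generate Poisson ideals -/

section Minors

theorem derivation_prod {A ι : Type*} [CommRing A] [Algebra ℂ A] [DecidableEq ι]
    (D : Derivation ℂ A A) (s : Finset ι) (f : ι → A) :
    D (∏ j ∈ s, f j) = ∑ i ∈ s, ∏ j ∈ s, Function.update f i (D (f i)) j := by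
  induction s using Finset.induction_on with
  | empty => simp
  | insert k s hk ih =>
    rw [Finset.prod_insert hk, Derivation.leibniz, ih, Finset.sum_insert hk, Finset.prod_insert hk,
      Function.update_self, add_comm, smul_eq_mul, smul_eq_mul, Finset.mul_sum]
    congr 1
    · rw [mul_comm]
      congr 1
      exact Finset.prod_congr rfl fun j hj =>
        (Function.update_of_ne (ne_of_mem_of_not_mem hj hk) _ _).symm
    · refine Finset.sum_congr rfl fun i hi => ?_
      rw [Finset.prod_insert hk, Function.update_of_ne (ne_of_mem_of_not_mem hi hk).symm]

theorem derivation_det {A : Type*} [CommRing A] [Algebra ℂ A] (D : Derivation ℂ A A) {n : ℕ}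
    (M : Matrix (Fin n) (Fin n) A) :
    D M.det = ∑ j, (M.updateCol j fun i => D (M i j)).det := by
  simp only [Matrix.det_apply, map_sum, Units.smul_def, map_zsmul, derivation_prod]
  simp only [Finset.smul_sum]
  rw [Finset.sum_comm]
  refine Finset.sum_congr rfl fun j _ => Finset.sum_congr rfl fun σ _ => ?_
  congr 1
  refine Finset.prod_congr rfl fun i _ => ?_
  by_cases h : i = j
  · subst h; simp
  · simp [h]

theorem sum_det_updateCol {A : Type*} [CommRing A] {n : ℕ} (M N : Matrix (Fin n) (Fin n) A) :
    ∑ j, (M.updateCol j fun i => N i j).det = (M.adjugate * N).trace := by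
  refine Finset.sum_congr rfl fun j _ => ?_
  rw [← Matrix.cramer_apply, Matrix.cramer_eq_adjugate_mulVec]
  rfl

/-- Both sides are the trace of adj(M) N. This lets the two halves of a bracket derivative be taken
along rows and along columns respectively. -/
theorem sum_det_updateRow {A : Type*} [CommRing A] {n : ℕ} (M N : Matrix (Fin n) (Fin n) A) :
    ∑ i, (M.updateRow i (N i)).det = ∑ j, (M.updateCol j fun i => N i j).det := by
  rw [sum_det_updateCol, ← Matrix.trace_transpose, Matrix.transpose_mul, Matrix.trace_mul_comm,
    Matrix.adjugate_transpose, ← sum_det_updateCol]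
  refine Finset.sum_congr rfl fun i _ => ?_
  rw [← Matrix.det_transpose, ← Matrix.updateCol_transpose]
  rfl

variable {R : Type*} [CommRing R] [Algebra ℂ R] [PoissonAlgebra R]

/-- The determinant of a matrix of brackets. -/
def bracketDet {n : ℕ} (a c : Fin n → R) : R := (Matrix.of fun i j => bracket (a i) (c j)).det

theorem map_bracketDet {S : Type*} [CommRing S] (φ : R →+* S) {n : ℕ} (a c : Fin n → R) :
    φ (bracketDet a c) = (Matrix.of fun i j => φ (bracket (a i) (c j))).det := by
  rw [bracketDet, RingHom.map_det]
  rfl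

/-- The Jacobi identity splits {f, {a_i, c_j}} into a change of a_i, which affects a row, and a
change of c_j, which affects a column. -/
theorem bracket_bracketDet (f : R) {n : ℕ} (a c : Fin n → R) : bracket f (bracketDet a c) =
    ∑ i, bracketDet (Function.update a i (bracket f (a i))) c +
      ∑ j, bracketDet a (Function.update c j (bracket f (c j))) := by
  rw [← hamiltonian_apply, bracketDet, derivation_det]
  have hsplit : (Matrix.of fun i j =>
      hamiltonian f ((Matrix.of fun i j => bracket (a i) (c j)) i j) : Matrix (Fin n) (Fin n) R) =
      Matrix.of (fun i j => bracket (bracket f (a i)) (c j)) +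
        Matrix.of fun i j => bracket (a i) (bracket f (c j)) := by
    ext i j
    exact PoissonAlgebra.jacobi f (a i) (c j)
  refine (sum_det_updateCol _ (Matrix.of fun i j =>
      hamiltonian f ((Matrix.of fun i j => bracket (a i) (c j)) i j))).trans ?_
  rw [hsplit, mul_add, Matrix.trace_add, ← sum_det_updateCol, ← sum_det_updateCol,
    ← sum_det_updateRow]
  congr 1
  · refine Finset.sum_congr rfl fun i _ => congrArg Matrix.det ?_
    ext k j
    by_cases h : k = i
    · subst h; simp
    · simp [h]
  · refine Finset.sum_congr rfl fun i _ => congrArg Matrix.det ?_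
    ext k j
    by_cases h : j = i
    · subst h; simp
    · simp [h]

/-- Consequently the locus in V(Q) where the rank drops below n is a union of leaves. -/
theorem isPoissonIdeal_sup_minors {Q : Ideal R} (hQ : IsPoissonIdeal Q) (n : ℕ) :
    IsPoissonIdeal (Q ⊔ Ideal.span {f | ∃ a c : Fin n → R, f = bracketDet a c}) := by
  intro f g hg
  have hspan : ∀ g ∈ Ideal.span {f | ∃ a c : Fin n → R, f = bracketDet a c},
      hamiltonian f g ∈ Ideal.span {f | ∃ a c : Fin n → R, f = bracketDet a c} := fun g hg => by
    induction hg using Submodule.span_induction with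
    | mem g hg =>
      obtain ⟨a, c, rfl⟩ := hg
      rw [hamiltonian_apply, bracket_bracketDet]
      exact add_mem (sum_mem fun i _ => Ideal.subset_span ⟨_, _, rfl⟩)
        (sum_mem fun i _ => Ideal.subset_span ⟨_, _, rfl⟩)
    | zero => simp
    | add x y _ _ hx hy => rw [map_add]; exact add_mem hx hy
    | smul a x hx' hx =>
      rw [smul_eq_mul, Derivation.leibniz]
      exact add_mem (Ideal.mul_mem_left _ _ hx) (Ideal.mul_mem_right _ _ hx')
  obtain ⟨u, hu, v, hv, rfl⟩ := Submodule.mem_sup.1 hg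
  rw [map_add]
  exact add_mem (Ideal.mem_sup_left (hQ f u hu)) (Ideal.mem_sup_right (hspan v hv))

end Minors

/-! ### Straightening the Hamiltonian vector fields where the rank is maximal -/

section FlowBoxes

variable {R : Type*} [CommRing R] [Algebra ℂ R] [PoissonAlgebra R] {Q : Ideal R}

theorem exists_hamiltonian_extension (hP : IsPoissonIdeal Q) {B : Type*} [CommRing B] [Algebra ℂ B]
    [Algebra (R ⧸ Q) B] [IsScalarTower ℂ (R ⧸ Q) B] [Algebra.FormallyEtale (R ⧸ Q) B] (a : R) :
    ∃ D : Derivation ℂ B B, ∀ f, D (algebraMap (R ⧸ Q) B (Ideal.Quotient.mk Q f)) =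
      algebraMap (R ⧸ Q) B (Ideal.Quotient.mk Q (bracket a f)) := by
  have h0 : ∀ f, Ideal.Quotient.mkₐ ℂ Q f = 0 → Ideal.Quotient.mkₐ ℂ Q (hamiltonian a f) = 0 :=
    fun f hf => Ideal.Quotient.eq_zero_iff_mem.2 (hP a f (Ideal.Quotient.eq_zero_iff_mem.1 hf))
  let D₀ : Derivation ℂ (R ⧸ Q) (R ⧸ Q) :=
    Derivation.liftOfSurjective (f := Ideal.Quotient.mkₐ ℂ Q)
      (Ideal.Quotient.mkₐ_surjective ℂ Q) (d := hamiltonian a) h0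
  have hD₀ : ∀ f, D₀ (Ideal.Quotient.mk Q f) = Ideal.Quotient.mk Q (bracket a f) := fun f =>
    Derivation.liftOfSurjective_apply (Ideal.Quotient.mkₐ_surjective ℂ Q) h0 f
  obtain ⟨D, hD⟩ := exists_derivation_extension (B := B)
    ((Algebra.linearMap (R ⧸ Q) B).compDer D₀)
  exact ⟨D, fun f => by rw [hD, ← hD₀]; rfl⟩

/-- Brackets of linear combinations of Hamiltonian vector fields are such combinations. -/
theorem commutator_mem_span {B : Type*} [CommRing B] [Algebra ℂ B] {S : Set (Derivation ℂ B B)}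
    (hS : ∀ X ∈ S, ∀ Y ∈ S, ⁅X, Y⁆ ∈ Submodule.span B S) {X Y : Derivation ℂ B B}
    (hX : X ∈ Submodule.span B S) (hY : Y ∈ Submodule.span B S) : ⁅X, Y⁆ ∈ Submodule.span B S := by
  have hsmul : ∀ (b : B) (X Y : Derivation ℂ B B), ⁅X, b • Y⁆ = b • ⁅X, Y⁆ + X b • Y :=
    fun b X Y => by
      ext f
      simp only [Derivation.commutator_apply, Derivation.add_apply, Derivation.smul_apply,
        smul_eq_mul, Derivation.leibniz]
      ring
  have hright : ∀ X ∈ S, ∀ Y ∈ Submodule.span B S, ⁅X, Y⁆ ∈ Submodule.span B S :=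
    fun X hX Y hY => by
      induction hY using Submodule.span_induction with
      | mem Y hY => exact hS X hX Y hY
      | zero => simp
      | add Y Y' _ _ h h' => rw [lie_add]; exact add_mem h h'
      | smul b Y hY h =>
        rw [hsmul]
        exact add_mem (Submodule.smul_mem _ _ h) (Submodule.smul_mem _ _ hY)
  induction hX using Submodule.span_induction with
  | mem X hX => exact hright X hX Y hY
  | zero => simp
  | add X X' _ _ h h' => rw [add_lie]; exact add_mem h h'
  | smul b X hX h =>
    rw [← lie_skew, hsmul, ← lie_skew Y X]
    refine neg_mem (add_mem (Submodule.smul_mem _ _ ?_) (Submodule.smul_mem _ _ hX))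
    rw [lie_skew, ← lie_skew]
    exact neg_mem h

/-- A relation between values of a matrix with vanishing bordered minor. -/
theorem eq_sum_inv_of_det_eq_zero {B : Type*} [CommRing B] {r : ℕ} {M : Matrix (Fin r) (Fin r) B}
    (hM : IsUnit M.det) {u v : Fin r → B} {e : B}
    (h : (Matrix.fromBlocks M (Matrix.of fun i _ => u i) (Matrix.of fun _ j => v j)
      (Matrix.of fun _ _ => e) : Matrix (Fin r ⊕ Fin 1) (Fin r ⊕ Fin 1) B).det = 0) :
    e = ∑ j, v j * ∑ l, M⁻¹ j l * u l := by
  have := M.invertibleOfIsUnitDet hM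
  rw [Matrix.det_fromBlocks₁₁, hM.mul_right_eq_zero, Matrix.det_fin_one, Matrix.sub_apply,
    sub_eq_zero, Matrix.invOf_eq_nonsing_inv, Matrix.mul_assoc] at h
  exact h

theorem exists_flowBox (hP : IsPoissonIdeal Q) {r : ℕ} (a c : Fin r → R)
    (hmax : ∀ a c : Fin (r + 1) → R, bracketDet a c ∈ Q) {B : Type*} [CommRing B] [Algebra ℂ B]
    [Algebra (R ⧸ Q) B] [IsScalarTower ℂ (R ⧸ Q) B]
    [IsLocalization.Away (Ideal.Quotient.mk Q (bracketDet a c)) B] :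
    Nonempty (FlowBox Q r (bracketDet a c) B) := by
  set Δ := bracketDet a c with hΔ
  let A := R ⧸ Q
  have : Algebra.FormallyEtale A B :=
    Algebra.FormallyEtale.of_isLocalization (Submonoid.powers (Ideal.Quotient.mk Q Δ))
  let φ : R →ₐ[ℂ] B := (IsScalarTower.toAlgHom ℂ A B).comp (Ideal.Quotient.mkₐ ℂ Q)
  have hφQ : ∀ f ∈ Q, φ f = 0 := fun f hf => by
    change algebraMap A B (Ideal.Quotient.mk Q f) = 0
    rw [Ideal.Quotient.eq_zero_iff_mem.2 hf, map_zero]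
  have hunit : IsUnit (φ Δ) := IsLocalization.Away.algebraMap_isUnit (S := B) (Ideal.Quotient.mk Q Δ)
  choose D hD using fun a => exists_hamiltonian_extension (B := B) hP a
  replace hD : ∀ a f, D a (φ f) = φ (bracket a f) := hD
  have hext : ∀ {X Y : Derivation ℂ B B}, (∀ f, X (φ f) = Y (φ f)) → X = Y := fun {X Y} h =>
    derivation_ext_of_formallyEtale (A := A) fun u => by
      obtain ⟨f, rfl⟩ := Ideal.Quotient.mk_surjective u
      exact h f
  let M : Matrix (Fin r) (Fin r) B := Matrix.of fun i j => φ (bracket (a i) (c j))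
  have hM : IsUnit M.det := by
    have : φ Δ = M.det := map_bracketDet φ.toRingHom a c
    exact this ▸ hunit
  -- The combinations of Hamiltonian fields dual to the functions c: Z_k c_j = δ_kj.
  let Z : Fin r → Derivation ℂ B B := fun k => ∑ l, M⁻¹ k l • D (a l)
  have hZ : ∀ k b, Z k b = ∑ l, M⁻¹ k l * D (a l) b := fun k b => by
    simp only [Z, derivation_sum_apply, Derivation.smul_apply, smul_eq_mul]
  have hZφ : ∀ k f, Z k (φ f) = ∑ l, M⁻¹ k l * φ (bracket (a l) f) := fun k f => by
    simp only [hZ, hD]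
  have hZc : ∀ k j, Z k (φ (c j)) = if k = j then 1 else 0 := fun k j => by
    rw [hZφ, ← Matrix.one_apply, ← Matrix.nonsing_inv_mul M hM]
    rfl
  -- The (r+1)-minor bordered by a' and f vanishes modulo Q, so every Hamiltonian field is
  -- determined by its values on c.
  have hbr : ∀ a' f, φ (bracket a' f) = ∑ j, φ (bracket a' (c j)) * Z j (φ f) := fun a' f => by
    simp only [hZφ]
    refine eq_sum_inv_of_det_eq_zero hM ?_
    have h1 := hφQ _ (hmax (Fin.append a ![a']) (Fin.append c ![f]))
    have h2 := map_bracketDet φ.toRingHom (Fin.append a ![a']) (Fin.append c ![f])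
    rw [← Matrix.det_submatrix_equiv_self finSumFinEquiv] at h2
    refine Eq.trans (congrArg Matrix.det ?_) (h2.symm.trans h1)
    ext i j
    rcases i with i | i <;> rcases j with j | j <;> simp [M, Fin.append_left, Fin.append_right]
  let S : Set (Derivation ℂ B B) := Set.range D
  have hspan : ∀ X ∈ Submodule.span B S, ∀ f, X (φ f) = ∑ j, X (φ (c j)) * Z j (φ f) :=
    fun X hX f => by
      induction hX using Submodule.span_induction with
      | mem X hX =>
        obtain ⟨a', rfl⟩ := hX
        simp only [hD]
        exact hbr a' f
      | zero => simp
      | add X Y _ _ h h' => simp only [Derivation.add_apply, h, h', add_mul, Finset.sum_add_distrib]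
      | smul b X _ h =>
        simp only [Derivation.smul_apply, smul_eq_mul, h, Finset.mul_sum, mul_assoc]
  have hS : ∀ X ∈ S, ∀ Y ∈ S, ⁅X, Y⁆ ∈ Submodule.span B S := by
    rintro _ ⟨a₁, rfl⟩ _ ⟨a₂, rfl⟩
    have : ⁅D a₁, D a₂⁆ = D (bracket a₁ a₂) := hext fun f => by
      rw [Derivation.commutator_apply, hD, hD, hD, hD, hD, ← map_sub, PoissonAlgebra.jacobi a₁ a₂ f,
        add_sub_cancel_right]
    rw [this]
    exact Submodule.subset_span ⟨_, rfl⟩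
  have hZS : ∀ k, Z k ∈ Submodule.span B S := fun k =>
    sum_mem fun l _ => Submodule.smul_mem _ _ (Submodule.subset_span ⟨_, rfl⟩)
  -- By the Jacobi identity the commutator is again a combination of Hamiltonian fields, hence
  -- determined by its values on c. These are zero because Z_k c_j is constant.
  have hcomm : ∀ i j, ⁅Z i, Z j⁆ = 0 := fun i j => hext fun f => by
    rw [hspan _ (commutator_mem_span hS (hZS i) (hZS j))]
    refine Finset.sum_eq_zero fun m _ => ?_
    rw [Derivation.commutator_apply, hZc, hZc]
    split_ifs <;> simp
  refine ⟨⟨φ, Z, c, a, fun k l => M⁻¹ k l, hφQ, hunit, fun p hp hpΔ => ?_, fun b => ?_, fun i j f => ?_, hbr,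
    hZφ⟩⟩
  · let p' : A →ₐ[ℂ] ℂ := Ideal.Quotient.liftₐ Q p.toAlgHom hp
    have hu : ∀ y : Submonoid.powers (Ideal.Quotient.mk Q Δ), IsUnit (p' y) := by
      rintro ⟨_, n, rfl⟩
      rw [map_pow]
      exact (IsUnit.mk0 _ hpΔ).pow n
    exact ⟨IsLocalization.liftAlgHom (S := B) hu, fun f =>
      IsLocalization.lift_eq (S := B) (g := p'.toRingHom) hu (Ideal.Quotient.mk Q f)⟩
  · obtain ⟨⟨u, ⟨_, n, rfl⟩⟩, hu⟩ :=
      IsLocalization.surj (Submonoid.powers (Ideal.Quotient.mk Q Δ)) b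
    obtain ⟨f, rfl⟩ := Ideal.Quotient.mk_surjective u
    exact ⟨f, n, hu⟩
  · have := congrArg (fun X : Derivation ℂ B B => X f) (hcomm i j)
    simpa [Derivation.commutator_apply, sub_eq_zero] using this

end FlowBoxes
end ArcPoisson

namespace ArcPoisson
open ArcPoisson.PoissonAlgebra (bracket)

/-! ### Leaves are covered by countably many plaques -/

section Plaques

variable {R : Type*} [CommRing R] [Algebra ℂ R] [PoissonAlgebra R] {Q : Ideal R} {r : ℕ}

/-- A fibre of a plaque chart. -/
def plaque (P : PlaqueChart Q r × Pt R) : Set (Pt R) :=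
  {p | Q ≤ p.maxIdeal ∧ ⇑p ∈ P.1.O ∧ P.1.h p = P.2}

theorem countable_setOf_plaque_inter (P : PlaqueChart Q r × Pt R) (C : PlaqueChart Q r) :
    {c | (plaque P ∩ plaque (C, c)).Nonempty}.Countable := by
  obtain ⟨Θ, V, hV, hsurj, hQ, htan, hlip⟩ := P.1.exists_plaque P.2
  have hcont : ContinuousOn (fun v => ⇑(Θ v)) V := continuousOn_pi.2 fun f =>
    let ⟨_, h⟩ := hlip f
    h.continuousOn
  let W : Set (Fin r → ℂ) := {v | v ∈ V ∧ ⇑(Θ v) ∈ C.O}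
  -- On the parameter space of a plaque, the function h of another chart is locally constant, since
  -- nearby parameters are joined by segments, which are tangent curves. Second countability leaves
  -- countably many values.
  have hloc : ∀ v ∈ W, {v' | C.h (Θ v') = C.h (Θ v)} ∈ nhdsWithin v W := fun v hv => by
    obtain ⟨ε, hε, hb⟩ := Metric.mem_nhdsWithin_iff.1
      (hcont v hv.1 (C.isOpen.mem_nhds hv.2))
    refine Metric.mem_nhdsWithin_iff.2 ⟨ε, hε, fun v' hv' => ?_⟩
    have hseg : ∀ t ∈ Set.Icc (0 : ℝ) 1, v + t • (v' - v) ∈ Metric.ball v ε ∩ V := fun t ht =>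
      ((convex_ball v ε).inter hV).add_smul_sub_mem ⟨Metric.mem_ball_self hε, hv.1⟩
        ⟨hv'.1, hv'.2.1⟩ ht
    have := C.h_eq _ _ (convex_Icc 0 1) (htan v hv.1 v' hv'.2.1)
      (fun t ht => ⟨hQ _ (hseg t ht).2, hb (hseg t ht)⟩) 1 (Set.right_mem_Icc.2 zero_le_one) 0
      (Set.left_mem_Icc.2 zero_le_one)
    simpa using this
  obtain ⟨T, -, hTc, hT⟩ := TopologicalSpace.countable_cover_nhdsWithin hloc
  refine (hTc.image fun v => C.h (Θ v)).mono ?_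
  rintro c ⟨p, ⟨hpQ, hpO, hpc⟩, -, hpC, hc⟩
  obtain ⟨v, hv, rfl⟩ := hsurj p hpQ hpO hpc
  obtain ⟨w, hw, hvw⟩ := Set.mem_iUnion₂.1 (hT ⟨hv, hpC⟩)
  exact ⟨w, hw, hvw.symm.trans hc⟩

/-- Starting from one plaque, adjoin neighbours repeatedly. Each step keeps the set countable
because a plaque meets countably many plaques of each chart. -/
theorem exists_countable_plaques {𝒞 : Set (PlaqueChart Q r)} (h𝒞 : 𝒞.Countable)
    (P₀ : PlaqueChart Q r × Pt R) : ∃ 𝒩 : Set (PlaqueChart Q r × Pt R), 𝒩.Countable ∧ P₀ ∈ 𝒩 ∧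
    ∀ P ∈ 𝒩, ∀ C ∈ 𝒞, ∀ c, (plaque P ∩ plaque (C, c)).Nonempty → (C, c) ∈ 𝒩 := by
  let N : ℕ → Set (PlaqueChart Q r × Pt R) := fun n => Nat.rec {P₀} (fun _ S =>
    ⋃ P ∈ S, ⋃ C ∈ 𝒞, (fun c => (C, c)) '' {c | (plaque P ∩ plaque (C, c)).Nonempty}) n
  have hN : ∀ n, (N n).Countable := fun n => by
    induction n with
    | zero => exact Set.countable_singleton P₀
    | succ n ih =>
      exact ih.biUnion fun P _ => h𝒞.biUnion fun C _ => (countable_setOf_plaque_inter P C).image _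
  refine ⟨⋃ n, N n, Set.countable_iUnion hN, Set.mem_iUnion.2 ⟨0, rfl⟩, fun P hP C hC c hc => ?_⟩
  obtain ⟨n, hn⟩ := Set.mem_iUnion.1 hP
  exact Set.mem_iUnion.2 ⟨n + 1, Set.mem_iUnion₂.2 ⟨P, hn, Set.mem_iUnion₂.2 ⟨C, hC, c, hc, rfl⟩⟩⟩

/-- Tangent curves do not leave a union of plaques that is closed under taking neighbours. -/
theorem IsTangentCurve.mem_plaques_iff {γ : ℝ → Pt R} (hγ : IsTangentCurve γ (Set.Icc 0 1))
    (hQ : ∀ t ∈ Set.Icc (0 : ℝ) 1, Q ≤ (γ t).maxIdeal) {𝒞 : Set (PlaqueChart Q r)}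
    (h𝒞 : ∀ t ∈ Set.Icc (0 : ℝ) 1, ∃ C ∈ 𝒞, ⇑(γ t) ∈ C.O) {𝒩 : Set (PlaqueChart Q r × Pt R)}
    (h𝒩 : ∀ P ∈ 𝒩, ∀ C ∈ 𝒞, ∀ c, (plaque P ∩ plaque (C, c)).Nonempty → (C, c) ∈ 𝒩) :
    (∃ P ∈ 𝒩, γ 0 ∈ plaque P) ↔ ∃ P ∈ 𝒩, γ 1 ∈ plaque P := by
  -- Within a chart the curve stays in one plaque, so membership in the union is locally constant on
  -- the connected interval.
  refine (isPreconnected_Icc (a := (0 : ℝ)) (b := 1)).induction₂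
    (fun t t' => (∃ P ∈ 𝒩, γ t ∈ plaque P) ↔ ∃ P ∈ 𝒩, γ t' ∈ plaque P) (fun t ht => ?_)
    (fun _ _ _ _ _ _ h h' => h.trans h') (fun _ _ _ _ h => h.symm)
    (Set.left_mem_Icc.2 zero_le_one) (Set.right_mem_Icc.2 zero_le_one)
  obtain ⟨C, hC, htC⟩ := h𝒞 t ht
  obtain ⟨ε, hε, hb⟩ := Metric.mem_nhdsWithin_iff.1
    (hγ.continuousOn t ht (C.isOpen.mem_nhds htC))
  refine Metric.mem_nhdsWithin_iff.2 ⟨ε, hε, fun t' ht' => ?_⟩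
  have hconst := C.h_eq γ (Metric.ball t ε ∩ Set.Icc 0 1) ((convex_ball t ε).inter (convex_Icc 0 1))
    (hγ.mono Set.inter_subset_right) fun t ht => ⟨hQ t ht.2, hb ht⟩
  have key : ∀ t₁ ∈ Metric.ball t ε ∩ Set.Icc 0 1, ∀ t₂ ∈ Metric.ball t ε ∩ Set.Icc 0 1,
      (∃ P ∈ 𝒩, γ t₁ ∈ plaque P) → ∃ P ∈ 𝒩, γ t₂ ∈ plaque P := by
    rintro t₁ ht₁ t₂ ht₂ ⟨P, hP, hP₁⟩
    exact ⟨(C, C.h (γ t₁)), h𝒩 P hP C hC _ ⟨γ t₁, hP₁, hQ t₁ ht₁.2, hb ht₁, rfl⟩, hQ t₂ ht₂.2,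
      hb ht₂, hconst t₂ ht₂ t₁ ht₁⟩
  have htt : t ∈ Metric.ball t ε ∩ Set.Icc 0 1 := ⟨Metric.mem_ball_self hε, ht⟩
  exact ⟨key t htt t' ht', key t' ht' t htt⟩

/-- Restrict the holomorphic curve to the segment from 0 to z. By the chain rule the velocity is z
times the Hamiltonian field. -/
theorem HamiltonianFlow.exists_tangentCurve {x y : Pt R} (h : HamiltonianFlow x y) :
    ∃ γ : ℝ → Pt R, IsTangentCurve γ (Set.Icc 0 1) ∧ γ 0 = x ∧ γ 1 = y ∧
      ∀ t ∈ Set.Icc (0 : ℝ) 1, HamiltonianFlow x (γ t) := by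
  obtain ⟨a, r, σ, hσ, rfl, z, hz, rfl⟩ := h
  have hmem : ∀ t ∈ Set.Icc (0 : ℝ) 1, (t : ℂ) * z ∈ Metric.ball (0 : ℂ) r := fun t ht => by
    rw [mem_ball_zero_iff] at hz ⊢
    rw [norm_mul, Complex.norm_real, Real.norm_of_nonneg ht.1]
    exact (mul_le_of_le_one_left (norm_nonneg _) ht.2).trans_lt hz
  refine ⟨fun t => σ (t * z), ⟨1, fun _ => a, fun _ _ => z, ‖z‖, fun t ht => ⟨fun _ => le_rfl,
    fun f => ?_⟩⟩, by simp, by simp, fun t ht => ⟨a, r, σ, hσ, rfl, _, hmem t ht, rfl⟩⟩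
  have h1 : HasDerivAt (fun w : ℂ => w * z) z t := by simpa using (hasDerivAt_id (t : ℂ)).mul_const z
  have h2 := (HasDerivAt.comp (t : ℂ) (hσ _ (hmem t ht) f) h1).comp_ofReal
  refine h2.hasDerivWithinAt.congr_deriv ?_
  simp [mul_comm]

/-- A symplectic leaf in a subset covered by countably many plaque charts is contained in a
countable union of plaques. -/
theorem exists_plaques_leaf {𝒞 : Set (PlaqueChart Q r)} (h𝒞 : 𝒞.Countable) {X : Set (Pt R)}
    (hX : ∀ x y, HamiltonianFlow x y → (x ∈ X ↔ y ∈ X)) (hQ : ∀ x ∈ X, Q ≤ x.maxIdeal)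
    (hcov : ∀ x ∈ X, ∃ C ∈ 𝒞, ⇑x ∈ C.O) {x : Pt R} (hx : x ∈ X) :
    ∃ 𝒩 : Set (PlaqueChart Q r × Pt R), 𝒩.Countable ∧
      ∀ y ∈ symplecticLeaf x, ∃ P ∈ 𝒩, y ∈ plaque P := by
  obtain ⟨C, -, hxC⟩ := hcov x hx
  obtain ⟨𝒩, h𝒩c, h0, h𝒩⟩ := exists_countable_plaques h𝒞 (C, C.h x)
  refine ⟨𝒩, h𝒩c, fun y hy => ?_⟩
  -- Membership in X is carried through the induction, so that the charts cover every curve used.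
  have key : (x ∈ X ↔ y ∈ X) ∧
      (x ∈ X → ((∃ P ∈ 𝒩, x ∈ plaque P) ↔ ∃ P ∈ 𝒩, y ∈ plaque P)) := by
    replace hy : Relation.EqvGen HamiltonianFlow x y := hy
    clear h0 hxC hx
    induction hy with
    | rel x y h =>
      refine ⟨hX x y h, fun hx => ?_⟩
      obtain ⟨γ, hγ, rfl, rfl, hflow⟩ := h.exists_tangentCurve
      have hγX : ∀ t ∈ Set.Icc (0 : ℝ) 1, γ t ∈ X := fun t ht => (hX _ _ (hflow t ht)).1 hx
      exact hγ.mem_plaques_iff (fun t ht => hQ _ (hγX t ht)) (fun t ht => hcov _ (hγX t ht)) h𝒩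
    | refl x => exact ⟨Iff.rfl, fun _ => Iff.rfl⟩
    | symm x y _ h => exact ⟨h.1.symm, fun hy => (h.2 (h.1.2 hy)).symm⟩
    | trans x y z _ _ h h' => exact ⟨h.1.trans h'.1, fun hx => (h.2 hx).trans (h'.2 (h.1.1 hx))⟩
  exact (key.2 hx).1 ⟨_, h0, hQ x hx, hxC, rfl⟩

theorem exists_plaques (hfin : (Set.range fun x : Pt R => symplecticLeaf x).Finite)
    {𝒞 : Set (PlaqueChart Q r)} (h𝒞 : 𝒞.Countable) {X : Set (Pt R)}
    (hX : ∀ x y, HamiltonianFlow x y → (x ∈ X ↔ y ∈ X)) (hQ : ∀ x ∈ X, Q ≤ x.maxIdeal)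
    (hcov : ∀ x ∈ X, ∃ C ∈ 𝒞, ⇑x ∈ C.O) :
    ∃ 𝒩 : Set (PlaqueChart Q r × Pt R), 𝒩.Countable ∧ ∀ x ∈ X, ∃ P ∈ 𝒩, x ∈ plaque P := by
  have h : ∀ L : Set (Pt R), ∃ 𝒩 : Set (PlaqueChart Q r × Pt R), 𝒩.Countable ∧
      ∀ x ∈ X, symplecticLeaf x = L → ∀ y ∈ L, ∃ P ∈ 𝒩, y ∈ plaque P := fun L => by
    by_cases hL : ∃ x ∈ X, symplecticLeaf x = L
    · obtain ⟨x, hx, rfl⟩ := hL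
      obtain ⟨𝒩, hc, h⟩ := exists_plaques_leaf h𝒞 hX hQ hcov hx
      exact ⟨𝒩, hc, fun _ _ _ => h⟩
    · exact ⟨∅, Set.countable_empty, fun x hx hxL => (hL ⟨x, hx, hxL⟩).elim⟩
  choose 𝒩 hc h𝒩 using h
  refine ⟨⋃ L ∈ Set.range fun x : Pt R => symplecticLeaf x, 𝒩 L,
    hfin.countable.biUnion fun L _ => hc L, fun x hx => ?_⟩
  obtain ⟨P, hP, hxP⟩ := h𝒩 _ x hx rfl x (Relation.EqvGen.refl x)
  exact ⟨P, Set.mem_iUnion₂.2 ⟨_, ⟨x, rfl⟩, hP⟩, hxP⟩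

/-- The image is contained in a Lipschitz image of a part of ℂ^r, which has real dimension 2r. -/
theorem dimH_image_plaque_le (P : PlaqueChart Q r × Pt R) {d : ℕ} (b : Fin d → R) :
    dimH ((fun (p : Pt R) j => p (b j)) '' plaque P) ≤ (2 * r : ℕ) := by
  obtain ⟨Θ, V, -, hsurj, -, -, hlip⟩ := P.1.exists_plaque P.2
  choose K hK using fun j => hlip (b j)
  have hL : LipschitzOnWith (∑ j, K j) (fun v j => Θ v (b j)) V := fun v hv w hw => by
    refine edist_pi_le_iff.2 fun j => (hK j hv hw).trans ?_
    gcongr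
    exact Finset.single_le_sum (f := K) (fun _ _ => zero_le) (Finset.mem_univ j)
  have hdim : dimH (Set.univ : Set (Fin r → ℂ)) = (2 * r : ℕ) := by
    rw [Real.dimH_univ_eq_finrank]
    simp [Module.finrank_pi_fintype, mul_comm]
  rw [← hdim]
  refine (dimH_mono ?_).trans (hL.dimH_image_le.trans (dimH_mono (Set.subset_univ V)))
  rintro _ ⟨p, ⟨hpQ, hpO, hpc⟩, rfl⟩
  obtain ⟨v, hv, rfl⟩ := hsurj p hpQ hpO hpc
  exact ⟨v, hv, rfl⟩

end Plaques

/-! ### Finitely many leaves force maximal generic rank -/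

section Rank

variable {R : Type*} [CommRing R] [Algebra ℂ R] [Algebra.FiniteType ℂ R]

/-- The image of a nonempty open part of an integral scheme under a Noether normalization. -/
theorem exists_image_normalization {A : Type*} [CommRing A] [IsDomain A] [Algebra ℂ A]
    [Algebra.FiniteType ℂ A] {d : ℕ} {g : MvPolynomial (Fin d) ℂ →ₐ[ℂ] A} (hint : g.IsIntegral)
    (hinj : Function.Injective g) {u : A} (hu : u ≠ 0) : ∃ f : MvPolynomial (Fin d) ℂ, f ≠ 0 ∧
    ∀ w, MvPolynomial.eval w f ≠ 0 → ∃ x : Pt A, x u ≠ 0 ∧ ∀ j, x (g (.X j)) = w j := by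
  let : Algebra (MvPolynomial (Fin d) ℂ) A := g.toAlgebra
  have : Algebra.IsIntegral (MvPolynomial (Fin d) ℂ) A := ⟨hint⟩
  -- By integrality u has a nonzero multiple f among the polynomials. Lying over gives a point above
  -- any w, and u is nonzero there when f(w) is.
  have hne := Ideal.comap_ne_bot_of_integral_mem (R := MvPolynomial (Fin d) ℂ) hu
    (Ideal.mem_span_singleton_self u) (hint u)
  obtain ⟨f, hf, hf0⟩ := Submodule.exists_mem_ne_zero_of_ne_bot hne
  obtain ⟨e, he⟩ := Ideal.mem_span_singleton.1 (Ideal.mem_comap.1 hf)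
  refine ⟨f, hf0, fun w hw => ?_⟩
  have : (RingHom.ker (MvPolynomial.eval w)).IsPrime := RingHom.ker_isPrime _
  obtain ⟨P, hP, hPw⟩ := Ideal.exists_ideal_over_prime_of_isIntegral_of_isDomain (S := A)
    (RingHom.ker (MvPolynomial.eval w)) (by
      rw [(RingHom.injective_iff_ker_eq_bot _).1 (show Function.Injective (algebraMap _ A) from hinj)]
      exact bot_le)
  obtain ⟨x, hx, -⟩ := exists_pt_ne_zero_of_finiteType (P := P) (f := 1)
    fun h => hP.ne_top ((Ideal.eq_top_iff_one P).2 h)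
  have hxg : ∀ p, x (g p) = MvPolynomial.eval w p := fun p => by
    have h1 : p - .C (MvPolynomial.eval w p) ∈ RingHom.ker (MvPolynomial.eval w) := by
      simp [RingHom.mem_ker]
    rw [← hPw] at h1
    have h2 : x (g (p - .C (MvPolynomial.eval w p))) = 0 := hx h1
    rw [map_sub, map_sub, sub_eq_zero] at h2
    rw [h2, ← MvPolynomial.algebraMap_eq, AlgHom.commutes]
    exact AlgHomClass.commutes x _
  refine ⟨x, fun h => hw ?_, fun j => by rw [hxg, MvPolynomial.eval_X]⟩
  rw [← hxg]
  have := congrArg x he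
  rw [map_mul, h, zero_mul] at this
  exact this

theorem exists_bracketDet_notMem [PoissonAlgebra R]
    (hfin : (Set.range fun x : Pt R => symplecticLeaf x).Finite) {Q : Ideal R} [hQ : Q.IsPrime]
    (hP : IsPoissonIdeal Q) {d : ℕ} {b : Fin d → R}
    (hint : ((Ideal.Quotient.mkₐ ℂ Q).comp (MvPolynomial.aeval b)).IsIntegral)
    (hinj : Function.Injective ((Ideal.Quotient.mkₐ ℂ Q).comp (MvPolynomial.aeval (R := ℂ) b)))
    {r : ℕ} (hr : r < d) (hne : ∃ a c : Fin r → R, bracketDet a c ∉ Q) :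
    ∃ a c : Fin (r + 1) → R, bracketDet a c ∉ Q := by
  by_contra! hmax
  have : IsNoetherianRing R := Algebra.FiniteType.isNoetherianRing ℂ R
  -- Finitely many r-minors generate the ideal of all of them, so finitely many flow boxes cover the
  -- part of rank r.
  obtain ⟨D, hD, hDspan⟩ := (Submodule.fg_span_iff_fg_span_finset_subset (R := R)
    {f : R | ∃ a c : Fin r → R, f = bracketDet a c}).1 (IsNoetherian.noetherian (R := R) _)
  let I : Ideal R := Q ⊔ Ideal.span {f | ∃ a c : Fin r → R, f = bracketDet a c}
  have hI : IsPoissonIdeal I := isPoissonIdeal_sup_minors hP r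
  -- The part of V(Q) of rank r. It is stable under flows because both ideals are Poisson.
  let X : Set (Pt R) := {x | Q ≤ x.maxIdeal ∧ ¬ I ≤ x.maxIdeal}
  have hX : ∀ x y, HamiltonianFlow x y → (x ∈ X ↔ y ∈ X) := fun x y h =>
    and_congr (h.le_maxIdeal_iff hP) (not_congr (h.le_maxIdeal_iff hI))
  have hcharts : ∀ Δ : R, ∃ 𝒞 : Set (PlaqueChart Q r), 𝒞.Countable ∧ (Δ ∈ D →
      ∀ p : Pt R, Q ≤ p.maxIdeal → p Δ ≠ 0 → ∃ C ∈ 𝒞, ⇑p ∈ C.O) := fun Δ => by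
    by_cases hΔ : Δ ∈ D
    swap
    · exact ⟨∅, Set.countable_empty, fun h => (hΔ h).elim⟩
    obtain ⟨a, c, rfl⟩ := hD hΔ
    obtain ⟨s, hs⟩ := Algebra.FiniteType.out (R := ℂ)
      (A := Localization.Away (Ideal.Quotient.mk Q (bracketDet a c)))
    obtain ⟨F⟩ := exists_flowBox hP a c hmax
      (B := Localization.Away (Ideal.Quotient.mk Q (bracketDet a c)))
    obtain ⟨𝒞, hc, h⟩ := F.exists_charts hs
    exact ⟨𝒞, hc, fun _ => h⟩
  choose 𝒞 h𝒞c h𝒞 using hcharts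
  obtain ⟨𝒩, h𝒩c, h𝒩⟩ := exists_plaques hfin
    (𝒞 := ⋃ Δ ∈ D, 𝒞 Δ) (D.countable_toSet.biUnion fun Δ _ => h𝒞c Δ) hX (fun x hx => hx.1)
    fun x hx => by
      obtain ⟨Δ, hΔ, hxΔ⟩ : ∃ Δ ∈ D, x Δ ≠ 0 := by
        by_contra! h
        refine hx.2 (sup_le hx.1 ?_)
        rw [Ideal.span, hDspan]
        exact Ideal.span_le.2 h
      obtain ⟨C, hC, hxC⟩ := h𝒞 Δ hΔ x hx.1 hxΔ
      exact ⟨C, Set.mem_iUnion₂.2 ⟨Δ, hΔ, hC⟩, hxC⟩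
  obtain ⟨a, c, hac⟩ := hne
  obtain ⟨f, hf0, hf⟩ := exists_image_normalization hint hinj (u := Ideal.Quotient.mk Q
    (bracketDet a c)) fun h => hac (Ideal.Quotient.eq_zero_iff_mem.1 h)
  have hU : {w | MvPolynomial.eval w f ≠ 0} ⊆
      ⋃ P ∈ 𝒩, (fun (p : Pt R) j => p (b j)) '' plaque P := fun w hw => by
    obtain ⟨x, hxu, hxw⟩ := hf w hw
    let p : Pt R := x.toAlgHom.comp (Ideal.Quotient.mkₐ ℂ Q)
    have hp : ∀ f, p f = x (Ideal.Quotient.mk Q f) := fun f => rfl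
    have hpX : p ∈ X := by
      refine ⟨fun f hf => ?_, fun h => hxu ?_⟩
      · rw [Pt.mem_maxIdeal, hp, Ideal.Quotient.eq_zero_iff_mem.2 hf, map_zero]
      · exact h (Ideal.mem_sup_right (Ideal.subset_span ⟨a, c, rfl⟩))
    obtain ⟨P, hPP, hpP⟩ := h𝒩 p hpX
    refine Set.mem_iUnion₂.2 ⟨P, hPP, p, hpP, funext fun j => ?_⟩
    rw [← hxw j]
    simp [hp]
  have hopen : IsOpen {w : Fin d → ℂ | MvPolynomial.eval w f ≠ 0} :=
    isOpen_ne_fun (MvPolynomial.continuous_eval f) continuous_const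
  have hnonempty : {w : Fin d → ℂ | MvPolynomial.eval w f ≠ 0}.Nonempty := by
    by_contra h
    refine hf0 (MvPolynomial.funext fun w => ?_)
    rw [map_zero]
    by_contra hw
    exact h ⟨w, hw⟩
  -- A nonempty open subset of ℂ^d has dimension 2d, but a countable union of plaque images has
  -- dimension at most 2r < 2d.
  have h1 := dimH_mono hU
  rw [Real.dimH_of_nonempty_interior (by rwa [hopen.interior_eq]), dimH_bUnion h𝒩c] at h1
  have h2 := h1.trans (iSup₂_le fun P _ => dimH_image_plaque_le P b)
  simp only [Module.finrank_pi_fintype, Complex.finrank_real_complex, Finset.sum_const,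
    Finset.card_univ, Fintype.card_fin, smul_eq_mul, Nat.cast_le] at h2
  omega

theorem exists_det_bracket_ne_zero [PoissonAlgebra R]
    (hfin : (Set.range fun x : Pt R => symplecticLeaf x).Finite) {Q : Ideal R} [Q.IsPrime]
    (hP : IsPoissonIdeal Q) {d : ℕ}
    (c : Coordinates ((IsScalarTower.toAlgHom ℂ (R ⧸ Q) (FractionRing (R ⧸ Q))).comp
      (Ideal.Quotient.mkₐ ℂ Q)) d)
    (hint : ((Ideal.Quotient.mkₐ ℂ Q).comp (MvPolynomial.aeval c.b)).IsIntegral)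
    (hinj : Function.Injective ((Ideal.Quotient.mkₐ ℂ Q).comp (MvPolynomial.aeval c.b))) :
    ∃ a : Fin d → R, (Matrix.of fun i j => ((IsScalarTower.toAlgHom ℂ (R ⧸ Q) (FractionRing (R ⧸ Q))).comp
      (Ideal.Quotient.mkₐ ℂ Q)) (bracket (a i) (c.b j))).det ≠ 0 := by
  let K := FractionRing (R ⧸ Q)
  have hrank : ∀ r ≤ d, ∃ a c : Fin r → R, bracketDet a c ∉ Q := fun r => by
    induction r with
    | zero =>
      refine fun _ => ⟨Fin.elim0, Fin.elim0, fun h => ?_⟩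
      rw [bracketDet, Matrix.det_isEmpty] at h
      exact ‹Q.IsPrime›.ne_top ((Ideal.eq_top_iff_one Q).2 h)
    | succ r ih =>
      exact fun hr => exists_bracketDet_notMem hfin hP hint hinj hr (ih (Nat.le_of_succ_le hr))
  obtain ⟨a, e, hae⟩ := hrank d le_rfl
  have : Algebra.FormallyEtale (R ⧸ Q) K := Algebra.FormallyEtale.of_isLocalization
    (nonZeroDivisors (R ⧸ Q))
  choose D hD using fun a => exists_hamiltonian_extension (B := K) hP a
  let φ : R →ₐ[ℂ] K := (IsScalarTower.toAlgHom ℂ (R ⧸ Q) K).comp (Ideal.Quotient.mkₐ ℂ Q)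
  replace hD : ∀ a f, D a (φ f) = φ (bracket a f) := hD
  refine ⟨a, fun h0 => hae (Ideal.Quotient.eq_zero_iff_mem.1
    ((map_eq_zero_iff _ (IsFractionRing.injective (R ⧸ Q) K)).1 ?_))⟩
  -- The chain rule in the coordinates b factors the nonzero minor through the matrix of the {a_i,
  -- b_j}, which is therefore invertible.
  have h1 : (Matrix.of fun i j => φ (bracket (a i) (e j))) =
      (Matrix.of fun i j => φ (bracket (a i) (c.b j))) * Matrix.of fun j k => c.der j (φ (e k)) := by
    ext i k
    rw [Matrix.mul_apply]
    simp only [Matrix.of_apply]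
    rw [← hD, c.derivation_eq]
    exact Finset.sum_congr rfl fun j _ => congrArg (· * _) (hD (a i) (c.b j))
  refine (map_bracketDet φ.toRingHom a e).trans ?_
  exact (congrArg Matrix.det h1).trans (by rw [Matrix.det_mul, h0, zero_mul])

end Rank
end ArcPoisson

namespace ArcPoisson
open ArcPoisson.Arc (ι T nprod)
open ArcPoisson.PoissonAlgebra (bracket)

/-! ### Arc spaces and chiral cores over a prime Poisson ideal -/

section ArcSets

variable {R : Type*} [CommRing R] [Algebra ℂ R]

theorem constArc_ι (x : Pt R) (f : R) : constArc x (ι f) = x f := Arc.lift_ι _ _ _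

theorem basePt_constArc (x : Pt R) : basePt (constArc x) = x :=
  DFunLike.ext _ _ fun f => constArc_ι x f

theorem constArc_T (x : Pt R) (u : Arc R) : constArc x (T u) = 0 := Arc.lift_T _ _ _

theorem constArc_iterate_T (x : Pt R) (f : R) (hf : x f = 0) (j : ℕ) :
    constArc x (T^[j] (ι f)) = 0 := by
  cases j with
  | zero => exact (constArc_ι x f).trans hf
  | succ j => rw [Function.iterate_succ_apply', constArc_T]

theorem constArc_mem_arcSet {x : Pt R} {S : Set (Pt R)} : constArc x ∈ arcSet S ↔ x ∈ S := by
  refine ⟨fun h => ?_, fun h => ⟨fun f hf j => constArc_iterate_T x f (hf x h) j, ?_⟩⟩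
  · rw [← basePt_constArc x]; exact h.2
  · rw [basePt_constArc]; exact h

theorem continuous_basePt : Continuous (basePt : Pt (Arc R) → Pt R) := by
  refine continuous_iff_isClosed.2 fun S hS => ?_
  obtain ⟨I, rfl⟩ := Pt.isClosed_iff.1 hS
  refine Pt.isClosed_iff.2 ⟨I.map (ι : R →ₐ[ℂ] Arc R), ?_⟩
  ext y
  change I ≤ (y.maxIdeal).comap (ι : R →ₐ[ℂ] Arc R) ↔ I.map (ι : R →ₐ[ℂ] Arc R) ≤ y.maxIdeal
  exact Ideal.map_le_iff_le_comap.symm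

theorem diffIdeal_le_iff {Q : Ideal R} {y : Pt (Arc R)} :
    diffIdeal Q ≤ y.maxIdeal ↔ ∀ f ∈ Q, ∀ j, y (T^[j] (ι f)) = 0 := by
  refine ⟨fun h f hf j => h (iterate_T_mem_diffIdeal hf j), fun h => Ideal.span_le.2 ?_⟩
  rintro _ ⟨f, hf, j, rfl⟩
  exact h f hf j

theorem mem_arcSet_iff {S : Set (Pt R)} {y : Pt (Arc R)} :
    y ∈ arcSet S ↔ diffIdeal (vanIdeal S) ≤ y.maxIdeal ∧ basePt y ∈ S := by
  rw [diffIdeal_le_iff]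
  simp only [mem_vanIdeal]
  rfl

theorem le_maxIdeal_basePt {Q : Ideal R} {y : Pt (Arc R)} (h : diffIdeal Q ≤ y.maxIdeal) :
    Q ≤ (basePt y).maxIdeal := fun _ hf => h (ι_mem_diffIdeal hf)

theorem closure_inter_of_isIrreducible {X : Type*} [TopologicalSpace X] {Z U : Set X}
    (hZ : IsIrreducible Z) (hc : IsClosed Z) (hU : IsOpen U) (hne : (Z ∩ U).Nonempty) :
    closure (Z ∩ U) = Z :=
  subset_antisymm (closure_minimal Set.inter_subset_left hc)
    (subset_closure_inter_of_isPreirreducible_of_isOpen hZ.isPreirreducible hU hne)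

variable [Algebra.FiniteType ℂ R]

theorem mem_arcSet_zeroLocus {Q : Ideal R} [Q.IsPrime] {y : Pt (Arc R)} :
    y ∈ arcSet {x : Pt R | Q ≤ x.maxIdeal} ↔ diffIdeal Q ≤ y.maxIdeal := by
  rw [mem_arcSet_iff, vanIdeal_zeroLocus fun f hf => exists_pt_ne_zero_of_finiteType hf]
  exact and_iff_left_of_imp le_maxIdeal_basePt

/-- The elements T^j a, for a in a finite generating set of R, suffice. This makes the
Nullstellensatz available on the arc space. -/
theorem exists_countable_adjoin_arc :
    ∃ s : Set (Arc R), s.Countable ∧ Algebra.adjoin ℂ s = ⊤ := by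
  obtain ⟨t, ht⟩ := Algebra.FiniteType.out (R := ℂ) (A := R)
  let s : Set (Arc R) := Set.range fun p : t × ℕ => T^[p.2] (ι p.1.1)
  have hs : ∀ u ∈ Algebra.adjoin ℂ s, T u ∈ Algebra.adjoin ℂ s := fun u hu => by
    induction hu using Algebra.adjoin_induction with
    | mem u hu =>
      obtain ⟨p, rfl⟩ := hu
      exact Algebra.subset_adjoin ⟨(p.1, p.2 + 1), Function.iterate_succ_apply' _ _ _⟩
    | algebraMap c => rw [Derivation.map_algebraMap]; exact zero_mem _
    | add u v _ _ hu hv => rw [map_add]; exact add_mem hu hv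
    | mul u v hu' hv' hu hv =>
      rw [Derivation.leibniz]
      exact add_mem (mul_mem hu' hv) (mul_mem hv' hu)
  refine ⟨s, Set.countable_range _, top_le_iff.1 fun u _ => ?_⟩
  induction u using Arc.induction with
  | hι a =>
    have ha : a ∈ Algebra.adjoin ℂ (t : Set R) := ht ▸ Algebra.mem_top
    clear * - ha
    induction ha using Algebra.adjoin_induction with
    | mem a ha => exact Algebra.subset_adjoin ⟨(⟨a, ha⟩, 0), rfl⟩
    | algebraMap c => rw [AlgHom.commutes]; exact Subalgebra.algebraMap_mem _ _
    | add u v _ _ hu hv => rw [map_add]; exact add_mem hu hv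
    | mul u v _ _ hu hv => rw [map_mul]; exact mul_mem hu hv
  | hT u hu => exact hs u (hu trivial)
  | hadd u v hu hv => exact add_mem (hu trivial) (hv trivial)
  | hmul u v hu hv => exact mul_mem (hu trivial) (hv trivial)

theorem isIrreducible_zeroLocus_arc {N : Ideal (Arc R)} [N.IsPrime] :
    IsIrreducible {y : Pt (Arc R) | N ≤ y.maxIdeal} := by
  obtain ⟨s, hs, hadj⟩ := exists_countable_adjoin_arc (R := R)
  exact isIrreducible_of_prime fun f hf => exists_pt_ne_zero hs hadj hf

-- The largest T-stable ideal inside 𝔪_y is prime, and its contraction to R consists of the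
-- functions vanishing along the whole arc. A minimal prime lies below this contraction.
omit [Algebra.FiniteType ℂ R] in
theorem exists_minimalPrime_diffIdeal_le (y : Pt (Arc R)) :
    ∃ Q ∈ minimalPrimes R, diffIdeal Q ≤ y.maxIdeal := by
  have := derivCore_isPrime (D := (T : Derivation ℂ (Arc R) (Arc R))) (P := y.maxIdeal)
  obtain ⟨Q, hQ, hle⟩ := Ideal.exists_minimalPrimes_le
    (J := (derivCore T y.maxIdeal).comap (ι : R →ₐ[ℂ] Arc R)) bot_le
  exact ⟨Q, hQ, diffIdeal_le_iff.2 fun f hf j => hle hf j⟩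

variable [PoissonAlgebra R]

theorem exists_chiralPoissonCore_eq
    {Q : Ideal R} [Q.IsPrime] (hQ : IsPoissonIdeal Q) {K : Type*} [Field K] [Algebra ℂ K] {φ : R →ₐ[ℂ] K}
    (hker : RingHom.ker φ = Q) {d : ℕ} (c : Coordinates φ d) {a : Fin d → R}
    (ha : (Matrix.of fun i j => φ (bracket (a i) (c.b j))).det ≠ 0) :
    ∃ N : Ideal (Arc R), N.IsPrime ∧
      (∀ y : Pt (Arc R), N ≤ y.maxIdeal ↔ diffIdeal Q ≤ y.maxIdeal) ∧
      ∀ y : Pt (Arc R), diffIdeal Q ≤ y.maxIdeal → poissonCore (basePt y).maxIdeal = Q →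
        chiralPoissonCore y.maxIdeal = N := by
  have hφ : ∀ f, φ f = 0 ↔ f ∈ Q := fun f => by rw [← hker, RingHom.mem_ker]
  obtain ⟨N, hN, hmem, hjet⟩ := exists_genericIdeal c
  have hle : diffIdeal Q ≤ N := fun u hu => (hmem u).2
    ⟨1, by simp, by rw [hker, map_one, one_mul]; exact hu⟩
  have hNy : ∀ y : Pt (Arc R), diffIdeal Q ≤ y.maxIdeal → N ≤ y.maxIdeal := fun y hy F hF => by
    obtain ⟨g, hg, h⟩ := (hmem F).1 hF
    rw [hker] at h
    exact eq_zero_of_mul_mem_diffIdeal hy (fun h => hg ((hφ g).2 h)) h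
  refine ⟨N, hN, fun y => ⟨hle.trans, hNy y⟩, fun y hy hcore => le_antisymm ?_ ?_⟩
  · refine sSup_le fun J ⟨hJ, hJy⟩ => ?_
    by_contra hJN
    obtain ⟨F, hF, hFN⟩ := SetLike.not_le_iff_exists.1 hJN
    have hJ' : IsChiralPoissonIdeal (J ⊔ diffIdeal Q) :=
      isChiralPoissonIdeal_sup hJ (isChiralPoissonIdeal_diffIdeal hQ)
    obtain ⟨g, hg, _, ⟨p, rfl⟩, hp⟩ := isJetPoly c F
    rw [hker] at hp
    have hpJ : jetEval c.b p ∈ J ⊔ diffIdeal Q := by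
      have := sub_mem (Ideal.mul_mem_left _ (ι g) (Ideal.mem_sup_left hF))
        (Ideal.mem_sup_right (S := J) hp)
      simpa using this
    -- If p vanished over K, then g F would lie in the prime N, so g would, as F does not. A
    -- constant arc at a point of V(Q) where g' g is nonzero excludes this.
    have hp0 : MvPolynomial.map φ.toRingHom p ≠ 0 := fun h0 => by
      rw [← hjet] at h0
      have := add_mem (hle hp) h0
      rw [sub_add_cancel] at this
      refine (hN.mem_or_mem this).elim (fun h => ?_) hFN
      obtain ⟨g', hg', h'⟩ := (hmem _).1 h
      rw [hker, ← map_mul] at h'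
      obtain ⟨z, hz, hz'⟩ := exists_pt_ne_zero_of_finiteType (P := Q) (f := g' * g) fun h =>
        mul_ne_zero hg' hg (by rw [← map_mul]; exact (hφ _).2 h)
      refine hz' ?_
      rw [← constArc_ι]
      exact diffIdeal_le_iff.2 (fun f hf j => constArc_iterate_T z f (hz hf) j) h'
    obtain ⟨u, hu, huJ⟩ := exists_ι_mem_of_chiral c ha hJ' (by rw [hker]; exact le_sup_right) hpJ hp0
    -- The contraction of the chiral ideal to R is a Poisson ideal inside the maximal ideal of the
    -- base point, hence inside its core Q, although u ∉ Q.
    refine hu ((hφ u).2 (hcore ▸ ?_))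
    refine le_poissonCore (isPoissonIdeal_comap_ι hJ') (fun f hf => ?_) huJ
    exact (sup_le hJy hy : _ ≤ y.maxIdeal) hf
  · refine (isGreatest_chiralPoissonCore _).2 ⟨?_, hNy y hy⟩
    exact isChiralPoissonIdeal_generic (φ := φ) (by rw [hker]; exact hQ) hmem

theorem exists_generic_chiralPoissonCore
    (hfin : (Set.range fun x : Pt R => symplecticLeaf x).Finite) {Q : Ideal R} [Q.IsPrime]
    (hQ : IsPoissonIdeal Q) : ∃ N : Ideal (Arc R), N.IsPrime ∧
      (∀ y : Pt (Arc R), N ≤ y.maxIdeal ↔ diffIdeal Q ≤ y.maxIdeal) ∧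
      ∀ y : Pt (Arc R), diffIdeal Q ≤ y.maxIdeal → poissonCore (basePt y).maxIdeal = Q →
        chiralPoissonCore y.maxIdeal = N := by
  obtain ⟨d, c, hint, hinj⟩ := exists_coordinates (R := R) (Q := Q)
  obtain ⟨a, ha⟩ := exists_det_bracket_ne_zero hfin hQ c hint hinj
  refine exists_chiralPoissonCore_eq hQ (Ideal.ext fun f => ?_) c ha
  rw [← Ideal.Quotient.eq_zero_iff_mem (I := Q)]
  exact map_eq_zero_iff _ (FaithfulSMul.algebraMap_injective (R ⧸ Q) (FractionRing (R ⧸ Q)))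

/-- The closures of symplectic cores and their arc spaces, for a prime Poisson ideal. -/
theorem arcSet_closures (hfin : (Set.range fun x : Pt R => symplecticLeaf x).Finite)
    {Q : Ideal R} [hQp : Q.IsPrime] (hQ : IsPoissonIdeal Q) {Y : Set (Pt R)}
    (hY : Y = {x : Pt R | Q ≤ x.maxIdeal}) :
    IsIrreducible (arcSet Y) ∧ IsClosed (arcSet Y) ∧ (∃ x ∈ Y, Y = closure (symplecticCore x)) ∧
      ∀ x : Pt R, Y = closure (symplecticCore x) →
        IsLocallyClosed (symplecticCore x) ∧
        arcSet Y = closure (arcSet (symplecticCore x)) ∧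
        arcSet Y = closure (chiralSymplecticCore (constArc x)) := by
  have hnull : ∀ f ∉ Q, ∃ x : Pt R, Q ≤ x.maxIdeal ∧ x f ≠ 0 := fun f hf =>
    exists_pt_ne_zero_of_finiteType hf
  have hYc : IsClosed Y := Pt.isClosed_iff.2 ⟨Q, hY⟩
  have hYi : IsIrreducible Y := hY ▸ isIrreducible_of_prime hnull
  have hYv : vanIdeal Y = Q := hY ▸ vanIdeal_zeroLocus hnull
  obtain ⟨U, hU, hUmem⟩ := exists_isOpen_poissonCore_eq_iff (finite_poissonCores hfin) hQ
  obtain ⟨N, hN, hNy, hcore⟩ := exists_generic_chiralPoissonCore hfin hQ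
  have harc : arcSet Y = {y | N ≤ y.maxIdeal} := by
    ext y
    rw [hY, mem_arcSet_zeroLocus, ← hNy]; rfl
  have hZi : IsIrreducible (arcSet Y) := harc ▸ isIrreducible_zeroLocus_arc
  have hZc : IsClosed (arcSet Y) := Pt.isClosed_iff.2 ⟨N, harc⟩
  have hsc : ∀ x : Pt R, poissonCore x.maxIdeal = Q → symplecticCore x = Y ∩ U := fun x hx => by
    ext y
    change poissonCore y.maxIdeal = poissonCore x.maxIdeal ↔ _
    rw [hx, hUmem, hY]; rfl
  have hclos : ∀ x : Pt R, poissonCore x.maxIdeal = Q → Y = closure (symplecticCore x) :=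
    fun x hx => by
      rw [hsc x hx, closure_inter_of_isIrreducible hYi hYc hU ⟨x, hsc x hx ▸ rfl⟩]
  refine ⟨hZi, hZc, ?_, fun x hx => ?_⟩
  · obtain ⟨x, hx⟩ := exists_poissonCore_eq (finite_poissonCores hfin) hQ
    refine ⟨x, ?_, hclos x hx⟩
    rw [hY, ← hx]
    exact poissonCore_le _
  · have hxY : x ∈ Y := hx ▸ subset_closure rfl
    -- The core of x vanishes on the symplectic core of x, hence on its closure Y, so it lies in the
    -- vanishing ideal Q of Y. The other inclusion holds because Q is Poisson.
    have hxQ : poissonCore x.maxIdeal = Q := by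
      refine le_antisymm ?_ (le_poissonCore hQ (by rw [hY] at hxY; exact hxY))
      rw [← hYv, hx]
      intro f hf
      rw [mem_vanIdeal, ← hx]
      intro y hy
      have : closure (symplecticCore x) ⊆ {y | poissonCore x.maxIdeal ≤ y.maxIdeal} :=
        closure_minimal (fun y hy => by
          change poissonCore y.maxIdeal = _ at hy
          rw [Set.mem_ofPred_eq, ← hy]
          exact poissonCore_le _) (Pt.isClosed_iff.2 ⟨_, rfl⟩)
      exact this (hx ▸ hy) hf
    have hv : vanIdeal (symplecticCore x) = Q := by
      rw [← hYv, hx]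
      ext f
      rw [mem_vanIdeal, mem_vanIdeal]
      refine ⟨fun h y hy => ?_, fun h y hy => h y (subset_closure hy)⟩
      rw [closure_eq_zeroLocus] at hy
      exact hy (mem_vanIdeal.2 h)
    -- Both sides require the arc to lie in V(Q). What distinguishes them is the open condition on
    -- the base point.
    have hcs : arcSet (symplecticCore x) = arcSet Y ∩ basePt ⁻¹' U := by
      ext y
      rw [Set.mem_inter_iff, mem_arcSet_iff, mem_arcSet_iff, hv, hYv, hsc x hxQ]
      exact and_assoc.symm
    have h1 : closure (arcSet (symplecticCore x)) = arcSet Y := by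
      rw [hcs]
      refine closure_inter_of_isIrreducible hZi hZc (hU.preimage continuous_basePt)
        ⟨constArc x, ?_⟩
      rw [← hcs, constArc_mem_arcSet]
      rfl
    have hcx : chiralPoissonCore (constArc x).maxIdeal = N := by
      refine hcore _ ((hNy _).1 ?_) (by rw [basePt_constArc, hxQ])
      have := constArc_mem_arcSet.2 hxY
      rwa [harc] at this
    -- The chiral symplectic core lies between the arcs of the symplectic core and the arcs of Y,
    -- and the former are dense in the latter.
    refine ⟨?_, h1.symm, subset_antisymm ?_ (closure_minimal ?_ hZc)⟩
    · rw [hsc x hxQ]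
      exact hYc.isLocallyClosed.inter hU.isLocallyClosed
    · rw [← h1]
      refine closure_mono fun y hy => ?_
      change chiralPoissonCore y.maxIdeal = _
      rw [hcx]
      obtain ⟨hy1, hy2⟩ := mem_arcSet_iff.1 hy
      exact hcore y (hv ▸ hy1) (hy2.trans hxQ)
    · intro y hy
      change chiralPoissonCore y.maxIdeal = _ at hy
      rw [harc]
      change N ≤ _
      rw [← hcx, ← hy]
      exact (isGreatest_chiralPoissonCore _).1.2

end ArcSets
end ArcPoisson

/-! ### Assembly over the irreducible components -/

open ArcPoisson
theorem mainTheorem4 {R : Type*} [CommRing R] [Algebra ℂ R] [Algebra.FiniteType ℂ R]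
    [PoissonAlgebra R]
    (hfin : (Set.range fun x : Pt R => symplecticLeaf x).Finite) :
    (∀ Z ∈ irreducibleComponents (Pt (Arc R)),
      ∃ y : Pt (Arc R), Z = closure (chiralSymplecticCore y)) ∧
    irreducibleComponents (Pt (Arc R)) = arcSet '' irreducibleComponents (Pt R) ∧
    ∀ Y ∈ irreducibleComponents (Pt R),
      (∃ x ∈ Y, Y = closure (symplecticCore x)) ∧
      ∀ x : Pt R, Y = closure (symplecticCore x) →
        IsLocallyClosed (symplecticCore x) ∧
        arcSet Y = closure (arcSet (symplecticCore x)) ∧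
        arcSet Y = closure (chiralSymplecticCore (constArc x)) := by
  have : IsNoetherianRing R := Algebra.FiniteType.isNoetherianRing ℂ R
  have key : ∀ Y ∈ irreducibleComponents (Pt R), IsIrreducible (arcSet Y) ∧ IsClosed (arcSet Y) ∧
      (∃ x ∈ Y, Y = closure (symplecticCore x)) ∧
      ∀ x : Pt R, Y = closure (symplecticCore x) →
        IsLocallyClosed (symplecticCore x) ∧
        arcSet Y = closure (arcSet (symplecticCore x)) ∧
        arcSet Y = closure (chiralSymplecticCore (constArc x)) := fun Y hY => by
    rw [irreducibleComponents_pt] at hY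
    obtain ⟨Q, hQ, rfl⟩ := hY
    have : Q.IsPrime := hQ.1.1
    exact arcSet_closures hfin (isPoissonIdeal_of_mem_minimalPrimes hQ) rfl
  have hfinite : (irreducibleComponents (Pt R)).Finite := by
    rw [irreducibleComponents_pt]
    exact (minimalPrimes.finite_of_isNoetherianRing R).image _
  have hcover : ∀ y : Pt (Arc R), ∃ Y ∈ irreducibleComponents (Pt R), y ∈ arcSet Y := fun y => by
    obtain ⟨Q, hQ, hle⟩ := exists_minimalPrime_diffIdeal_le y
    have : Q.IsPrime := hQ.1.1
    refine ⟨_, ?_, mem_arcSet_zeroLocus.2 hle⟩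
    rw [irreducibleComponents_pt]
    exact ⟨Q, hQ, rfl⟩
  have hsub : ∀ Z : Set (Pt (Arc R)), IsIrreducible Z →
      ∃ Y ∈ irreducibleComponents (Pt R), Z ⊆ arcSet Y := fun Z hZ => by
    classical
    -- An irreducible set covered by finitely many closed sets lies in one of them.
    obtain ⟨W, hW, hZW⟩ := isIrreducible_iff_sUnion_isClosed.1 hZ (hfinite.image arcSet).toFinset
      (fun W hW => by
        rw [Set.Finite.mem_toFinset] at hW
        obtain ⟨Y, hY, rfl⟩ := hW
        exact (key Y hY).2.1) fun y _ => by
        obtain ⟨Y, hY, hy⟩ := hcover y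
        exact ⟨_, by simpa using ⟨Y, hY, rfl⟩, hy⟩
    rw [Set.Finite.mem_toFinset] at hW
    obtain ⟨Y, hY, rfl⟩ := hW
    exact ⟨Y, hY, hZW⟩
  have hcomp : irreducibleComponents (Pt (Arc R)) = arcSet '' irreducibleComponents (Pt R) := by
    ext Z
    constructor
    · intro hZ
      obtain ⟨Y, hY, hZY⟩ := hsub Z hZ.1
      exact ⟨Y, hY, subset_antisymm (hZ.2 (key Y hY).1 hZY) hZY⟩
    · rintro ⟨Y, hY, rfl⟩
      refine ⟨(key Y hY).1, fun Z hZ hYZ => ?_⟩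
      obtain ⟨Y', hY', hZY'⟩ := hsub Z hZ
      -- Constant arcs recover Y from its arc space, so inclusions between arc spaces descend to the
      -- components.
      have hYY' : Y ⊆ Y' := fun x hx =>
        constArc_mem_arcSet.1 (hZY' (hYZ (constArc_mem_arcSet.2 hx)))
      have := subset_antisymm (hY.2 hY'.1 hYY') hYY'
      exact this ▸ hZY'
  refine ⟨fun Z hZ => ?_, hcomp, fun Y hY => (key Y hY).2.2⟩
  rw [hcomp] at hZ
  obtain ⟨Y, hY, rfl⟩ := hZ
  obtain ⟨x, -, hx⟩ := (key Y hY).2.2.1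
  exact ⟨_, ((key Y hY).2.2.2 x hx).2.2⟩
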